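/- Let $n\ge 1$, let $\rho\in\mathbb{C}^{2^n\times 2^n}$ be an $n$-qubit state (density matrix), and let $\Lambda\in(0,1)$ be a lower bound on all non-zero eigenvalues of $\rho$. Let $\epsilon,\delta\in(0,1)$, let $S(\rho)=-\operatorname{tr}(\rho\ln\rho)$, and suppose that copies of $\rho$ are freely available. **The algorithm.** Put $\eta=\epsilon/3$ and $$K=\Big\lceil\frac{\ln(4/(\eta\Lambda))}{\ln(1/(1-\Lambda))}\Big\rceil,\quad r=\frac{4\sum_{k=1}^K 1/k}{\eta},\quad L=\frac{\ln r}{\Lambda^2},\quad M_l=\Big\lceil\sqrt{\tfrac{l}{2}\ln r}\Big\rceil .$$ Let $b_l^{(1)}=0$ for even $l$, $b_l^{(1)}=\frac{2}{\pi 2^{l-1}l}\binom{l-1}{(l-1)/2}$ for odd $l$, $b_l^{(k+1)}=\sum_{l'=0}^{l}b_{l'}^{(k)}b_{l-l'}^{(1)}$, and $$f(s,l)=\Big(\sum_{k=1}^K\frac{b_l^{(k)}}{k}\Big)\frac{1}{2^l}\binom{l}{s}\qquad\Big(0\le l\le\lfloor L\rfloor,\ \ \max\{0,\lfloor\tfrac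 l2\rfloor-M_l\}\le s\le\min\{l,\lceil\tfrac l2\rceil+M_l\}\Big).$$ Let $\|\mathbf f\|_{\ell_1}$ be the sum of these weights, $\varepsilon=\eta/\|\mathbf f\|_{\ell_1}$, $N=\sum_{l=0}^{\lfloor L\rfloor}(2M_l+1)$, $B=\lceil 4\ln(2/\delta)/\varepsilon^2\rceil$ and $R=\lceil 16\ln(2N/\delta)/\varepsilon^2\rceil$. Repeat independently for $j=1,\dots,B$: sample a pair $(s,l)$ with probability $f(s,l)/\|\mathbf f\|_{\ell_1}$; put $t=(2s-l)\pi/2$, $Q=\lceil t^2/\varepsilon\rceil$ and $\Delta=t/Q$; construct the circuit described below, execute it $R$ times, each time on fresh copies of $\rho$, and let $\mathrm{est}_j$ be the average of the outcomes ($+1$ for the result $0$, $-1$ for the result $1$). Return $\|\mathbf f\|_{\ell_1}\cdot\frac1B\sum_{j}\mathrm{est}_j$. **The circuit.** It has a measure qubit, two ancillas, one more ancilla for controlled swaps (all initially $|0\rangle$), and a main and an ancillary register of $n$ qubits each. A copy of $\rho$ is loaded into the main register and a Hadamard gate is applied to the measure qubit. Then the following is done $Q$ times: the ancillary register is discarded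 and reset to a fresh copy of $\rho$, and $A=-W(I-2P)W^\dagger(I-2P)W$ is applied, controlled by the measure qubit. Finally a Hadamard gate is applied to the measure qubit, which is measured in the computational basis. Here $P=|00\rangle\langle 00|$ on the two ancillas and $W=R_2^\dagger\cdot\mathrm{select}(\mathcal S)\cdot(\text{oc-}R_2)\cdot R_1$. The rotation $R_1$ acts on the first ancilla, $R_2$ acts on the second one, and oc-$R_2$ is $R_2$ controlled by the first ancilla being in the state $|0\rangle$. With $\alpha=\cos\Delta+|\sin\Delta|$, $R_1|0\rangle=\frac{\alpha}{2}|0\rangle+\sqrt{1-\alpha^2/4}\,|1\rangle$ and $R_2|0\rangle=\sqrt{\cos\Delta/\alpha}\,|0\rangle+\sqrt{|\sin\Delta|/\alpha}\,|1\rangle$. Moreover $\mathrm{select}(\mathcal S)=|0\rangle\langle 0|\otimes I+|1\rangle\langle 1|\otimes(-i\,\mathrm{sgn}\,\Delta)\mathcal S$ on the second ancilla and the two registers, where $\mathcal S$ is the swap of the registers. Everything is decomposed into single- and two-qubit gates: a Toffoli gate or a doubly controlled $Z$ into five controlled one-qubit gates, a controlled swap of two qubits into two CNOTs and a Toffoli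 gate. **Theorem.** There are absolute constants $C>0$ and $k\in\mathbb N$ such that for all $n,\rho,\Lambda,\epsilon,\delta$ as above the output $\widehat S$ of the algorithm satisfies $\Pr[|\widehat S-S(\rho)|\le\epsilon]\ge 1-\delta$, and in every run (worst case) * the total number of copies of $\rho$ consumed, over all executions of all circuits, is at most $C\ln^k\!\big(\tfrac{3}{\epsilon\delta\Lambda}\big)\cdot\frac{1}{\epsilon^5\Lambda^2}$, that is, $\widetilde O(1/(\epsilon^5\Lambda^2))$; * the total number of single/two-qubit gates of the $B$ constructed circuits (each circuit counted once, not once per repeated execution) is at most $C\ln^k\!\big(\tfrac{3}{\epsilon\delta\Lambda}\big)\cdot\frac{n}{\epsilon^3\Lambda^2}$, that is, $\widetilde O(n/(\epsilon^3\Lambda^2))$. -/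

import Mathlib

open scoped ENNReal ComplexOrder

noncomputable section

namespace EntropyEstimation

/-! ## Quantum states and the von Neumann entropy -/

/-- A density matrix on a system whose computational basis is indexed by `ι`. -/
structure IsDensityMatrix {ι : Type} [Fintype ι] (ρ : Matrix ι ι ℂ) : Prop where
  posSemidef : ρ.PosSemidef
  trace_eq_one : ρ.trace = 1

/-- Operators on `n` qubits; the computational basis is the set of bit strings of length `n`. -/
abbrev QubitMatrix (n : ℕ) : Type := Matrix (Fin n → Fin 2) (Fin n → Fin 2) ℂ

/-- `S(ρ) = -tr(ρ ln ρ)`; the matrix `ln ρ` is formed by functional calculus, with `ln 0 = 0`,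
which is the usual convention `0 ln 0 = 0`. -/
def vonNeumannEntropy {n : ℕ} (ρ : QubitMatrix n) : ℝ :=
  -(Matrix.trace (ρ * cfc Real.log ρ)).re

/-! ## Elementary gates -/

/-- The `y`-rotation with angle `2 * φ`. -/
def rotY (φ : ℝ) : Matrix (Fin 2) (Fin 2) ℂ :=
  !![(Real.cos φ : ℂ), -(Real.sin φ : ℂ); (Real.sin φ : ℂ), (Real.cos φ : ℂ)]

/-- The diagonal gate `diag(1, z)`. -/
def phase (z : ℂ) : Matrix (Fin 2) (Fin 2) ℂ := !![1, 0; 0, z]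

def pauliX : Matrix (Fin 2) (Fin 2) ℂ := !![0, 1; 1, 0]

def hadamardH : Matrix (Fin 2) (Fin 2) ℂ :=
  !![((√2 : ℝ) : ℂ)⁻¹, ((√2 : ℝ) : ℂ)⁻¹; ((√2 : ℝ) : ℂ)⁻¹, -((√2 : ℝ) : ℂ)⁻¹]

/-- A square root of the Pauli `X` gate. -/
def sqrtX : Matrix (Fin 2) (Fin 2) ℂ :=
  !![(1 + Complex.I) / 2, (1 - Complex.I) / 2; (1 - Complex.I) / 2, (1 + Complex.I) / 2]

/-- The two-qubit gate that applies `U` to the first (target) qubit if the second (control) qubit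
is in the basis state `c`, and nothing otherwise. -/
def controlled (c : Fin 2) (U : Matrix (Fin 2) (Fin 2) ℂ) :
    Matrix (Fin 2 × Fin 2) (Fin 2 × Fin 2) ℂ :=
  Matrix.blockDiagonal fun b => if b = c then U else 1

theorem rotY_mem (φ : ℝ) : rotY φ ∈ Matrix.unitaryGroup (Fin 2) ℂ := by
  rw [Matrix.mem_unitaryGroup_iff, Matrix.star_eq_conjTranspose]
  have h : (Complex.cos φ) ^ 2 + (Complex.sin φ) ^ 2 = 1 := Complex.cos_sq_add_sin_sq _
  have h1 : (starRingEnd ℂ) (Complex.cos φ) = Complex.cos φ := by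
    rw [← Complex.ofReal_cos, Complex.conj_ofReal]
  have h2 : (starRingEnd ℂ) (Complex.sin φ) = Complex.sin φ := by
    rw [← Complex.ofReal_sin, Complex.conj_ofReal]
  ext i j
  fin_cases i <;> fin_cases j <;>
    simp [rotY, Matrix.mul_apply, Fin.sum_univ_two, h1, h2] <;> first | linear_combination h | ring

theorem phase_mem (z : ℂ) (hz : z * star z = 1) :
    phase z ∈ Matrix.unitaryGroup (Fin 2) ℂ := by
  rw [Matrix.mem_unitaryGroup_iff, Matrix.star_eq_conjTranspose]
  have h : z * (starRingEnd ℂ) z = 1 := hz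
  ext i j
  fin_cases i <;> fin_cases j <;> simp [phase, Matrix.mul_apply, Fin.sum_univ_two, h]

theorem pauliX_mem : pauliX ∈ Matrix.unitaryGroup (Fin 2) ℂ := by
  rw [Matrix.mem_unitaryGroup_iff, Matrix.star_eq_conjTranspose]
  ext i j
  fin_cases i <;> fin_cases j <;> simp [pauliX, Matrix.mul_apply, Fin.sum_univ_two]

theorem hadamardH_mem : hadamardH ∈ Matrix.unitaryGroup (Fin 2) ℂ := by
  rw [Matrix.mem_unitaryGroup_iff, Matrix.star_eq_conjTranspose]
  have h : (((√2 : ℝ) : ℂ)⁻¹) * (((√2 : ℝ) : ℂ)⁻¹) = 1 / 2 := by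
    rw [← mul_inv, ← Complex.ofReal_mul, Real.mul_self_sqrt (by norm_num)]
    norm_num
  ext i j
  fin_cases i <;> fin_cases j <;>
    simp [hadamardH, Matrix.mul_apply, Fin.sum_univ_two, h] <;> norm_num

theorem sqrtX_mem : sqrtX ∈ Matrix.unitaryGroup (Fin 2) ℂ := by
  rw [Matrix.mem_unitaryGroup_iff, Matrix.star_eq_conjTranspose]
  have h2 : (starRingEnd ℂ) 2 = 2 := Complex.conj_ofNat 2
  ext i j
  fin_cases i <;> fin_cases j <;>
    simp [sqrtX, Matrix.mul_apply, Fin.sum_univ_two, h2] <;> ring_nf <;> simp <;> norm_num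

theorem controlled_mem (c : Fin 2) {U : Matrix (Fin 2) (Fin 2) ℂ}
    (hU : U ∈ Matrix.unitaryGroup (Fin 2) ℂ) :
    controlled c U ∈ Matrix.unitaryGroup (Fin 2 × Fin 2) ℂ := by
  rw [Matrix.mem_unitaryGroup_iff, Matrix.star_eq_conjTranspose] at *
  unfold controlled
  rw [Matrix.blockDiagonal_conjTranspose, ← Matrix.blockDiagonal_mul, ← Matrix.blockDiagonal_one]
  congr 1
  ext1 b
  by_cases h : b = c <;> simp [h, hU]

/-! ## Circuits -/

/-- A primitive gate on qubits labelled by `W`: a one-qubit unitary on a wire, or a two-qubit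
unitary on an ordered pair of distinct wires. -/
inductive Gate (W : Type) : Type
  | one (w : W) (U : Matrix.unitaryGroup (Fin 2) ℂ) : Gate W
  | two (v w : W) (hvw : v ≠ w) (U : Matrix.unitaryGroup (Fin 2 × Fin 2) ℂ) : Gate W

namespace Gate

variable {W : Type}

/-- The inverse gate. -/
def dagger : Gate W → Gate W
  | one w U => one w U⁻¹
  | two v w h U => two v w h U⁻¹

/-- The action of a gate on the whole register: the given unitary on the wires of the gate,
tensored with the identity on all other wires. -/
def toMatrix [Fintype W] [DecidableEq W] :
    Gate W → Matrix (W → Fin 2) (W → Fin 2) ℂ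
  | one w U => fun x y => if ∀ u, u ≠ w → x u = y u then U.1 (x w) (y w) else 0
  | two v w _ U => fun x y =>
      if ∀ u, u ≠ v → u ≠ w → x u = y u then U.1 (x v, x w) (y v, y w) else 0

end Gate

/-- The inverse of a sequence of gates (the head of a list of gates is applied first). -/
def daggerList {W : Type} (c : List (Gate W)) : List (Gate W) := (c.map Gate.dagger).reverse

/-- The qubits of the estimation circuit: four single qubits (the measure qubit, the two ancillas
of the linear combination of unitaries, the ancilla of the controlled swap) and two registers of
`n` qubits (`0`: the main register, `1`: the ancillary register). -/
abbrev Wire (n : ℕ) : Type := Fin 4 ⊕ Fin 2 × Fin n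

abbrev measWire {n : ℕ} : Wire n := Sum.inl 0
abbrev lcuWire₁ {n : ℕ} : Wire n := Sum.inl 1
abbrev lcuWire₂ {n : ℕ} : Wire n := Sum.inl 2
abbrev swapWire {n : ℕ} : Wire n := Sum.inl 3
abbrev regWire {n : ℕ} (r : Fin 2) (i : Fin n) : Wire n := Sum.inr (r, i)

/-- Operators on all the qubits of the estimation circuit. -/
abbrev WireMatrix (n : ℕ) : Type := Matrix (Wire n → Fin 2) (Wire n → Fin 2) ℂ

/-- One step of a circuit: a primitive gate, or the (re)initialization of register `r` with a fresh
copy of the input state, which discards what was in the register. -/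
inductive Instr (n : ℕ) : Type
  | gate (g : Gate (Wire n)) : Instr n
  | load (r : Fin 2) : Instr n

namespace Instr

/-- Overwrite the bits of register `r` in the bit string `x` by `z`. -/
def overwrite {n : ℕ} (r : Fin 2) (z : Fin n → Fin 2) (x : Wire n → Fin 2) : Wire n → Fin 2
  | Sum.inl a => x (Sum.inl a)
  | Sum.inr (r', i) => if r' = r then z i else x (Sum.inr (r', i))

/-- The effect of an instruction on a density matrix: `σ ↦ U σ U†` for a gate, and
`σ ↦ ρ_r ⊗ tr_r σ` for the reinitialization of register `r`. -/
def apply {n : ℕ} (ρ : QubitMatrix n) : Instr n → WireMatrix n → WireMatrix n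
  | gate g, σ => g.toMatrix * σ * g.toMatrix.conjTranspose
  | load r, σ => fun x y =>
      ρ (fun i => x (regWire r i)) (fun i => y (regWire r i)) *
        ∑ z : Fin n → Fin 2, σ (overwrite r z x) (overwrite r z y)

/-- Number of single/two-qubit gates of an instruction. -/
def gateCost {n : ℕ} : Instr n → ℕ
  | gate _ => 1
  | load _ => 0

/-- Number of copies of the input state consumed by an instruction. -/
def copyCost {n : ℕ} : Instr n → ℕ
  | gate _ => 0
  | load _ => 1

end Instr

/-- A circuit is a list of instructions, executed from the head on. It does not depend on the input
state, which enters only when the `load` instructions are executed. -/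
abbrev Circuit (n : ℕ) : Type := List (Instr n)

namespace Circuit

variable {n : ℕ}

def gateCount (c : Circuit n) : ℕ := (c.map Instr.gateCost).sum

def copyCount (c : Circuit n) : ℕ := (c.map Instr.copyCost).sum

/-- The initial state: all qubits in the state `|0⟩`. -/
def initialState : WireMatrix n := fun x y => if x = 0 ∧ y = 0 then 1 else 0

/-- The final state of the circuit when the copies that it loads are copies of `ρ`. -/
def finalState (c : Circuit n) (ρ : QubitMatrix n) : WireMatrix n :=
  c.foldl (fun σ i => i.apply ρ σ) initialState

end Circuit

/-! ## Sampling -/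

/-- The distribution on the finite set `I` with probabilities proportional to the non-negative
weights `w`. (If all weights vanish, a default point is returned.) -/
def sampleProportional {α : Type} [DecidableEq α] [Inhabited α] (I : Finset α) (w : α → ℝ) :
    PMF α :=
  let f : α → ℝ≥0∞ := fun a => if a ∈ I then ENNReal.ofReal (w a) else 0
  open Classical in
  if h : tsum f ≠ 0 ∧ tsum f ≠ ⊤ then PMF.normalize f h.1 h.2 else PMF.pure default

/-- `k` independent samples from `p`. -/
def iid {α : Type} (p : PMF α) : ℕ → PMF (List α)
  | 0 => PMF.pure []
  | k + 1 => p.bind fun a => (iid p k).map fun l => a :: l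

/-- One execution of a circuit followed by a measurement of the measure qubit along the eigenbasis
of the Pauli `Z`: outcome `b` has probability `tr((|b⟩⟨b| ⊗ I) σ)`, where `σ` is the final state
(which has trace one). -/
def measure {n : ℕ} (c : Circuit n) (ρ : QubitMatrix n) : PMF (Fin 2) :=
  sampleProportional Finset.univ fun b =>
    (∑ x : Wire n → Fin 2, if x measWire = b then c.finalState ρ x x else 0).re

/-- The eigenvalue of the Pauli `Z` of a measurement outcome. -/
def outcomeSign (b : Fin 2) : ℝ := if b = 0 then 1 else -1

/-! ## The circuit for `tr(ρ cos(ρ t))` -/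

section Circuits

variable {n : ℕ}

def gateX (w : Wire n) : Gate (Wire n) := .one w ⟨pauliX, pauliX_mem⟩

def gateH (w : Wire n) : Gate (Wire n) := .one w ⟨hadamardH, hadamardH_mem⟩

/-- `U` on the wire `t`, controlled by the wire `c` being in state `b`. -/
def gateC (b : Fin 2) (c t : Wire n) (h : t ≠ c) (U : Matrix.unitaryGroup (Fin 2) ℂ) :
    Gate (Wire n) :=
  .two t c h ⟨controlled b U.1, controlled_mem b U.2⟩

/-- The doubly controlled `V ^ 2` as five controlled gates. -/
def gatesCC (c₁ c₂ t : Wire n) (h : c₂ ≠ c₁) (h₁ : t ≠ c₁) (h₂ : t ≠ c₂)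
    (V : Matrix.unitaryGroup (Fin 2) ℂ) : List (Gate (Wire n)) :=
  [gateC 1 c₂ t h₂ V, gateC 1 c₁ c₂ h ⟨pauliX, pauliX_mem⟩, gateC 1 c₂ t h₂ V⁻¹,
    gateC 1 c₁ c₂ h ⟨pauliX, pauliX_mem⟩, gateC 1 c₁ t h₁ V]

/-- The phase gate `S = diag(1, i)`, a square root of `Z`. -/
def phaseS : Matrix.unitaryGroup (Fin 2) ℂ := ⟨phase Complex.I, phase_mem _ (by simp)⟩

def pauliZ : Matrix.unitaryGroup (Fin 2) ℂ := ⟨phase (-1), phase_mem _ (by simp)⟩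

/-- The Toffoli gate. -/
def toffoli (c₁ c₂ t : Wire n) (h : c₂ ≠ c₁) (h₁ : t ≠ c₁) (h₂ : t ≠ c₂) :
    List (Gate (Wire n)) := gatesCC c₁ c₂ t h h₁ h₂ ⟨sqrtX, sqrtX_mem⟩

/-- `Z` on the second ancilla controlled by the measure qubit and the first ancilla. -/
def ccZ : List (Gate (Wire n)) :=
  gatesCC measWire lcuWire₁ lcuWire₂ (by simp) (by simp) (by simp) phaseS

/-- The swap of the `i`-th qubits of the two registers, controlled by the swap ancilla. -/
def cSwapQubit (i : Fin n) : List (Gate (Wire n)) :=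
  [gateC 1 (regWire 1 i) (regWire 0 i) (by simp) ⟨pauliX, pauliX_mem⟩] ++
    toffoli swapWire (regWire 0 i) (regWire 1 i) (by simp) (by simp) (by simp) ++
    [gateC 1 (regWire 1 i) (regWire 0 i) (by simp) ⟨pauliX, pauliX_mem⟩]

/-- `select(𝒮) = |0⟩⟨0| ⊗ I + |1⟩⟨1| ⊗ (-i sgn Δ) 𝒮` on the second ancilla and the two registers,
controlled by the measure qubit. -/
def cSelect (Δ : ℝ) : List (Gate (Wire n)) :=
  toffoli measWire lcuWire₂ swapWire (by simp) (by simp) (by simp) ++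
    (List.finRange n).flatMap cSwapQubit ++
    toffoli measWire lcuWire₂ swapWire (by simp) (by simp) (by simp) ++
    [gateC 1 measWire lcuWire₂ (by simp) phaseS] ++
    (if 0 < Δ then [gateC 1 measWire lcuWire₂ (by simp) pauliZ] else [])

/-- `α = cos Δ + |sin Δ|`. -/
def lcuAlpha (Δ : ℝ) : ℝ := Real.cos Δ + |Real.sin Δ|

/-- `R₁|0⟩ = (α/2)|0⟩ + √(1 - α²/4)|1⟩`. -/
def rotR₁ (Δ : ℝ) : Matrix.unitaryGroup (Fin 2) ℂ :=
  ⟨rotY (Real.arccos (lcuAlpha Δ / 2)), rotY_mem _⟩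

/-- `R₂|0⟩ = √(cos Δ/α)|0⟩ + √(|sin Δ|/α)|1⟩`. -/
def rotR₂ (Δ : ℝ) : Matrix.unitaryGroup (Fin 2) ℂ :=
  ⟨rotY (Real.arccos (√(Real.cos Δ / lcuAlpha Δ))), rotY_mem _⟩

/-- `W = R₂† select(𝒮) (oc-R₂) R₁`, controlled by the measure qubit. -/
def cW (Δ : ℝ) : List (Gate (Wire n)) :=
  [gateC 1 measWire lcuWire₁ (by simp) (rotR₁ Δ),
    gateC 0 lcuWire₁ lcuWire₂ (by simp) (rotR₂ Δ)] ++
    cSelect Δ ++ [.one lcuWire₂ (rotR₂ Δ)⁻¹]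

/-- `I - 2P` with `P = |00⟩⟨00|` on the two ancillas, controlled by the measure qubit. -/
def cReflect : List (Gate (Wire n)) :=
  [gateX lcuWire₁, gateC 1 measWire lcuWire₁ (by simp) pauliZ] ++ ccZ ++ [gateX lcuWire₁]

/-- `-(I - 2P)`, controlled by the measure qubit. -/
def cNegReflect : List (Gate (Wire n)) :=
  [gateC 1 measWire lcuWire₁ (by simp) pauliZ, gateX lcuWire₁] ++ ccZ ++ [gateX lcuWire₁]

/-- `A = -W (I - 2P) W† (I - 2P) W`, controlled by the measure qubit. -/
def cA (Δ : ℝ) : List (Gate (Wire n)) :=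
  cW Δ ++ cReflect ++ daggerList (cW Δ) ++ cNegReflect ++ cW Δ

/-- The circuit with qubit reset that estimates `tr(ρ cos(ρ t))` in `Q` steps of length `t / Q`;
it consumes `Q + 1` copies. -/
def estimationCircuit (n : ℕ) (t : ℝ) (Q : ℕ) : Circuit n :=
  [.load 0, .gate (gateH measWire)] ++
    (List.replicate Q (Instr.load 1 :: (cA (t / Q)).map Instr.gate)).flatten ++
    [.gate (gateH measWire)]

end Circuits

/-! ## The Fourier series and the algorithm

In the definitions below `η` is the accuracy, `δ` the failure probability, and `Λ` the lower bound
on the non-zero eigenvalues that are given to the algorithm. -/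

/-- The Taylor coefficients of `arcsin y / (π / 2)`. -/
def coeffB₁ (l : ℕ) : ℝ :=
  if Even l then 0 else 2 * ((l - 1).choose ((l - 1) / 2) : ℝ) / (Real.pi * 2 ^ (l - 1) * l)

/-- `b_l^{(k)}` for `k ≥ 1` (the value at `k = 0` is never used). -/
def coeffB : ℕ → ℕ → ℝ
  | 0, _ => 0
  | 1, l => coeffB₁ l
  | k + 2, l => ∑ l' ∈ Finset.range (l + 1), coeffB (k + 1) l' * coeffB₁ (l - l')

/-- The truncation order `K ∈ Θ(log(ηΛ) / log(1 - Λ))` of the Taylor series. -/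
def orderK (η Λ : ℝ) : ℕ := ⌈Real.log (4 / (η * Λ)) / Real.log (1 / (1 - Λ))⌉₊

/-- `ln(4 (∑_{k=1}^K 1/k) / η)`. -/
def logTerm (η Λ : ℝ) : ℝ :=
  Real.log (4 * (∑ k ∈ Finset.Icc 1 (orderK η Λ), 1 / (k : ℝ)) / η)

/-- `L = ln(4 (∑_{k=1}^K 1/k) / η) / Λ²`. -/
def paramL (η Λ : ℝ) : ℝ := logTerm η Λ * (1 / Λ ^ 2)

/-- `M_l = ⌈√(ln(4 (∑_{k=1}^K 1/k) / η) l / 2)⌉`. -/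
def paramM (η Λ : ℝ) (l : ℕ) : ℕ := ⌈√(logTerm η Λ * (l / 2))⌉₊

/-- The index set of the Fourier series: the pairs `⟨l, s⟩` with `0 ≤ l ≤ ⌊L⌋` and
`max{0, ⌊l/2⌋ - M_l} ≤ s ≤ min{l, ⌈l/2⌉ + M_l}` (subtraction in `ℕ` is truncated at `0`). -/
def indexSet (η Λ : ℝ) : Finset (Σ _ : ℕ, ℕ) :=
  (Finset.range (⌊paramL η Λ⌋₊ + 1)).sigma fun l =>
    Finset.Icc (l / 2 - paramM η Λ l) (min l ((l + 1) / 2 + paramM η Λ l))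

/-- The weight `f(s,l) = (∑_{k=1}^K b_l^{(k)} / k) binom(l, s) / 2^l`. -/
def weight (η Λ : ℝ) (p : Σ _ : ℕ, ℕ) : ℝ :=
  (∑ k ∈ Finset.Icc 1 (orderK η Λ), coeffB k p.1 / k) * ((p.1.choose p.2 : ℝ) / 2 ^ p.1)

/-- `‖f‖_{ℓ₁}`. -/
def weightNorm (η Λ : ℝ) : ℝ := ∑ p ∈ indexSet η Λ, |weight η Λ p|

/-- `ε = η / ‖f‖_{ℓ₁}`. -/
def termAccuracy (η Λ : ℝ) : ℝ := η / weightNorm η Λ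

/-- `N = ∑_{l=0}^{⌊L⌋} (2 M_l + 1)`. -/
def numTerms (η Λ : ℝ) : ℕ :=
  ∑ l ∈ Finset.range (⌊paramL η Λ⌋₊ + 1), (2 * paramM η Λ l + 1)

/-- The number `B = O(log(2/δ) / ε²)` of sampled pairs. -/
def numSamples (η δ Λ : ℝ) : ℕ := ⌈4 * Real.log (2 / δ) / termAccuracy η Λ ^ 2⌉₊

/-- The number `O(log(2N/δ) / ε²)` of executions of the circuit of one sampled pair. -/
def numMeasurements (η δ Λ : ℝ) : ℕ :=
  ⌈16 * Real.log (2 * numTerms η Λ / δ) / termAccuracy η Λ ^ 2⌉₊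

/-- The time `t(s,l) = (2s - l) π / 2`. -/
def time (p : Σ _ : ℕ, ℕ) : ℝ := (2 * (p.2 : ℝ) - p.1) * Real.pi / 2

/-- The number of steps `Q = ⌈(2s - l)² π² / (4ε)⌉`. -/
def numSteps (η Λ : ℝ) (p : Σ _ : ℕ, ℕ) : ℕ :=
  ⌈(2 * (p.2 : ℝ) - p.1) ^ 2 * Real.pi ^ 2 / (4 * termAccuracy η Λ)⌉₊

/-- The circuit of the pair `(s,l)`. -/
def termCircuit (n : ℕ) (η Λ : ℝ) (p : Σ _ : ℕ, ℕ) : Circuit n :=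
  estimationCircuit n (time p) (numSteps η Λ p)

/-- What is recorded: an estimate, the number of copies of the input state that were consumed, and
the number of single/two-qubit gates of the circuits that were constructed. -/
structure Outcome : Type where
  estimate : ℝ
  copies : ℕ
  gates : ℕ

/-- One pass through the loop, including the sampling of the pair `(s,l)`: construct the circuit of
the pair, execute it repeatedly, each time on fresh copies, and average the outcomes. The copies of
all executions are counted; the gates of the circuit are counted once. -/
def iteration {n : ℕ} (η δ Λ : ℝ) (ρ : QubitMatrix n) : PMF Outcome :=
  (sampleProportional (indexSet η Λ) (weight η Λ)).bind fun p =>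
    (iid (measure (termCircuit n η Λ p) ρ) (numMeasurements η δ Λ)).map fun bs =>
      { estimate := (bs.map outcomeSign).sum / numMeasurements η δ Λ
        copies := numMeasurements η δ Λ * (termCircuit n η Λ p).copyCount
        gates := (termCircuit n η Λ p).gateCount }

/-- The entropy estimation algorithm: the law of its output together with the resources used. -/
def algorithm {n : ℕ} (η δ Λ : ℝ) (ρ : QubitMatrix n) : PMF Outcome :=
  (iid (iteration η δ Λ ρ) (numSamples η δ Λ)).map fun rs =>
    { estimate := weightNorm η Λ * ((rs.map Outcome.estimate).sum / numSamples η δ Λ)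
      copies := (rs.map Outcome.copies).sum
      gates := (rs.map Outcome.gates).sum }

end EntropyEstimation

end

open scoped ENNReal ComplexOrder

noncomputable section

namespace EntropyEstimation

/-! ## Action of gates on computational basis vectors -/

section Gates

open Matrix

variable {W : Type} [Fintype W] [DecidableEq W]

/-! The argument has four ingredients.

Approximation. The entropy is the sum of `λ_i * (-ln λ_i)` over the eigenvalues. On `[Λ, 1]`, `-ln
x` is close to the truncated series of `(1 - x)^k / k`. Moreover `1 - x = arcsin y / (π/2)` with `y
= cos(xπ/2)`. Powers of this function of `y` have nonnegative Taylor coefficients of total mass at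
most one (`sum_coeffB_le_one`), and `y ≤ exp(-Λ²)`, so about `ln r / Λ²` coefficients suffice.
Finally `y^l` is a binomial average of `cos((2s - l)xπ/2)`, and by a Chernoff bound only the `s`
close to `l/2` matter. This gives `fourier_approx`: `-ln x` is within `η` of a nonnegative
combination of cosines. Applied to the eigenvalues, it says that the entropy is within `η` of the
combination of the numbers `tr(ρ cos(ρt))`.

The circuit. The `|00⟩` block of `W` is exactly half of the unitary `exp(-iΔ𝒮)`, so a single round
of oblivious amplitude amplification turns `A` into `exp(-iΔ𝒮)` without error and returns the
ancillas to zero (`cA_mulVec_ket_one`). Hence the state can be followed on the measure qubit and the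
two registers alone. The partial trace of `𝒮(X ⊗ ρ)` over the second register is `ρX`, so each step
multiplies the `(1,0)` block of the state by `cos Δ - i sin Δ ρ`. The final `Z`-expectation is
therefore `Re tr(ρ(cos Δ - i sin Δ ρ)^Q)` (`estimationCircuit_weight`). Per step, `cos Δ - i sin Δ
x` differs from `exp(-iΔx)` by at most `Δ²`, so the total deviation from `tr(ρ cos(ρt))` is at most
`t²/Q ≤ ε`. After multiplication by the norm of the weights this is at most `η`
(`meanEstimate_error`).

Sampling. One pass of the loop returns a number in `[-1, 1]` whose mean is the normalized weighted
sum of circuit expectations, so the bound of Hoeffding type `iid_mean_tail` with `B` passes costs a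
third `η` with failure probability at most `δ`. The number `R` of executions does not affect this
mean; for accuracy only `R ≠ 0` matters.

Resources. Every parameter is bounded by powers of `1/ϵ`, `1/Λ` and one logarithm, at every point of
the support. The truncation in `s` keeps `|2s - l|` of order `1/Λ` although `l` reaches order `1/Λ²`
(`abs_frequency_le`); since `Q` is quadratic in `2s - l`, this is the source of the factor `1/Λ²`.
-/

/-- The computational basis vector of the bit string `x`. -/
def ket (x : W → Fin 2) : (W → Fin 2) → ℂ := Pi.single x 1

/-- The one-qubit operator `U` on the wire `w`. -/
def onWire (w : W) (U : Matrix (Fin 2) (Fin 2) ℂ) : Matrix (W → Fin 2) (W → Fin 2) ℂ :=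
  fun x y => if ∀ u, u ≠ w → x u = y u then U (x w) (y w) else 0

theorem toMatrix_one (w : W) (U : Matrix.unitaryGroup (Fin 2) ℂ) :
    (Gate.one w U).toMatrix = onWire w U.1 := rfl

theorem onWire_mulVec_ket (w : W) (U : Matrix (Fin 2) (Fin 2) ℂ) (x : W → Fin 2) :
    onWire w U *ᵥ ket x = ∑ a, U a (x w) • ket (Function.update x w a) := by
  ext y
  rw [ket, Matrix.mulVec_single_one]
  simp only [onWire, Matrix.col_apply, Finset.sum_apply, Pi.smul_apply, ket, Pi.single_apply,
    smul_eq_mul, mul_ite, mul_one, mul_zero]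
  by_cases h : ∀ u, u ≠ w → y u = x u
  · rw [if_pos h, Finset.sum_eq_single (y w)]
    · rw [if_pos]
      funext u
      by_cases hu : u = w
      · subst hu; simp
      · simp [hu, h u hu]
    · intro b _ hb
      rw [if_neg]
      rintro rfl
      simp at hb
    · simp
  · rw [if_neg h, Finset.sum_eq_zero]
    intro b _
    rw [if_neg]
    rintro rfl
    apply h
    intro u hu
    simp [hu]

theorem matrix_ext_ket {A B : Matrix (W → Fin 2) (W → Fin 2) ℂ}
    (h : ∀ x, A *ᵥ ket x = B *ᵥ ket x) : A = B := by
  ext y x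
  have := congrFun (h x) y
  simpa [ket, Matrix.mulVec_single_one] using this

theorem onWire_one (w : W) : onWire w 1 = 1 := by
  apply matrix_ext_ket
  intro x
  rw [onWire_mulVec_ket, Finset.sum_eq_single (x w)]
  · simp
  · intro b _ hb
    simp [hb]
  · simp

theorem onWire_mul (w : W) (U V : Matrix (Fin 2) (Fin 2) ℂ) :
    onWire w U * onWire w V = onWire w (U * V) := by
  apply matrix_ext_ket
  intro x
  rw [← Matrix.mulVec_mulVec, onWire_mulVec_ket, onWire_mulVec_ket, Matrix.mulVec_sum]
  simp only [Matrix.mulVec_smul, onWire_mulVec_ket, Function.update_self, Function.update_idem,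
    Finset.smul_sum, Matrix.mul_apply, Finset.sum_smul]
  rw [Finset.sum_comm]
  refine Finset.sum_congr rfl fun a _ => Finset.sum_congr rfl fun b _ => ?_
  rw [smul_smul, mul_comm]

theorem onWire_comm {v w : W} (h : v ≠ w) (U V : Matrix (Fin 2) (Fin 2) ℂ) :
    onWire v U * onWire w V = onWire w V * onWire v U := by
  apply matrix_ext_ket
  intro x
  rw [← Matrix.mulVec_mulVec, onWire_mulVec_ket, ← Matrix.mulVec_mulVec, onWire_mulVec_ket,
    Matrix.mulVec_sum, Matrix.mulVec_sum]
  simp only [Matrix.mulVec_smul, onWire_mulVec_ket, Function.update_of_ne h,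
    Function.update_of_ne h.symm, Finset.smul_sum]
  rw [Finset.sum_comm]
  refine Finset.sum_congr rfl fun a _ => Finset.sum_congr rfl fun b _ => ?_
  rw [smul_smul, smul_smul, mul_comm, Function.update_comm h]

/-- A nonzero entry has equal control bits in row and column because `t ≠ c`. So each column is a
column of the one-qubit operator selected by its own control bit. The entrywise form is what
`HasBit.gateC_mulVec` needs for superpositions. -/
theorem toMatrix_controlled_apply (b : Fin 2) {c t : W} (h : t ≠ c)
    (U : Matrix (Fin 2) (Fin 2) ℂ) (hU) (y x : W → Fin 2) :
    (Gate.two t c h ⟨controlled b U, hU⟩).toMatrix y x =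
      onWire t (if x c = b then U else 1) y x := by
  simp only [Gate.toMatrix, controlled, onWire, Matrix.blockDiagonal_apply]
  by_cases h1 : ∀ u, u ≠ t → y u = x u
  · rw [if_pos h1, if_pos fun u hu _ => h1 u hu, if_pos (h1 c h.symm), h1 c h.symm]
  · rw [if_neg h1]
    split_ifs with h2 h3
    · refine absurd (fun u hu => ?_) h1
      by_cases huc : u = c
      · rw [huc, h3]
      · exact h2 u hu huc
    · refine absurd (fun u hu => ?_) h1
      by_cases huc : u = c
      · rw [huc, h3]
      · exact h2 u hu huc
    · rfl
    · rfl

theorem controlled_mulVec_ket (b : Fin 2) {c t : W} (h : t ≠ c)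
    (U : Matrix (Fin 2) (Fin 2) ℂ) (hU) (x : W → Fin 2) :
    (Gate.two t c h ⟨controlled b U, hU⟩).toMatrix *ᵥ ket x =
      if x c = b then onWire t U *ᵥ ket x else ket x := by
  have : (Gate.two t c h ⟨controlled b U, hU⟩).toMatrix *ᵥ ket x =
      onWire t (if x c = b then U else 1) *ᵥ ket x := by
    ext y
    simpa [ket, Matrix.mulVec_single_one] using toMatrix_controlled_apply b h U hU y x
  rw [this]
  split_ifs
  · rfl
  · rw [onWire_one, Matrix.one_mulVec]

theorem toMatrix_two_mulVec_ket {v w : W} (h : v ≠ w)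
    (U : Matrix.unitaryGroup (Fin 2 × Fin 2) ℂ) (x : W → Fin 2) :
    (Gate.two v w h U).toMatrix *ᵥ ket x =
      ∑ a : Fin 2 × Fin 2, U.1 a (x v, x w) •
        ket (Function.update (Function.update x v a.1) w a.2) := by
  ext y
  rw [ket, Matrix.mulVec_single_one, Matrix.col_apply]
  simp only [Gate.toMatrix, Finset.sum_apply, Pi.smul_apply, ket,
    Pi.single_apply, smul_eq_mul, mul_ite, mul_one, mul_zero]
  by_cases h1 : ∀ u, u ≠ v → u ≠ w → y u = x u
  · rw [if_pos h1, Finset.sum_eq_single (y v, y w)]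
    · rw [if_pos]
      funext u
      by_cases hu : u = w
      · subst hu; simp
      · by_cases hv : u = v
        · subst hv; simp [h]
        · simp [hu, hv, h1 u hv hu]
    · rintro ⟨b, c⟩ _ hb
      rw [if_neg]
      rintro rfl
      simp [h] at hb
    · simp
  · rw [if_neg h1, Finset.sum_eq_zero]
    rintro ⟨b, c⟩ _
    rw [if_neg]
    rintro rfl
    apply h1
    intro u hu hw
    simp [hu, hw]

theorem toMatrix_dagger_mul (g : Gate W) : g.dagger.toMatrix * g.toMatrix = 1 := by
  cases g with
  | one w U =>
    rw [Gate.dagger, toMatrix_one, toMatrix_one, onWire_mul, ← Submonoid.coe_mul,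
      inv_mul_cancel, Submonoid.coe_one, onWire_one]
  | two v w h U =>
    apply matrix_ext_ket
    intro x
    rw [Gate.dagger, ← Matrix.mulVec_mulVec, toMatrix_two_mulVec_ket, Matrix.mulVec_sum]
    simp only [Matrix.mulVec_smul, toMatrix_two_mulVec_ket, Finset.smul_sum, smul_smul,
      Function.update_self, Function.update_of_ne h]
    rw [Finset.sum_comm]
    have key : ∀ a : Fin 2 × Fin 2, ∑ b : Fin 2 × Fin 2, (U.1 b (x v, x w) * (U⁻¹).1 a (b.1, b.2)) =
        if a = (x v, x w) then 1 else 0 := by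
      intro a
      have h1 : ((U⁻¹).1 * U.1) a (x v, x w) = (1 : Matrix _ _ ℂ) a (x v, x w) := by
        rw [← Submonoid.coe_mul, inv_mul_cancel, Submonoid.coe_one]
      rw [Matrix.mul_apply, Matrix.one_apply] at h1
      rw [← h1]
      exact Finset.sum_congr rfl fun b _ => mul_comm _ _
    have upd : ∀ a b : Fin 2 × Fin 2,
        Function.update (Function.update (Function.update (Function.update x v b.1) w b.2) v a.1)
          w a.2 = Function.update (Function.update x v a.1) w a.2 := by
      intro a b
      rw [Function.update_comm h.symm, Function.update_idem, Function.update_idem]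
    simp only [upd, ← Finset.sum_smul, key]
    rw [Finset.sum_eq_single (x v, x w)]
    · simp
    · intro b _ hb
      simp [hb]
    · simp

/-- The operator of a sequence of gates. -/
def gatesMatrix : List (Gate W) → Matrix (W → Fin 2) (W → Fin 2) ℂ
  | [] => 1
  | g :: c => gatesMatrix c * g.toMatrix

theorem gatesMatrix_append (c d : List (Gate W)) :
    gatesMatrix (c ++ d) = gatesMatrix d * gatesMatrix c := by
  induction c with
  | nil => simp [gatesMatrix]
  | cons g c ih => simp [gatesMatrix, ih, Matrix.mul_assoc]

theorem gatesMatrix_append_mulVec (c d : List (Gate W)) (ψ : (W → Fin 2) → ℂ) :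
    gatesMatrix (c ++ d) *ᵥ ψ = gatesMatrix d *ᵥ (gatesMatrix c *ᵥ ψ) := by
  rw [gatesMatrix_append, Matrix.mulVec_mulVec]

theorem gatesMatrix_cons_mulVec (g : Gate W) (c : List (Gate W)) (ψ : (W → Fin 2) → ℂ) :
    gatesMatrix (g :: c) *ᵥ ψ = gatesMatrix c *ᵥ (g.toMatrix *ᵥ ψ) := by
  rw [gatesMatrix, Matrix.mulVec_mulVec]

theorem gatesMatrix_nil_mulVec (ψ : (W → Fin 2) → ℂ) :
    gatesMatrix ([] : List (Gate W)) *ᵥ ψ = ψ := by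
  rw [gatesMatrix, Matrix.one_mulVec]

/-- Allows reversed circuits to be evaluated from the action of the forward ones, and supplies the
unitarity of `W` used in the amplification step. -/
theorem gatesMatrix_daggerList_mul (c : List (Gate W)) :
    gatesMatrix (daggerList c) * gatesMatrix c = 1 := by
  induction c with
  | nil => simp [daggerList, gatesMatrix]
  | cons g c ih =>
    have : daggerList (g :: c) = daggerList c ++ [g.dagger] := by simp [daggerList]
    rw [this, gatesMatrix_append]
    simp only [gatesMatrix]
    rw [Matrix.mul_assoc, ← Matrix.mul_assoc _ _ g.toMatrix, ih, Matrix.one_mul, Matrix.one_mul,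
      toMatrix_dagger_mul]

theorem gatesMatrix_daggerList_mulVec (c : List (Gate W)) (ψ : (W → Fin 2) → ℂ) :
    gatesMatrix (daggerList c) *ᵥ (gatesMatrix c *ᵥ ψ) = ψ := by
  rw [Matrix.mulVec_mulVec, gatesMatrix_daggerList_mul, Matrix.one_mulVec]

end Gates

theorem daggerList_append {W : Type} (c d : List (Gate W)) :
    daggerList (c ++ d) = daggerList d ++ daggerList c := by
  simp [daggerList]

/-! ### Toffoli, doubly controlled `Z` and controlled swap from the elementary gates. -/

section BasicGates

open Matrix

variable {n : ℕ}

theorem gateC_mulVec_ket (b : Fin 2) (c t : Wire n) (h : t ≠ c)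
    (U : Matrix.unitaryGroup (Fin 2) ℂ) (x : Wire n → Fin 2) :
    (gateC b c t h U).toMatrix *ᵥ ket x = if x c = b then onWire t U.1 *ᵥ ket x else ket x :=
  controlled_mulVec_ket b h U.1 _ x

theorem onWire_pauliX_mulVec_ket {W : Type} [Fintype W] [DecidableEq W] (w : W)
    (x : W → Fin 2) :
    onWire w pauliX *ᵥ ket x = ket (Function.update x w (x w + 1)) := by
  rw [onWire_mulVec_ket, Fin.sum_univ_two]
  obtain h | h : x w = 0 ∨ x w = 1 := by omega
  · simp [pauliX, h]
  · simp [pauliX, h]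

theorem gateX_mulVec_ket (w : Wire n) (x : Wire n → Fin 2) :
    (gateX w).toMatrix *ᵥ ket x = ket (Function.update x w (x w + 1)) :=
  onWire_pauliX_mulVec_ket w x

theorem onWire_phase_mulVec_ket {W : Type} [Fintype W] [DecidableEq W] (w : W) (z : ℂ)
    (x : W → Fin 2) :
    onWire w (phase z) *ᵥ ket x = (if x w = 1 then z else 1) • ket x := by
  rw [onWire_mulVec_ket, Fin.sum_univ_two]
  obtain h | h : x w = 0 ∨ x w = 1 := by omega
  · have : Function.update x w 0 = x := by rw [← h, Function.update_eq_self]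
    simp [phase, h, this]
  · have : Function.update x w 1 = x := by rw [← h, Function.update_eq_self]
    simp [phase, h, this]

theorem cnot_mulVec_ket (c t : Wire n) (h : t ≠ c) (x : Wire n → Fin 2) :
    (gateC 1 c t h ⟨pauliX, pauliX_mem⟩).toMatrix *ᵥ ket x =
      ket (Function.update x t (x t + x c)) := by
  rw [gateC_mulVec_ket, onWire_pauliX_mulVec_ket]
  obtain h | h : x c = 0 ∨ x c = 1 := by omega
  · simp [h]
  · simp [h]

/-- A vector in the span of the basis vectors with the bit `b` on the wire `c`. -/
def HasBit (c : Wire n) (b : Fin 2) (ψ : (Wire n → Fin 2) → ℂ) : Prop :=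
  ∀ x, ψ x ≠ 0 → x c = b

theorem hasBit_ket (c : Wire n) (x : Wire n → Fin 2) : HasBit c (x c) (ket x) := by
  intro y hy
  by_cases h : y = x
  · rw [h]
  · simp [ket, h] at hy

theorem HasBit.onWire {c : Wire n} {b : Fin 2} {ψ : (Wire n → Fin 2) → ℂ} (hψ : HasBit c b ψ)
    {t : Wire n} (h : t ≠ c) (U : Matrix (Fin 2) (Fin 2) ℂ) :
    HasBit c b (onWire t U *ᵥ ψ) := by
  intro y hy
  obtain ⟨x, -, hx⟩ := Finset.exists_ne_zero_of_sum_ne_zero hy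
  have h2 := right_ne_zero_of_mul hx
  have h1 := left_ne_zero_of_mul hx
  rw [← hψ x h2]
  simp only [EntropyEstimation.onWire, ne_eq, ite_eq_right_iff, Classical.not_imp] at h1
  exact h1.1 c h.symm

/-- Inside a gate sequence the target may already be in superposition; a control bit shared by all
basis vectors present is enough to resolve the gate. -/
theorem HasBit.gateC_mulVec {c : Wire n} {b' : Fin 2} {ψ : (Wire n → Fin 2) → ℂ}
    (hψ : HasBit c b' ψ) (b : Fin 2) {t : Wire n} (h : t ≠ c)
    (U : Matrix.unitaryGroup (Fin 2) ℂ) :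
    (gateC b c t h U).toMatrix *ᵥ ψ = if b' = b then EntropyEstimation.onWire t U.1 *ᵥ ψ else ψ := by
  have : (gateC b c t h U).toMatrix *ᵥ ψ =
      EntropyEstimation.onWire t (if b' = b then U.1 else 1) *ᵥ ψ := by
    ext y
    refine Finset.sum_congr rfl fun x _ => ?_
    by_cases hx : ψ x = 0
    · simp [hx]
    · congr 1
      have := toMatrix_controlled_apply b h U.1 (controlled_mem b U.2) y x
      rw [hψ x hx] at this
      exact this
  rw [this]
  split_ifs
  · rfl
  · rw [onWire_one, Matrix.one_mulVec]

theorem unitary_mul_inv (V : Matrix.unitaryGroup (Fin 2) ℂ) : V.1 * (V⁻¹).1 = 1 := by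
  rw [← Submonoid.coe_mul, mul_inv_cancel, Submonoid.coe_one]

theorem unitary_inv_mul (V : Matrix.unitaryGroup (Fin 2) ℂ) : (V⁻¹).1 * V.1 = 1 := by
  rw [← Submonoid.coe_mul, inv_mul_cancel, Submonoid.coe_one]

theorem onWire_comm_mulVec {v w : Wire n} (h : v ≠ w) (U V : Matrix (Fin 2) (Fin 2) ℂ)
    (ψ : (Wire n → Fin 2) → ℂ) :
    onWire v U *ᵥ (onWire w V *ᵥ ψ) = onWire w V *ᵥ (onWire v U *ᵥ ψ) := by
  rw [Matrix.mulVec_mulVec, onWire_comm h, Matrix.mulVec_mulVec]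

theorem onWire_mulVec_onWire (w : Wire n) (U V : Matrix (Fin 2) (Fin 2) ℂ)
    (ψ : (Wire n → Fin 2) → ℂ) :
    onWire w U *ᵥ (onWire w V *ᵥ ψ) = onWire w (U * V) *ᵥ ψ := by
  rw [Matrix.mulVec_mulVec, onWire_mul]

/-- The exponents of `V` accumulated on the target are `x₂`, then `-(x₁ ⊕ x₂)`, then `x₁`, and `x₁ +
x₂ - (x₁ ⊕ x₂) = 2 x₁ x₂`. The two CNOTs write the parity on the second control and then remove it.
-/
theorem gatesCC_mulVec_ket (c₁ c₂ t : Wire n) (h : c₂ ≠ c₁) (h₁ : t ≠ c₁) (h₂ : t ≠ c₂)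
    (V : Matrix.unitaryGroup (Fin 2) ℂ) (x : Wire n → Fin 2) :
    gatesMatrix (gatesCC c₁ c₂ t h h₁ h₂ V) *ᵥ ket x =
      if x c₁ = 1 ∧ x c₂ = 1 then onWire t (V.1 * V.1) *ᵥ ket x else ket x := by
  simp only [gatesCC, gatesMatrix_cons_mulVec, gatesMatrix_nil_mulVec]
  have b1 := hasBit_ket c₁ x
  have b2 := hasBit_ket c₂ x
  have x1 : x c₁ = 0 ∨ x c₁ = 1 := by omega
  have x2 : x c₂ = 0 ∨ x c₂ = 1 := by omega
  rcases x1 with x1 | x1 <;> rcases x2 with x2 | x2 <;> rw [x1] at b1 <;> rw [x2] at b2 <;>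
    simp only [x1, x2]
  · simp [b1.gateC_mulVec, b2.gateC_mulVec]
  · have b1' := (b1.onWire h₁ V.1)
    have b2' := (b2.onWire h₂ V.1)
    rw [b2.gateC_mulVec, if_pos rfl, b1'.gateC_mulVec, if_neg (by decide), b2'.gateC_mulVec,
      if_pos rfl, onWire_mulVec_onWire, unitary_inv_mul, onWire_one, Matrix.one_mulVec]
    simp [b1.gateC_mulVec]
  · rw [b2.gateC_mulVec, if_neg (by decide), b1.gateC_mulVec, if_pos rfl,
      onWire_pauliX_mulVec_ket]
    have b3 := hasBit_ket c₂ (Function.update x c₂ (x c₂ + 1))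
    have b4 := hasBit_ket c₁ (Function.update x c₂ (x c₂ + 1))
    rw [Function.update_self, x2, zero_add] at b3
    rw [Function.update_of_ne h.symm, x1, x2, zero_add] at b4
    rw [x2, zero_add, b3.gateC_mulVec, if_pos rfl, (b4.onWire h₁ _).gateC_mulVec, if_pos rfl,
      onWire_comm_mulVec h₂.symm, onWire_pauliX_mulVec_ket]
    have : Function.update (Function.update x c₂ 1) c₂ (Function.update x c₂ 1 c₂ + 1) = x := by
      rw [Function.update_idem, Function.update_self]
      convert Function.update_eq_self c₂ x
      rw [x2]; rfl
    rw [this, (b1.onWire h₁ _).gateC_mulVec, if_pos rfl, onWire_mulVec_onWire,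
      unitary_mul_inv, onWire_one, Matrix.one_mulVec]
    simp
  · rw [b2.gateC_mulVec, if_pos rfl, (b1.onWire h₁ _).gateC_mulVec, if_pos rfl,
      onWire_comm_mulVec h₂.symm, onWire_pauliX_mulVec_ket]
    have b3 := hasBit_ket c₂ (Function.update x c₂ (x c₂ + 1))
    have b4 := hasBit_ket c₁ (Function.update x c₂ (x c₂ + 1))
    have e : (1 : Fin 2) + 1 = 0 := rfl
    rw [Function.update_self, x2, e] at b3
    rw [Function.update_of_ne h.symm, x1, x2, e] at b4
    rw [x2, e, (b3.onWire h₂ _).gateC_mulVec, if_neg (by decide), (b4.onWire h₁ _).gateC_mulVec,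
      if_pos rfl, onWire_comm_mulVec h₂.symm, onWire_pauliX_mulVec_ket]
    have : Function.update (Function.update x c₂ 0) c₂ (Function.update x c₂ 0 c₂ + 1) = x := by
      rw [Function.update_idem, Function.update_self]
      convert Function.update_eq_self c₂ x
      rw [x2]; rfl
    rw [this, (b1.onWire h₁ _).gateC_mulVec, if_pos rfl, onWire_mulVec_onWire]
    simp

theorem sqrtX_mul_self : sqrtX * sqrtX = pauliX := by
  have h := Complex.I_sq
  ext i j
  fin_cases i <;> fin_cases j <;> simp [sqrtX, pauliX, Matrix.mul_apply, Fin.sum_univ_two] <;>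
    ring_nf <;> rw [h] <;> ring

theorem toffoli_mulVec_ket (c₁ c₂ t : Wire n) (h : c₂ ≠ c₁) (h₁ : t ≠ c₁) (h₂ : t ≠ c₂)
    (x : Wire n → Fin 2) :
    gatesMatrix (toffoli c₁ c₂ t h h₁ h₂) *ᵥ ket x =
      ket (Function.update x t (x t + x c₁ * x c₂)) := by
  rw [toffoli, gatesCC_mulVec_ket, sqrtX_mul_self, onWire_pauliX_mulVec_ket]
  obtain h | h : x c₁ = 0 ∨ x c₁ = 1 := by omega
  · simp [h]
  · obtain h' | h' : x c₂ = 0 ∨ x c₂ = 1 := by omega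
    · simp [h, h']
    · simp [h, h']

theorem ccZ_mulVec_ket (x : Wire n → Fin 2) :
    gatesMatrix ccZ *ᵥ ket x =
      (if x measWire = 1 ∧ x lcuWire₁ = 1 ∧ x lcuWire₂ = 1 then (-1 : ℂ) else 1) • ket x := by
  have : phaseS.1 * phaseS.1 = phase (-1) := by
    ext i j
    fin_cases i <;> fin_cases j <;> simp [phaseS, phase, Matrix.mul_apply, Fin.sum_univ_two]
  rw [ccZ, gatesCC_mulVec_ket, this, onWire_phase_mulVec_ket]
  by_cases h : x measWire = 1 ∧ x lcuWire₁ = 1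
  · rw [if_pos h]
    simp [h.1, h.2]
  · rw [if_neg h, if_neg, one_smul]
    tauto

/-- The effect of the controlled swap of the `i`-th qubits on a bit string. -/
def swapBit (i : Fin n) (x : Wire n → Fin 2) : Wire n → Fin 2
  | Sum.inl a => x (Sum.inl a)
  | Sum.inr (r, j) => if x swapWire = 1 ∧ j = i then x (regWire (r + 1) j) else x (regWire r j)

theorem cSwapQubit_mulVec_ket (i : Fin n) (x : Wire n → Fin 2) :
    gatesMatrix (cSwapQubit i) *ᵥ ket x = ket (swapBit i x) := by
  simp only [cSwapQubit, gatesMatrix_append_mulVec, gatesMatrix_cons_mulVec,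
    gatesMatrix_nil_mulVec, cnot_mulVec_ket, toffoli_mulVec_ket]
  congr 1
  funext w
  -- Here `a` is the swap ancilla, `b` the bit of register `1` and `c` that of register `0`; the two
  -- expressions are the new bits of registers `1` and `0` after CNOT, Toffoli, CNOT, in arithmetic
  -- modulo two.
  have fin2 : ∀ a b c : Fin 2, a = 1 → b + (a * (c + b)) = c ∧ c + b + (b + a * (c + b)) = b := by
    decide
  have fin2' : ∀ a b c : Fin 2, a ≠ 1 → b + (a * (c + b)) = b ∧ c + b + (b + a * (c + b)) = c := by
    decide
  rcases w with a | ⟨r, j⟩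
  · simp [swapBit]
  · by_cases hj : j = i
    · subst hj
      by_cases hs : x swapWire = 1
      · have := fin2 _ (x (regWire 1 j)) (x (regWire 0 j)) hs
        fin_cases r <;> simp [swapBit, hs] at this ⊢
        · exact this.2
        · exact this.1
      · have := fin2' _ (x (regWire 1 j)) (x (regWire 0 j)) hs
        fin_cases r <;> simp [swapBit, hs] at this ⊢
        · exact this.2
        · exact this.1
    · simp [swapBit, hj]

end BasicGates

/-! ### The operators `W` and `A` on basis vectors; exact amplitude amplification. -/

section Step

open Matrix

variable {n : ℕ}

/-- The bit string with the given bits on the four single wires and on the two registers. -/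
def wires (m a b w : Fin 2) (u v : Fin n → Fin 2) : Wire n → Fin 2
  | Sum.inl i => ![m, a, b, w] i
  | Sum.inr (r, i) => if r = 0 then u i else v i

@[simp] theorem wires_meas (m a b w : Fin 2) (u v : Fin n → Fin 2) :
    wires m a b w u v measWire = m := rfl

@[simp] theorem wires_lcu₁ (m a b w : Fin 2) (u v : Fin n → Fin 2) :
    wires m a b w u v lcuWire₁ = a := rfl

@[simp] theorem wires_lcu₂ (m a b w : Fin 2) (u v : Fin n → Fin 2) :
    wires m a b w u v lcuWire₂ = b := rfl

@[simp] theorem wires_swap (m a b w : Fin 2) (u v : Fin n → Fin 2) :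
    wires m a b w u v swapWire = w := rfl

theorem wires_ext {x y : Wire n → Fin 2} (h0 : x measWire = y measWire)
    (h1 : x lcuWire₁ = y lcuWire₁) (h2 : x lcuWire₂ = y lcuWire₂) (h3 : x swapWire = y swapWire)
    (hr : ∀ r i, x (regWire r i) = y (regWire r i)) : x = y := by
  funext w
  rcases w with a | ⟨r, i⟩
  · fin_cases a
    · exact h0
    · exact h1
    · exact h2
    · exact h3
  · exact hr r i

@[simp] theorem update_wires_meas (m a b w c : Fin 2) (u v : Fin n → Fin 2) :
    Function.update (wires m a b w u v) measWire c = wires c a b w u v := by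
  apply wires_ext <;> simp [wires]

@[simp] theorem update_wires_lcu₁ (m a b w c : Fin 2) (u v : Fin n → Fin 2) :
    Function.update (wires m a b w u v) lcuWire₁ c = wires m c b w u v := by
  apply wires_ext <;> simp [wires]

@[simp] theorem update_wires_lcu₂ (m a b w c : Fin 2) (u v : Fin n → Fin 2) :
    Function.update (wires m a b w u v) lcuWire₂ c = wires m a c w u v := by
  apply wires_ext <;> simp [wires]

@[simp] theorem update_wires_swap (m a b w c : Fin 2) (u v : Fin n → Fin 2) :
    Function.update (wires m a b w u v) swapWire c = wires m a b c u v := by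
  apply wires_ext <;> simp [wires]

theorem flatMap_cSwapQubit_mulVec_ket (l : List (Fin n)) (x : Wire n → Fin 2) :
    gatesMatrix (l.flatMap cSwapQubit) *ᵥ ket x = ket (l.foldl (fun y i => swapBit i y) x) := by
  induction l generalizing x with
  | nil => simp [gatesMatrix]
  | cons i l ih =>
    rw [List.flatMap_cons, gatesMatrix_append_mulVec, cSwapQubit_mulVec_ket, ih, List.foldl_cons]

theorem foldl_swapBit_inl (l : List (Fin n)) (x : Wire n → Fin 2) (a : Fin 4) :
    l.foldl (fun y i => swapBit i y) x (Sum.inl a) = x (Sum.inl a) := by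
  induction l generalizing x with
  | nil => rfl
  | cons i l ih => rw [List.foldl_cons, ih]; rfl

/-- Without repetitions each position is exchanged at most once; a second exchange would undo the
first. -/
theorem foldl_swapBit_inr (l : List (Fin n)) (hl : l.Nodup) (x : Wire n → Fin 2) (r : Fin 2)
    (j : Fin n) :
    l.foldl (fun y i => swapBit i y) x (regWire r j) =
      if x swapWire = 1 ∧ j ∈ l then x (regWire (r + 1) j) else x (regWire r j) := by
  induction l generalizing x with
  | nil => simp
  | cons i l ih =>
    rw [List.nodup_cons] at hl
    rw [List.foldl_cons, ih hl.2]
    by_cases h1 : x swapWire = 1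
    · by_cases hj : j = i
      · subst hj
        simp [swapBit, h1, hl.1]
      · simp [swapBit, h1, hj]
    · simp [swapBit, h1]

theorem cSwap_mulVec_ket (m a b w : Fin 2) (u v : Fin n → Fin 2) :
    gatesMatrix ((List.finRange n).flatMap cSwapQubit) *ᵥ ket (wires m a b w u v) =
      ket (if w = 1 then wires m a b w v u else wires m a b w u v) := by
  rw [flatMap_cSwapQubit_mulVec_ket]
  congr 1
  have key : ∀ r j, (if w = 1 then wires m a b w v u else wires m a b w u v) (regWire r j) =
      if wires m a b w u v swapWire = 1 ∧ j ∈ List.finRange n then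
        wires m a b w u v (regWire (r + 1) j) else wires m a b w u v (regWire r j) := by
    intro r j
    by_cases hw : w = 1
    · fin_cases r <;> simp [wires, hw]
    · simp [hw]
  apply wires_ext
  · rw [foldl_swapBit_inl]; split_ifs <;> rfl
  · rw [foldl_swapBit_inl]; split_ifs <;> rfl
  · rw [foldl_swapBit_inl]; split_ifs <;> rfl
  · rw [foldl_swapBit_inl]; split_ifs <;> rfl
  · intro r j
    rw [foldl_swapBit_inr _ (List.nodup_finRange n), key]

/-- The phase `-i sgn Δ`. -/
def selectPhase (Δ : ℝ) : ℂ := if 0 < Δ then -Complex.I else Complex.I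

theorem selectPhase_mul_conj (Δ : ℝ) : selectPhase Δ * star (selectPhase Δ) = 1 := by
  unfold selectPhase
  split_ifs <;> simp

theorem conj_selectPhase (Δ : ℝ) : star (selectPhase Δ) = -selectPhase Δ := by
  unfold selectPhase
  split_ifs <;> simp

/-- The first Toffoli writes the product `m * b` on the clean swap ancilla, the controlled swaps act
on it, and the second Toffoli erases it. The controlled phase gate then contributes `i`, turned into
`-i` by the extra `Z` when `0 < Δ`. -/
theorem cSelect_mulVec_ket (Δ : ℝ) (m a b : Fin 2) (u v : Fin n → Fin 2) :
    gatesMatrix (cSelect Δ) *ᵥ ket (wires m a b 0 u v) =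
      if m = 1 ∧ b = 1 then selectPhase Δ • ket (wires m a b 0 v u)
      else ket (wires m a b 0 u v) := by
  simp only [cSelect, gatesMatrix_append_mulVec, toffoli_mulVec_ket, update_wires_swap,
    wires_meas, wires_lcu₂, wires_swap, cSwap_mulVec_ket, zero_add]
  by_cases h : m = 1 ∧ b = 1
  · obtain ⟨rfl, rfl⟩ := h
    have e : (1 : Fin 2) + 1 = 0 := rfl
    unfold selectPhase
    split_ifs <;>
    simp [gatesMatrix_cons_mulVec, gatesMatrix_nil_mulVec, gateC_mulVec_ket,
      phaseS, pauliZ, onWire_phase_mulVec_ket, Matrix.mulVec_smul, e] <;> tauto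
  · have hmb : m * b = 0 := by
      have : ∀ m b : Fin 2, ¬(m = 1 ∧ b = 1) → m * b = 0 := by decide
      exact this m b h
    have h01 : ¬(0 : Fin 2) = 1 := by decide
    rw [hmb, if_neg h]
    simp only [if_neg h01, wires_meas, wires_lcu₂, wires_swap, update_wires_swap, hmb, add_zero]
    have h' : m = 0 ∨ (m = 1 ∧ b = 0) := by omega
    rcases h' with rfl | ⟨rfl, rfl⟩ <;> split_ifs <;>
      simp [gatesMatrix_cons_mulVec, gatesMatrix_nil_mulVec, gateC_mulVec_ket,
        phaseS, pauliZ, onWire_phase_mulVec_ket]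

theorem dagger_cSelect_mulVec_ket (Δ : ℝ) (m a b : Fin 2) (u v : Fin n → Fin 2) :
    gatesMatrix (daggerList (cSelect Δ)) *ᵥ ket (wires m a b 0 u v) =
      if m = 1 ∧ b = 1 then star (selectPhase Δ) • ket (wires m a b 0 v u)
      else ket (wires m a b 0 u v) := by
  by_cases h : m = 1 ∧ b = 1
  · have h1 := cSelect_mulVec_ket Δ m a b v u
    rw [if_pos h] at h1 ⊢
    have h2 := gatesMatrix_daggerList_mulVec (cSelect Δ) (ket (wires m a b 0 v u))
    rw [h1, Matrix.mulVec_smul] at h2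
    rw [← h2, smul_smul, mul_comm, selectPhase_mul_conj, one_smul]
  · have h1 := cSelect_mulVec_ket Δ m a b u v
    rw [if_neg h] at h1 ⊢
    have h2 := gatesMatrix_daggerList_mulVec (cSelect Δ) (ket (wires m a b 0 u v))
    rwa [h1] at h2

theorem gateC_dagger (b : Fin 2) (c t : Wire n) (h : t ≠ c) (U : Matrix.unitaryGroup (Fin 2) ℂ) :
    (gateC b c t h U).dagger = gateC b c t h U⁻¹ := by
  have key : (⟨controlled b U.1, controlled_mem b U.2⟩ :
      Matrix.unitaryGroup (Fin 2 × Fin 2) ℂ)⁻¹ =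
      ⟨controlled b (U⁻¹).1, controlled_mem b (U⁻¹).2⟩ := by
    apply Subtype.ext
    simp only [Matrix.UnitaryGroup.inv_val, controlled, Matrix.star_eq_conjTranspose,
      Matrix.blockDiagonal_conjTranspose]
    congr 1
    ext1 b'
    split_ifs <;> simp
  exact congrArg (Gate.two t c h) key

theorem rotY_inv (φ : ℝ) : star (rotY φ) = rotY (-φ) := by
  ext i j
  have h1 : (starRingEnd ℂ) (Complex.cos φ) = Complex.cos φ := by
    rw [← Complex.ofReal_cos, Complex.conj_ofReal]
  have h2 : (starRingEnd ℂ) (Complex.sin φ) = Complex.sin φ := by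
    rw [← Complex.ofReal_sin, Complex.conj_ofReal]
  fin_cases i <;> fin_cases j <;> simp [rotY, h1, h2]

theorem onWire_rotY_mulVec_ket_zero (w : Wire n) (φ : ℝ) (x : Wire n → Fin 2) (h : x w = 0) :
    onWire w (rotY φ) *ᵥ ket x = (Real.cos φ : ℂ) • ket (Function.update x w 0) +
      (Real.sin φ : ℂ) • ket (Function.update x w 1) := by
  rw [onWire_mulVec_ket, Fin.sum_univ_two, h]
  rfl

theorem onWire_rotY_mulVec_ket_one (w : Wire n) (φ : ℝ) (x : Wire n → Fin 2) (h : x w = 1) :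
    onWire w (rotY φ) *ᵥ ket x = (-(Real.sin φ : ℂ)) • ket (Function.update x w 0) +
      (Real.cos φ : ℂ) • ket (Function.update x w 1) := by
  rw [onWire_mulVec_ket, Fin.sum_univ_two, h]
  rfl

/-- Half the angle of the rotation `R₁`. -/
def angle₁ (Δ : ℝ) : ℝ := Real.arccos (lcuAlpha Δ / 2)

/-- Half the angle of the rotation `R₂`. -/
def angle₂ (Δ : ℝ) : ℝ := Real.arccos (√(Real.cos Δ / lcuAlpha Δ))

theorem dagger_cW (Δ : ℝ) : daggerList (cW Δ : List (Gate (Wire n))) =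
    [.one lcuWire₂ (rotR₂ Δ)] ++ daggerList (cSelect Δ) ++
      [gateC 0 lcuWire₁ lcuWire₂ (by simp) (rotR₂ Δ)⁻¹,
        gateC 1 measWire lcuWire₁ (by simp) (rotR₁ Δ)⁻¹] := by
  rw [cW, daggerList_append, daggerList_append]
  have h1 : daggerList [gateC 1 measWire lcuWire₁ (by simp) (rotR₁ Δ),
      gateC 0 (lcuWire₁ : Wire n) lcuWire₂ (by simp) (rotR₂ Δ)] =
      [gateC 0 lcuWire₁ lcuWire₂ (by simp) (rotR₂ Δ)⁻¹,
        gateC 1 measWire lcuWire₁ (by simp) (rotR₁ Δ)⁻¹] := by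
    rw [← gateC_dagger, ← gateC_dagger]; rfl
  have h2 : daggerList [Gate.one (lcuWire₂ : Wire n) (rotR₂ Δ)⁻¹] =
      [.one lcuWire₂ (rotR₂ Δ)] := by
    simp [daggerList, Gate.dagger]
  rw [h1, h2, List.append_assoc]

theorem rotR₁_val (Δ : ℝ) : (rotR₁ Δ).1 = rotY (angle₁ Δ) := rfl

theorem rotR₂_val (Δ : ℝ) : (rotR₂ Δ).1 = rotY (angle₂ Δ) := rfl

theorem rotR₁_inv_val (Δ : ℝ) : ((rotR₁ Δ)⁻¹).1 = rotY (-angle₁ Δ) := by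
  rw [Matrix.UnitaryGroup.inv_val, rotR₁_val, rotY_inv]

theorem rotR₂_inv_val (Δ : ℝ) : ((rotR₂ Δ)⁻¹).1 = rotY (-angle₂ Δ) := by
  rw [Matrix.UnitaryGroup.inv_val, rotR₂_val, rotY_inv]

theorem cos_sq_add_sin_sq_ofReal (φ : ℝ) :
    (Real.cos φ : ℂ) * (Real.cos φ : ℂ) + (Real.sin φ : ℂ) * (Real.sin φ : ℂ) = 1 := by
  exact_mod_cast by nlinarith [Real.cos_sq_add_sin_sq φ]

/-- With the measure qubit at zero neither `R₁` nor the select operator fires. The rotation `R₂` is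
not controlled by the measure qubit, but the first ancilla is still zero, so `R₂` acts and the final
`R₂†` cancels it. -/
theorem cW_mulVec_ket_zero (Δ : ℝ) (u v : Fin n → Fin 2) :
    gatesMatrix (cW Δ) *ᵥ ket (wires 0 0 0 0 u v) = ket (wires 0 0 0 0 u v) := by
  simp only [cW, gatesMatrix_append_mulVec, gatesMatrix_cons_mulVec, gatesMatrix_nil_mulVec,
    gateC_mulVec_ket, wires_meas, wires_lcu₁, Fin.zero_eq_one_iff, OfNat.ofNat_ne_one, if_false,
    if_true, rotR₂_val, onWire_rotY_mulVec_ket_zero _ _ _ (wires_lcu₂ _ _ _ _ _ _),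
    Matrix.mulVec_add, Matrix.mulVec_smul, update_wires_lcu₂, cSelect_mulVec_ket, false_and,
    toMatrix_one, rotR₂_inv_val, onWire_rotY_mulVec_ket_one _ _ _ (wires_lcu₂ _ _ _ _ _ _),
    Real.cos_neg, Real.sin_neg, Complex.ofReal_neg]
  linear_combination (norm := module) (cos_sq_add_sin_sq_ofReal (angle₂ Δ)) • ket (wires 0 0 0 0 u v)

theorem dagger_cW_mulVec_ket_zero (Δ : ℝ) (u v : Fin n → Fin 2) :
    gatesMatrix (daggerList (cW Δ)) *ᵥ ket (wires 0 0 0 0 u v) = ket (wires 0 0 0 0 u v) := by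
  have := gatesMatrix_daggerList_mulVec (cW Δ) (ket (wires 0 0 0 0 u v))
  rwa [cW_mulVec_ket_zero] at this

/-- Linear combination of unitaries: on the ancilla state `|00⟩` the amplitude is `cos θ₁ (cos² θ₂ +
sin² θ₂ (-i sgn Δ) 𝒮)`, with `θ₁`, `θ₂` the half angles. The other terms are spelled out because the
reflections treat them separately. -/
theorem cW_mulVec_ket_one (Δ : ℝ) (u v : Fin n → Fin 2) :
    gatesMatrix (cW Δ) *ᵥ ket (wires 1 0 0 0 u v) =
      (Real.cos (angle₁ Δ) : ℂ) • (
        ((Real.cos (angle₂ Δ) : ℂ) * Real.cos (angle₂ Δ)) • ket (wires 1 0 0 0 u v) +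
        ((Real.sin (angle₂ Δ) : ℂ) * Real.sin (angle₂ Δ) * selectPhase Δ) •
          ket (wires 1 0 0 0 v u) -
        ((Real.cos (angle₂ Δ) : ℂ) * Real.sin (angle₂ Δ)) • ket (wires 1 0 1 0 u v) +
        ((Real.sin (angle₂ Δ) : ℂ) * Real.cos (angle₂ Δ) * selectPhase Δ) •
          ket (wires 1 0 1 0 v u)) +
      (Real.sin (angle₁ Δ) : ℂ) • ((Real.cos (angle₂ Δ) : ℂ) • ket (wires 1 1 0 0 u v) -
        (Real.sin (angle₂ Δ) : ℂ) • ket (wires 1 1 1 0 u v)) := by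
  simp only [cW, gatesMatrix_append_mulVec, gatesMatrix_cons_mulVec, gatesMatrix_nil_mulVec,
    gateC_mulVec_ket, wires_meas, wires_lcu₁, one_ne_zero, Fin.zero_eq_one_iff,
    OfNat.ofNat_ne_one, if_false,
    if_true, rotR₁_val, onWire_rotY_mulVec_ket_zero _ _ _ (wires_lcu₁ _ _ _ _ _ _),
    rotR₂_val, onWire_rotY_mulVec_ket_zero _ _ _ (wires_lcu₂ _ _ _ _ _ _),
    Matrix.mulVec_add, Matrix.mulVec_smul, update_wires_lcu₂, update_wires_lcu₁,
    cSelect_mulVec_ket, and_false, and_true,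
    toMatrix_one, rotR₂_inv_val, onWire_rotY_mulVec_ket_one _ _ _ (wires_lcu₂ _ _ _ _ _ _),
    Real.cos_neg, Real.sin_neg, Complex.ofReal_neg]
  module

theorem dagger_cW_mulVec_ket_one (Δ : ℝ) (u v : Fin n → Fin 2) :
    gatesMatrix (daggerList (cW Δ)) *ᵥ ket (wires 1 0 0 0 u v) =
      ((Real.cos (angle₂ Δ) : ℂ) * Real.cos (angle₂ Δ)) •
        ((Real.cos (angle₁ Δ) : ℂ) • ket (wires 1 0 0 0 u v) -
          (Real.sin (angle₁ Δ) : ℂ) • ket (wires 1 1 0 0 u v)) -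
      ((Real.cos (angle₂ Δ) : ℂ) * Real.sin (angle₂ Δ)) •
        ((Real.cos (angle₁ Δ) : ℂ) • ket (wires 1 0 1 0 u v) -
          (Real.sin (angle₁ Δ) : ℂ) • ket (wires 1 1 1 0 u v)) -
      ((Real.sin (angle₂ Δ) : ℂ) * Real.sin (angle₂ Δ) * selectPhase Δ) •
        ((Real.cos (angle₁ Δ) : ℂ) • ket (wires 1 0 0 0 v u) -
          (Real.sin (angle₁ Δ) : ℂ) • ket (wires 1 1 0 0 v u)) -
      ((Real.sin (angle₂ Δ) : ℂ) * Real.cos (angle₂ Δ) * selectPhase Δ) •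
        ((Real.cos (angle₁ Δ) : ℂ) • ket (wires 1 0 1 0 v u) -
          (Real.sin (angle₁ Δ) : ℂ) • ket (wires 1 1 1 0 v u)) := by
  simp only [dagger_cW, gatesMatrix_append_mulVec, gatesMatrix_cons_mulVec,
    gatesMatrix_nil_mulVec, gateC_mulVec_ket, wires_meas, wires_lcu₁,
    Fin.zero_eq_one_iff, OfNat.ofNat_ne_one, if_false,
    if_true, rotR₁_inv_val, onWire_rotY_mulVec_ket_zero _ _ _ (wires_lcu₁ _ _ _ _ _ _),
    rotR₂_val, onWire_rotY_mulVec_ket_zero _ _ _ (wires_lcu₂ _ _ _ _ _ _),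
    Matrix.mulVec_add, Matrix.mulVec_smul, update_wires_lcu₂, update_wires_lcu₁,
    dagger_cSelect_mulVec_ket, and_false, and_true, conj_selectPhase,
    toMatrix_one, rotR₂_inv_val, onWire_rotY_mulVec_ket_one _ _ _ (wires_lcu₂ _ _ _ _ _ _),
    Real.cos_neg, Real.sin_neg, Complex.ofReal_neg]
  module

/-- Conjugation by `X` makes the controlled `Z` sign all of `a = 0`, and the doubly controlled `Z`
removes the sign again for `b = 1`. In `cNegReflect` the controlled `Z` precedes the `X`, so it
signs `a = 1` instead, which gives the overall minus sign. -/
theorem cReflect_mulVec_ket (m a b : Fin 2) (u v : Fin n → Fin 2) :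
    gatesMatrix cReflect *ᵥ ket (wires m a b 0 u v) =
      (if m = 1 ∧ a = 0 ∧ b = 0 then (-1 : ℂ) else 1) • ket (wires m a b 0 u v) := by
  have hm : m = 0 ∨ m = 1 := by omega
  have ha : a = 0 ∨ a = 1 := by omega
  have hb : b = 0 ∨ b = 1 := by omega
  have e : (1 : Fin 2) + 1 = 0 := rfl
  rcases hm with rfl | rfl <;> rcases ha with rfl | rfl <;> rcases hb with rfl | rfl <;>
  simp [cReflect, gatesMatrix_append_mulVec, gatesMatrix_cons_mulVec, gatesMatrix_nil_mulVec,
    gateC_mulVec_ket, gateX_mulVec_ket, ccZ_mulVec_ket, pauliZ, onWire_phase_mulVec_ket,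
    Matrix.mulVec_neg, e]

theorem cNegReflect_mulVec_ket (m a b : Fin 2) (u v : Fin n → Fin 2) :
    gatesMatrix cNegReflect *ᵥ ket (wires m a b 0 u v) =
      (if m = 0 ∨ (a = 0 ∧ b = 0) then (1 : ℂ) else -1) • ket (wires m a b 0 u v) := by
  have hm : m = 0 ∨ m = 1 := by omega
  have ha : a = 0 ∨ a = 1 := by omega
  have hb : b = 0 ∨ b = 1 := by omega
  have e : (1 : Fin 2) + 1 = 0 := rfl
  rcases hm with rfl | rfl <;> rcases ha with rfl | rfl <;> rcases hb with rfl | rfl <;>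
  simp [cNegReflect, gatesMatrix_append_mulVec, gatesMatrix_cons_mulVec, gatesMatrix_nil_mulVec,
    gateC_mulVec_ket, gateX_mulVec_ket, ccZ_mulVec_ket, pauliZ, onWire_phase_mulVec_ket,
    Matrix.mulVec_neg, e]

theorem cA_mulVec_ket_zero (Δ : ℝ) (u v : Fin n → Fin 2) :
    gatesMatrix (cA Δ) *ᵥ ket (wires 0 0 0 0 u v) = ket (wires 0 0 0 0 u v) := by
  simp [cA, gatesMatrix_append_mulVec, cW_mulVec_ket_zero, dagger_cW_mulVec_ket_zero,
    cReflect_mulVec_ket, cNegReflect_mulVec_ket]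

theorem lcuAlpha_pos {Δ : ℝ} (h : 0 < Real.cos Δ) : 0 < lcuAlpha Δ := by
  unfold lcuAlpha
  positivity

theorem lcuAlpha_le_two (Δ : ℝ) : lcuAlpha Δ ≤ 2 := by
  unfold lcuAlpha
  linarith [Real.cos_le_one Δ, Real.abs_sin_le_one Δ]

theorem cos_angle₁ {Δ : ℝ} (h : 0 < Real.cos Δ) : Real.cos (angle₁ Δ) = lcuAlpha Δ / 2 :=
  Real.cos_arccos (by linarith [lcuAlpha_pos h]) (by linarith [lcuAlpha_le_two Δ])

theorem cos_angle₂_sq {Δ : ℝ} (h : 0 < Real.cos Δ) :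
    Real.cos (angle₂ Δ) * Real.cos (angle₂ Δ) = Real.cos Δ / lcuAlpha Δ := by
  have hα := lcuAlpha_pos h
  have h1 : Real.cos Δ / lcuAlpha Δ ≤ 1 := by
    rw [div_le_one hα, lcuAlpha]; linarith [abs_nonneg (Real.sin Δ)]
  rw [angle₂, Real.cos_arccos, Real.mul_self_sqrt (by positivity)]
  · linarith [Real.sqrt_nonneg (Real.cos Δ / lcuAlpha Δ)]
  · exact Real.sqrt_le_one.mpr h1

theorem sin_angle₂_sq {Δ : ℝ} (h : 0 < Real.cos Δ) :
    Real.sin (angle₂ Δ) * Real.sin (angle₂ Δ) = |Real.sin Δ| / lcuAlpha Δ := by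
  have hα := lcuAlpha_pos h
  have h1 := cos_angle₂_sq h
  have h2 := Real.cos_sq_add_sin_sq (angle₂ Δ)
  have h3 : Real.cos Δ / lcuAlpha Δ + |Real.sin Δ| / lcuAlpha Δ = 1 := by
    rw [← add_div]; exact div_self hα.ne'
  nlinarith

theorem abs_sin_mul_selectPhase {Δ : ℝ} (h0 : Δ ≠ 0) (h1 : |Δ| ≤ 1) :
    ((|Real.sin Δ| : ℝ) : ℂ) * selectPhase Δ = -Complex.I * Real.sin Δ := by
  have hpi := Real.pi_gt_three
  rw [abs_le] at h1
  unfold selectPhase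
  split_ifs with h
  · rw [abs_of_pos (Real.sin_pos_of_pos_of_lt_pi h (by linarith))]; ring
  · have hneg : Δ < 0 := lt_of_le_of_ne (not_lt.mp h) h0
    rw [abs_of_neg (Real.sin_neg_of_neg_of_neg_pi_lt hneg (by linarith))]
    push_cast; ring

/-- The factor `α/2 = cos θ₁` of the first rotation cancels the normalization `1/α` of the second.
Together with `sin_angles_mul` this says that the `|00⟩` block of `W` is one half of `cos Δ - i sin
Δ 𝒮`; the amplitude `1/2` is the one that a single amplification round raises to exactly one. -/
theorem cos_angles_mul {Δ : ℝ} (h1 : |Δ| ≤ 1) :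
    2 * ((Real.cos (angle₁ Δ) : ℂ) * ((Real.cos (angle₂ Δ) : ℂ) * Real.cos (angle₂ Δ))) =
      Real.cos Δ := by
  have h := Real.cos_pos_of_le_one h1
  have hα := (lcuAlpha_pos h).ne'
  rw [← Complex.ofReal_mul, cos_angle₂_sq h, cos_angle₁ h]
  norm_cast
  field_simp

theorem sin_angles_mul {Δ : ℝ} (h0 : Δ ≠ 0) (h1 : |Δ| ≤ 1) :
    2 * ((Real.cos (angle₁ Δ) : ℂ) *
      ((Real.sin (angle₂ Δ) : ℂ) * Real.sin (angle₂ Δ) * selectPhase Δ)) =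
      -Complex.I * Real.sin Δ := by
  have h := Real.cos_pos_of_le_one h1
  have hα := (lcuAlpha_pos h).ne'
  rw [← abs_sin_mul_selectPhase h0 h1, ← Complex.ofReal_mul, sin_angle₂_sq h, cos_angle₁ h,
    ← mul_assoc, ← mul_assoc]
  congr 1
  norm_cast
  field_simp

/-- Oblivious amplitude amplification: on the ancilla state `|00⟩`, the operator `A` is `exp(-iΔ𝒮)`
(controlled by the measure qubit). -/
theorem cA_mulVec_ket_one {Δ : ℝ} (h0 : Δ ≠ 0) (h1 : |Δ| ≤ 1) (u v : Fin n → Fin 2) :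
    gatesMatrix (cA Δ) *ᵥ ket (wires 1 0 0 0 u v) =
      (Real.cos Δ : ℂ) • ket (wires 1 0 0 0 u v) +
        (-Complex.I * Real.sin Δ) • ket (wires 1 0 0 0 v u) := by
  have hc := cos_angles_mul h1
  have hs := sin_angles_mul h0 h1
  set c : ℂ := (Real.cos Δ : ℂ)
  set s : ℂ := -Complex.I * Real.sin Δ
  -- Put `G = c + s𝒮`. As `𝒮² = 1`, `c` is real and `s` imaginary, this is the unitarity `G†G = 1`.
  have hcs : c * c - s * s = 1 := by
    have := cos_sq_add_sin_sq_ofReal Δ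
    have hI := Complex.I_mul_I
    simp only [c, s]
    linear_combination this - (Real.sin Δ : ℂ) * (Real.sin Δ : ℂ) * hI
  -- Since `2PWψ = Gψ`, the reflection gives `Wψ - Gψ`; likewise `hN` is `-(I - 2P)W†φ = G†φ - W†φ`.
  have hR : gatesMatrix cReflect *ᵥ (gatesMatrix (cW Δ) *ᵥ ket (wires 1 0 0 0 u v)) =
      gatesMatrix (cW Δ) *ᵥ ket (wires 1 0 0 0 u v) -
        (c • ket (wires 1 0 0 0 u v) + s • ket (wires 1 0 0 0 v u)) := by
    rw [← hc, ← hs]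
    simp only [cW_mulVec_ket_one, Matrix.mulVec_add, Matrix.mulVec_sub, Matrix.mulVec_smul,
      cReflect_mulVec_ket]
    simp only [and_true, if_true, one_ne_zero, and_false, if_false]
    module
  have hN : ∀ u v : Fin n → Fin 2, gatesMatrix cNegReflect *ᵥ
      (gatesMatrix (daggerList (cW Δ)) *ᵥ ket (wires 1 0 0 0 u v)) =
      (c • ket (wires 1 0 0 0 u v) - s • ket (wires 1 0 0 0 v u)) -
        gatesMatrix (daggerList (cW Δ)) *ᵥ ket (wires 1 0 0 0 u v) := by
    intro u v
    rw [← hc, ← hs]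
    simp only [dagger_cW_mulVec_ket_one, Matrix.mulVec_sub,
      Matrix.mulVec_smul, cNegReflect_mulVec_ket]
    simp only [and_true, if_true, one_ne_zero, and_false, if_false, false_or]
    module
  have hWW : ∀ ψ, gatesMatrix (cW Δ) *ᵥ (gatesMatrix (daggerList (cW Δ)) *ᵥ ψ) =
      (ψ : (Wire n → Fin 2) → ℂ) := by
    intro ψ
    rw [Matrix.mulVec_mulVec, mul_eq_one_comm.mp (gatesMatrix_daggerList_mul (cW Δ)),
      Matrix.one_mulVec]
  have hN1 : gatesMatrix cNegReflect *ᵥ ket (wires 1 0 0 0 u v) = ket (wires 1 0 0 0 u v) := by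
    simp [cNegReflect_mulVec_ket]
  -- `-(I - 2P)W†(Wψ - Gψ) = ψ - G†Gψ + W†Gψ`, and the first two terms cancel. The last `W` then
  -- leaves exactly `Gψ`.
  simp only [cA, gatesMatrix_append_mulVec, hR, Matrix.mulVec_sub, Matrix.mulVec_add,
    Matrix.mulVec_smul, hN, gatesMatrix_daggerList_mulVec, hN1, hWW]
  linear_combination (norm := module) (-hcs) • (gatesMatrix (cW Δ) *ᵥ ket (wires 1 0 0 0 u v))

end Step

/-! ### Evolution of the density matrix with ancillas at zero, and the outcome probabilities. -/

section Evolution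

open Matrix

variable {n : ℕ}

/-- The computational basis of the measure qubit and the two registers. -/
abbrev Core (n : ℕ) : Type := Fin 2 × (Fin n → Fin 2) × (Fin n → Fin 2)

/-- The bit string that extends a bit string of the core by zeros on the ancillas. -/
def extend (a : Core n) : Wire n → Fin 2 := wires a.1 0 0 0 a.2.1 a.2.2

/-- The bits of the core. -/
def restrict (x : Wire n → Fin 2) : Core n :=
  (x measWire, fun i => x (regWire 0 i), fun i => x (regWire 1 i))

/-- The ancillas are all zero. -/
def AncillaZero (x : Wire n → Fin 2) : Prop :=
  x lcuWire₁ = 0 ∧ x lcuWire₂ = 0 ∧ x swapWire = 0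

instance (x : Wire n → Fin 2) : Decidable (AncillaZero x) := by
  unfold AncillaZero; infer_instance

theorem restrict_extend (a : Core n) : restrict (extend a) = a := rfl

theorem ancillaZero_extend (a : Core n) : AncillaZero (extend a) := ⟨rfl, rfl, rfl⟩

theorem extend_restrict {x : Wire n → Fin 2} (h : AncillaZero x) : extend (restrict x) = x := by
  apply wires_ext
  · rfl
  · exact h.1.symm
  · exact h.2.1.symm
  · exact h.2.2.symm
  · intro r i
    fin_cases r <;> rfl

theorem eq_extend_iff (x : Wire n → Fin 2) (a : Core n) :
    x = extend a ↔ AncillaZero x ∧ a = restrict x := by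
  constructor
  · rintro rfl
    exact ⟨ancillaZero_extend a, rfl⟩
  · rintro ⟨h, rfl⟩
    exact (extend_restrict h).symm

theorem extend_injective : Function.Injective (extend (n := n)) := fun a b h => by
  rw [← restrict_extend a, h, restrict_extend]

/-- The isometry that adds the ancillas in the state zero. -/
def embedding (n : ℕ) : Matrix (Wire n → Fin 2) (Core n) ℂ :=
  fun x a => if x = extend a then 1 else 0

/-- The operator on all wires given by an operator on the core and ancillas in the state zero. -/
def embed (s : Matrix (Core n) (Core n) ℂ) : WireMatrix n :=
  embedding n * s * (embedding n)ᴴ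

theorem embed_apply (s : Matrix (Core n) (Core n) ℂ) (x y : Wire n → Fin 2) :
    embed s x y = if AncillaZero x ∧ AncillaZero y then s (restrict x) (restrict y) else 0 := by
  simp only [embed, Matrix.mul_apply, embedding, Matrix.conjTranspose_apply, eq_extend_iff]
  by_cases hx : AncillaZero x <;> by_cases hy : AncillaZero y <;> simp [hx, hy]

theorem eq_embed {σ : WireMatrix n} {s : Matrix (Core n) (Core n) ℂ}
    (h0 : ∀ x y, ¬(AncillaZero x ∧ AncillaZero y) → σ x y = 0)
    (h : ∀ a b, σ (extend a) (extend b) = s a b) : σ = embed s := by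
  ext x y
  rw [embed_apply]
  split_ifs with hxy
  · rw [← h, extend_restrict hxy.1, extend_restrict hxy.2]
  · exact h0 x y hxy

theorem mul_embedding {M : WireMatrix n} {U : Matrix (Core n) (Core n) ℂ}
    (h : ∀ a, M *ᵥ ket (extend a) = ∑ b, U b a • ket (extend b)) :
    M * embedding n = embedding n * U := by
  ext x a
  have h1 : (M * embedding n) x a = (M *ᵥ ket (extend a)) x := by
    rw [Matrix.mul_apply]
    refine Finset.sum_congr rfl fun y _ => ?_
    simp [embedding, ket, Pi.single_apply]
  rw [h1, h, Matrix.mul_apply, Finset.sum_apply]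
  refine Finset.sum_congr rfl fun b _ => ?_
  simp [embedding, ket, Pi.single_apply]

/-- Only the action of `M` on basis vectors with zero ancillas is needed: it gives `M E = E U` for
the isometry `E`. What `M` does elsewhere is irrelevant, which is why `A` need not be computed on
other ancilla states. -/
theorem conj_embed {M : WireMatrix n} {U : Matrix (Core n) (Core n) ℂ}
    (h : ∀ a, M *ᵥ ket (extend a) = ∑ b, U b a • ket (extend b))
    (s : Matrix (Core n) (Core n) ℂ) :
    M * embed s * Mᴴ = embed (U * s * Uᴴ) := by
  have h1 := mul_embedding h
  have h2 : (embedding n)ᴴ * Mᴴ = Uᴴ * (embedding n)ᴴ := by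
    rw [← Matrix.conjTranspose_mul, h1, Matrix.conjTranspose_mul]
  unfold embed
  calc M * (embedding n * s * (embedding n)ᴴ) * Mᴴ
      = (M * embedding n) * s * ((embedding n)ᴴ * Mᴴ) := by simp only [Matrix.mul_assoc]
    _ = _ := by rw [h1, h2]; simp only [Matrix.mul_assoc]

theorem foldl_gates (c : List (Gate (Wire n))) (ρ : QubitMatrix n) (σ : WireMatrix n) :
    (c.map Instr.gate).foldl (fun σ i => i.apply ρ σ) σ =
      gatesMatrix c * σ * (gatesMatrix c)ᴴ := by
  induction c generalizing σ with
  | nil => simp [gatesMatrix]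
  | cons g c ih =>
    rw [List.map_cons, List.foldl_cons, ih]
    simp only [Instr.apply, gatesMatrix, Matrix.conjTranspose_mul, Matrix.mul_assoc]

/-- Initialization of the main register on the core. -/
def loadMain (ρ : QubitMatrix n) (s : Matrix (Core n) (Core n) ℂ) :
    Matrix (Core n) (Core n) ℂ :=
  fun a b => ρ a.2.1 b.2.1 * ∑ z, s (a.1, z, a.2.2) (b.1, z, b.2.2)

/-- Initialization of the ancillary register on the core. -/
def loadAnc (ρ : QubitMatrix n) (s : Matrix (Core n) (Core n) ℂ) :
    Matrix (Core n) (Core n) ℂ :=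
  fun a b => ρ a.2.2 b.2.2 * ∑ z, s (a.1, a.2.1, z) (b.1, b.2.1, z)

theorem ancillaZero_overwrite (r : Fin 2) (z : Fin n → Fin 2) (x : Wire n → Fin 2) :
    AncillaZero (Instr.overwrite r z x) ↔ AncillaZero x := Iff.rfl

theorem load_zero_embed (ρ : QubitMatrix n) (s : Matrix (Core n) (Core n) ℂ) :
    (Instr.load 0).apply ρ (embed s) = embed (loadMain ρ s) := by
  apply eq_embed
  · intro x y h
    simp only [Instr.apply, embed_apply, ancillaZero_overwrite, if_neg h]
    simp
  · intro a b
    simp only [Instr.apply, embed_apply, ancillaZero_overwrite, ancillaZero_extend, and_self,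
      if_true, loadMain]
    rfl

theorem load_one_embed (ρ : QubitMatrix n) (s : Matrix (Core n) (Core n) ℂ) :
    (Instr.load 1).apply ρ (embed s) = embed (loadAnc ρ s) := by
  apply eq_embed
  · intro x y h
    simp only [Instr.apply, embed_apply, ancillaZero_overwrite, if_neg h]
    simp
  · intro a b
    simp only [Instr.apply, embed_apply, ancillaZero_overwrite, ancillaZero_extend, and_self,
      if_true, loadAnc]
    rfl

/-- The initial state of the core. -/
def coreInit (n : ℕ) : Matrix (Core n) (Core n) ℂ := fun a b => if a = 0 ∧ b = 0 then 1 else 0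

theorem extend_eq_zero_iff (a : Core n) : extend a = 0 ↔ a = 0 := by
  have h0 : extend (0 : Core n) = 0 := by
    apply wires_ext <;> try rfl
    intro r i
    fin_cases r <;> rfl
  rw [← h0]
  exact extend_injective.eq_iff

theorem initialState_eq : (Circuit.initialState : WireMatrix n) = embed (coreInit n) := by
  apply eq_embed
  · intro x y h
    unfold Circuit.initialState
    rw [if_neg]
    rintro ⟨rfl, rfl⟩
    exact h ⟨⟨rfl, rfl, rfl⟩, rfl, rfl, rfl⟩
  · intro a b
    simp only [Circuit.initialState, coreInit, extend_eq_zero_iff]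

/-- The Hadamard gate on the measure qubit of the core. -/
def coreH (n : ℕ) : Matrix (Core n) (Core n) ℂ :=
  fun a b => if a.2 = b.2 then hadamardH a.1 b.1 else 0

theorem gateH_embed (s : Matrix (Core n) (Core n) ℂ) (ρ : QubitMatrix n) :
    (Instr.gate (gateH measWire)).apply ρ (embed s) = embed (coreH n * s * (coreH n)ᴴ) := by
  apply conj_embed
  rintro ⟨m, w⟩
  rw [gateH, toMatrix_one, onWire_mulVec_ket, Fintype.sum_prod_type]
  refine Finset.sum_congr rfl fun a _ => ?_
  rw [Finset.sum_eq_single w]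
  · simp [coreH, extend]
  · intro b _ hb
    simp [coreH, hb]
  · simp

/-- Exchange of the two registers. -/
def swapCore (a : Core n) : Core n := (a.1, a.2.2, a.2.1)

/-- `c + σ 𝒮`, controlled by the measure qubit. -/
def coreStep (c σ : ℂ) : Matrix (Core n) (Core n) ℂ :=
  fun b a => if b.1 = 0 then (if a = b then 1 else 0)
    else c * (if a = b then 1 else 0) + σ * (if a = swapCore b then 1 else 0)

theorem coreStep_mul (c σ : ℂ) (s : Matrix (Core n) (Core n) ℂ) (a b : Core n) :
    ((coreStep c σ : Matrix (Core n) (Core n) ℂ) * s) a b = if a.1 = 0 then s a b else c * s a b + σ * s (swapCore a) b := by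
  simp only [Matrix.mul_apply, coreStep]
  split_ifs
  · simp
  · simp [add_mul, Finset.sum_add_distrib]

theorem mul_coreStep_conjTranspose (c σ : ℂ) (s : Matrix (Core n) (Core n) ℂ) (a b : Core n) :
    (s * (coreStep c σ : Matrix (Core n) (Core n) ℂ)ᴴ) a b =
      if b.1 = 0 then s a b else star c * s a b + star σ * s a (swapCore b) := by
  simp only [Matrix.mul_apply, coreStep, Matrix.conjTranspose_apply]
  split_ifs
  · simp
  · simp [mul_add, Finset.sum_add_distrib, apply_ite (starRingEnd ℂ), mul_comm]

theorem eq_swapCore_iff (a b : Core n) : a = swapCore b ↔ b = swapCore a := by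
  constructor <;> (rintro rfl; rfl)

theorem cA_embed {Δ : ℝ} (h0 : Δ ≠ 0) (h1 : |Δ| ≤ 1) (s : Matrix (Core n) (Core n) ℂ) :
    gatesMatrix (cA Δ) * embed s * (gatesMatrix (cA Δ))ᴴ =
      embed (coreStep (Real.cos Δ) (-Complex.I * Real.sin Δ) * s *
        (coreStep (Real.cos Δ) (-Complex.I * Real.sin Δ))ᴴ) := by
  apply conj_embed
  rintro ⟨m, u, v⟩
  obtain rfl | rfl : m = 0 ∨ m = 1 := by omega
  · rw [Finset.sum_eq_single (0, u, v)]
    · simp only [coreStep, if_true, one_smul]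
      exact cA_mulVec_ket_zero Δ u v
    · rintro ⟨m, w⟩ _ hb
      obtain rfl | rfl : m = 0 ∨ m = 1 := by omega
      · simp only [coreStep, if_true]
        rw [if_neg hb.symm, zero_smul]
      · simp [coreStep, swapCore]
    · simp
  · have key : ∀ b : Core n, coreStep (Real.cos Δ) (-Complex.I * Real.sin Δ) b (1, u, v) =
        (Real.cos Δ : ℂ) * (if b = (1, u, v) then 1 else 0) +
        (-Complex.I * Real.sin Δ) * (if b = (1, v, u) then 1 else 0) := by
      rintro ⟨m, w⟩
      have e : (((1, u, v) : Core n) = swapCore (m, w)) = ((m, w) = ((1, v, u) : Core n)) := by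
        rw [eq_swapCore_iff]; rfl
      obtain rfl | rfl : m = 0 ∨ m = 1 := by omega
      · simp [coreStep]
      · have e' : (((1, u, v) : Core n) = (1, w)) = ((1, w) = ((1, u, v) : Core n)) :=
          propext eq_comm
        have h01 : ¬(1 : Fin 2) = 0 := by decide
        simp only [coreStep, if_neg h01, e, e']
    simp only [key, add_smul, Finset.sum_add_distrib, mul_smul]
    simp only [ite_smul, smul_ite, one_smul, zero_smul, smul_zero, Finset.sum_ite_eq',
      Finset.mem_univ, if_true]
    have := cA_mulVec_ket_one h0 h1 u v
    rw [mul_smul] at this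
    exact this

/-- The blocks (with respect to the measure qubit) of the partial trace over the ancillary
register. -/
def block (s : Matrix (Core n) (Core n) ℂ) (m m' : Fin 2) : QubitMatrix n :=
  fun u u' => ∑ z, s (m, u, z) (m', u', z)

theorem loadAnc_apply (ρ : QubitMatrix n) (s : Matrix (Core n) (Core n) ℂ) (m m' : Fin 2)
    (u v u' v' : Fin n → Fin 2) :
    loadAnc ρ s (m, u, v) (m', u', v') = ρ v v' * block s m m' u u' := rfl

/-- One step of the circuit on the core. -/
def coreIter (ρ : QubitMatrix n) (c σ : ℂ) (s : Matrix (Core n) (Core n) ℂ) :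
    Matrix (Core n) (Core n) ℂ :=
  coreStep c σ * loadAnc ρ s * (coreStep c σ)ᴴ

variable {ρ : QubitMatrix n}

theorem block_coreIter_zero_zero (hρ : ρ.trace = 1) (c σ : ℂ) (s : Matrix (Core n) (Core n) ℂ) :
    block (coreIter ρ c σ s) 0 0 = block s 0 0 := by
  ext u u'
  simp only [block, coreIter, mul_coreStep_conjTranspose, coreStep_mul, if_true, loadAnc_apply]
  rw [← Finset.sum_mul]
  have : ∑ i, ρ i i = 1 := hρ
  rw [this, one_mul]

/-- The swap identity: tracing out the second register of `𝒮(X ⊗ ρ)` gives `ρX`, while `X ⊗ ρ` gives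
`X` because `ρ` has trace one. The recursion closes on blocks since the next reset discards the same
register. -/
theorem block_coreIter_one_zero (hρ : ρ.trace = 1) (c σ : ℂ) (s : Matrix (Core n) (Core n) ℂ) :
    block (coreIter ρ c σ s) 1 0 = c • block s 1 0 + σ • (ρ * block s 1 0) := by
  ext u u'
  have : ∑ i, ρ i i = 1 := hρ
  have h1 : block (coreIter ρ c σ s) 1 0 u u' =
      ∑ z, (c * (ρ z z * block s 1 0 u u') + σ * (ρ u z * block s 1 0 z u')) := by
    simp only [block, coreIter, mul_coreStep_conjTranspose, coreStep_mul, if_true, one_ne_zero,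
      if_false, swapCore, loadAnc_apply]
  rw [h1, Finset.sum_add_distrib, ← Finset.mul_sum, ← Finset.mul_sum, ← Finset.sum_mul, this,
    one_mul]
  rfl

theorem block_coreIter_zero_one (hρ : ρ.trace = 1) (c σ : ℂ) (s : Matrix (Core n) (Core n) ℂ) :
    block (coreIter ρ c σ s) 0 1 = star c • block s 0 1 + star σ • (block s 0 1 * ρ) := by
  ext u u'
  have : ∑ i, ρ i i = 1 := hρ
  have h1 : block (coreIter ρ c σ s) 0 1 u u' =
      ∑ z, (star c * (ρ z z * block s 0 1 u u') + star σ * (block s 0 1 u z * ρ z u')) := by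
    simp only [block, coreIter, mul_coreStep_conjTranspose, coreStep_mul, if_true, one_ne_zero,
      if_false, swapCore, loadAnc_apply]
    refine Finset.sum_congr rfl fun z _ => ?_
    rw [mul_comm (ρ z u')]
  rw [h1, Finset.sum_add_distrib, ← Finset.mul_sum, ← Finset.mul_sum, ← Finset.sum_mul, this,
    one_mul]
  rfl

/-- In this block `c + σ𝒮` acts by unitary conjugation: the mixed terms cancel by symmetry and `c² -
σ² = 1` does the rest. The final measurement uses only the trace of this block. -/
theorem trace_block_coreIter_one_one (hρ : ρ.trace = 1) {c σ : ℂ} (hc : star c = c)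
    (hσ : star σ = -σ) (h : c * c - σ * σ = 1) (s : Matrix (Core n) (Core n) ℂ) :
    (block (coreIter ρ c σ s) 1 1).trace = (block s 1 1).trace := by
  have h2 : ∑ i, ρ i i = 1 := hρ
  have h1 : (block (coreIter ρ c σ s) 1 1).trace =
      ∑ u, ∑ z, (c * c * (ρ z z * block s 1 1 u u) - σ * σ * (ρ u u * block s 1 1 z z) +
        c * σ * (ρ u z * block s 1 1 z u) - c * σ * (ρ z u * block s 1 1 u z)) := by
    simp only [Matrix.trace, Matrix.diag_apply, block, coreIter, mul_coreStep_conjTranspose,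
      coreStep_mul, one_ne_zero, if_false, swapCore, loadAnc_apply, hc, hσ]
    refine Finset.sum_congr rfl fun u _ => Finset.sum_congr rfl fun z _ => ?_
    ring
  have h3 : ∑ u, ∑ z, ρ z z * block s 1 1 u u = (block s 1 1).trace := by
    simp only [← Finset.sum_mul, h2, one_mul]
    rfl
  have h4 : ∑ u, ∑ z, ρ u z * block s 1 1 z u = ∑ u, ∑ z, ρ z u * block s 1 1 u z :=
    Finset.sum_comm
  have h5 : ∑ u, ρ u u * ∑ z, block s 1 1 z z = (block s 1 1).trace := by
    rw [← Finset.sum_mul, h2, one_mul]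
    rfl
  rw [h1]
  simp only [Finset.sum_add_distrib, Finset.sum_sub_distrib, ← Finset.mul_sum]
  rw [h4, h3, h5]
  linear_combination (block s 1 1).trace * h

theorem iterate_coreIter (hρ : ρ.trace = 1) {c σ : ℂ} (hc : star c = c)
    (hσ : star σ = -σ) (h : c * c - σ * σ = 1) {s : Matrix (Core n) (Core n) ℂ}
    (hs : ∀ m m', block s m m' = (1 / 2 : ℂ) • ρ) (Q : ℕ) :
    (block ((coreIter ρ c σ)^[Q] s) 0 0).trace = 1 / 2 ∧
    (block ((coreIter ρ c σ)^[Q] s) 1 1).trace = 1 / 2 ∧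
    block ((coreIter ρ c σ)^[Q] s) 1 0 = (1 / 2 : ℂ) • ((c • 1 + σ • ρ) ^ Q * ρ) ∧
    block ((coreIter ρ c σ)^[Q] s) 0 1 =
      (1 / 2 : ℂ) • (ρ * (star c • 1 + star σ • ρ) ^ Q) := by
  induction Q with
  | zero => simp [hs, hρ]
  | succ Q ih =>
    obtain ⟨i1, i2, i3, i4⟩ := ih
    simp only [Function.iterate_succ_apply']
    refine ⟨?_, ?_, ?_, ?_⟩
    · rw [block_coreIter_zero_zero hρ, i1]
    · rw [trace_block_coreIter_one_one hρ hc hσ h, i2]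
    · rw [block_coreIter_one_zero hρ, i3, pow_succ']
      simp only [add_mul, smul_mul_assoc, one_mul, mul_smul_comm, smul_add, mul_assoc]
      rw [smul_comm c, smul_comm σ]
    · rw [block_coreIter_zero_one hρ, i4, pow_succ]
      simp only [mul_add, smul_mul_assoc, mul_one, mul_smul_comm, smul_add, mul_assoc]
      rw [smul_comm (star c), smul_comm (star σ)]

theorem hadamardH_entry (m : Fin 2) (b : Fin 2) :
    hadamardH b m = (if b = 1 ∧ m = 1 then -1 else 1) * (((√2 : ℝ) : ℂ)⁻¹) := by
  fin_cases b <;> fin_cases m <;> simp [hadamardH]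

theorem inv_sqrt_two_mul_self : (((√2 : ℝ) : ℂ)⁻¹) * (((√2 : ℝ) : ℂ)⁻¹) = 1 / 2 := by
  rw [← mul_inv, ← Complex.ofReal_mul, Real.mul_self_sqrt (by norm_num)]
  norm_num

theorem coreH_conj_apply (s : Matrix (Core n) (Core n) ℂ) (a b : Core n) :
    (coreH n * s * (coreH n)ᴴ) a b =
      ∑ m, ∑ m', hadamardH a.1 m * s (m, a.2) (m', b.2) * star (hadamardH b.1 m') := by
  have h1 : ∀ (t : Matrix (Core n) (Core n) ℂ) (a b : Core n), (coreH n * t) a b =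
      ∑ m, hadamardH a.1 m * t (m, a.2) b := by
    intro t a b
    rw [Matrix.mul_apply, Fintype.sum_prod_type]
    refine Finset.sum_congr rfl fun m _ => ?_
    simp [coreH]
  have h2 : ∀ (t : Matrix (Core n) (Core n) ℂ) (a b : Core n), (t * (coreH n)ᴴ) a b =
      ∑ m, t a (m, b.2) * star (hadamardH b.1 m) := by
    intro t a b
    rw [Matrix.mul_apply, Fintype.sum_prod_type]
    refine Finset.sum_congr rfl fun m _ => ?_
    rw [Finset.sum_eq_single b.2]
    · simp [coreH]
    · intro w _ hw
      simp [coreH, hw.symm]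
    · simp
  rw [h2, Finset.sum_comm]
  refine Finset.sum_congr rfl fun m' _ => ?_
  rw [h1, Finset.sum_mul]

/-- The state of the core after the preparation. -/
def corePrep (ρ : QubitMatrix n) : Matrix (Core n) (Core n) ℂ :=
  coreH n * loadMain ρ (coreInit n) * (coreH n)ᴴ

theorem block_corePrep (m m' : Fin 2) : block (corePrep ρ) m m' = (1 / 2 : ℂ) • ρ := by
  have hs : star (((√2 : ℝ) : ℂ)⁻¹) = ((√2 : ℝ) : ℂ)⁻¹ := by
    rw [← Complex.ofReal_inv]; exact Complex.conj_ofReal _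
  have hload : ∀ a b : Core n, loadMain ρ (coreInit n) a b =
      if (a.1 = 0 ∧ a.2.2 = 0) ∧ (b.1 = 0 ∧ b.2.2 = 0) then ρ a.2.1 b.2.1 else 0 := by
    rintro ⟨a, u, v⟩ ⟨b, u', v'⟩
    simp only [loadMain, coreInit, Prod.mk_eq_zero]
    by_cases h : (a = 0 ∧ v = 0) ∧ (b = 0 ∧ v' = 0)
    · rw [if_pos h, Finset.sum_eq_single 0]
      · simp [h]
      · intro z _ hz; simp [hz]
      · simp
    · rw [if_neg h, Finset.sum_eq_zero, mul_zero]
      intro z _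
      rw [if_neg]
      tauto
  ext u u'
  simp only [block, corePrep, coreH_conj_apply, hload]
  rw [Finset.sum_eq_single 0]
  · have h0 : ∀ b : Fin 2, hadamardH b 0 = ((√2 : ℝ) : ℂ)⁻¹ := by
      intro b; rw [hadamardH_entry]; simp
    simp only [Fin.sum_univ_two, h0, hs, and_true, one_ne_zero, and_false, if_true, if_false]
    rw [Matrix.smul_apply, smul_eq_mul, ← inv_sqrt_two_mul_self]
    ring
  · intro z _ hz
    simp [hz]
  · simp

theorem sum_embed_diag (s : Matrix (Core n) (Core n) ℂ) (b : Fin 2) :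
    (∑ x : Wire n → Fin 2, if x measWire = b then embed s x x else 0) = (block s b b).trace := by
  have h1 : (∑ x : Wire n → Fin 2, if x measWire = b then embed s x x else 0) =
      ∑ a : Core n, if a.1 = b then s a a else 0 := by
    symm
    apply Finset.sum_of_injOn extend extend_injective.injOn
    · intro a _; simp
    · intro x _ hx
      have : embed s x x = 0 := by
        rw [embed_apply, if_neg]
        rintro ⟨h, -⟩
        exact hx ⟨restrict x, by simp, extend_restrict h⟩
      rw [this, ite_self]
    · intro a _
      have : embed s (extend a) (extend a) = s a a := by
        rw [embed_apply, if_pos ⟨ancillaZero_extend a, ancillaZero_extend a⟩]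
        rfl
      rw [this]
      rfl
  rw [h1, Fintype.sum_prod_type, Finset.sum_eq_single b]
  · simp only [if_true, Fintype.sum_prod_type]
    rfl
  · intro m _ hm
    simp [hm]
  · simp

/-- The last Hadamard turns the off-diagonal blocks into the bias of the measured bit. -/
theorem trace_block_coreH (s : Matrix (Core n) (Core n) ℂ) (b : Fin 2) :
    (block (coreH n * s * (coreH n)ᴴ) b b).trace =
      ((block s 0 0).trace + (block s 1 1).trace +
        (outcomeSign b : ℂ) * ((block s 1 0).trace + (block s 0 1).trace)) / 2 := by
  have hs : star (((√2 : ℝ) : ℂ)⁻¹) = ((√2 : ℝ) : ℂ)⁻¹ := by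
    rw [← Complex.ofReal_inv]; exact Complex.conj_ofReal _
  have h00 : hadamardH 0 0 = ((√2 : ℝ) : ℂ)⁻¹ := rfl
  have h01 : hadamardH 0 1 = ((√2 : ℝ) : ℂ)⁻¹ := rfl
  have h10 : hadamardH 1 0 = ((√2 : ℝ) : ℂ)⁻¹ := rfl
  have h11 : hadamardH 1 1 = -((√2 : ℝ) : ℂ)⁻¹ := rfl
  have hr := inv_sqrt_two_mul_self
  set r : ℂ := ((√2 : ℝ) : ℂ)⁻¹
  simp only [Matrix.trace, Matrix.diag_apply, block, coreH_conj_apply, ← Finset.sum_add_distrib,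
    Finset.mul_sum, Finset.sum_div]
  refine Finset.sum_congr rfl fun u _ => Finset.sum_congr rfl fun z _ => ?_
  obtain rfl | rfl : b = 0 ∨ b = 1 := by omega
  · simp only [Fin.sum_univ_two, h00, h01, hs, outcomeSign, if_true, Complex.ofReal_one]
    linear_combination (s (0, u, z) (0, u, z) + s (0, u, z) (1, u, z) + s (1, u, z) (0, u, z) +
      s (1, u, z) (1, u, z)) * hr
  · simp only [Fin.sum_univ_two, h10, h11, star_neg, hs, outcomeSign, one_ne_zero, if_false,
      Complex.ofReal_neg, Complex.ofReal_one]
    linear_combination (s (0, u, z) (0, u, z) - s (0, u, z) (1, u, z) - s (1, u, z) (0, u, z) +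
      s (1, u, z) (1, u, z)) * hr

theorem foldl_replicate_step {Δ : ℝ} (h0 : Δ ≠ 0) (h1 : |Δ| ≤ 1) (Q : ℕ)
    (s : Matrix (Core n) (Core n) ℂ) :
    (List.replicate Q (Instr.load 1 :: (cA Δ).map Instr.gate)).flatten.foldl
      (fun σ i => i.apply ρ σ) (embed s) =
    embed ((coreIter ρ (Real.cos Δ) (-Complex.I * Real.sin Δ))^[Q] s) := by
  induction Q generalizing s with
  | zero => simp
  | succ Q ih =>
    rw [List.replicate_succ, List.flatten_cons, List.foldl_append, List.foldl_cons,
      load_one_embed, foldl_gates, cA_embed h0 h1]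
    exact ih _

/-- The expectation of the Pauli `Z` of the measure qubit at the end of the circuit is
`Re tr(ρ (cos Δ - i sin Δ ρ)^Q)`. -/
theorem estimationCircuit_weight (hρ : IsDensityMatrix ρ) (t : ℝ) (Q : ℕ)
    (hQ : Q ≠ 0 → t / Q ≠ 0 ∧ |t / Q| ≤ 1) (b : Fin 2) :
    (∑ x : Wire n → Fin 2,
      if x measWire = b then (estimationCircuit n t Q).finalState ρ x x else 0).re =
    (1 + outcomeSign b * (ρ * ((Real.cos (t / Q) : ℂ) • (1 : QubitMatrix n) +
      (-Complex.I * Real.sin (t / Q)) • ρ) ^ Q).trace.re) / 2 := by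
  set c : ℂ := (Real.cos (t / Q) : ℂ) with hcdef
  set σ : ℂ := -Complex.I * Real.sin (t / Q) with hσdef
  have hc : star c = c := Complex.conj_ofReal _
  have hσ : star σ = -σ := by
    have : star ((Real.sin (t / Q) : ℝ) : ℂ) = (Real.sin (t / Q) : ℂ) := Complex.conj_ofReal _
    rw [hσdef, star_mul', this, star_neg]
    simp
  have hcσ : c * c - σ * σ = 1 := by
    have := cos_sq_add_sin_sq_ofReal (t / Q)
    have hI := Complex.I_mul_I
    rw [hcdef, hσdef]
    linear_combination this - (Real.sin (t / Q) : ℂ) * (Real.sin (t / Q) : ℂ) * hI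
  have hfinal : (estimationCircuit n t Q).finalState ρ =
      embed (coreH n * ((coreIter ρ c σ)^[Q] (corePrep ρ)) * (coreH n)ᴴ) := by
    unfold Circuit.finalState estimationCircuit
    rw [List.foldl_append, List.foldl_append]
    simp only [List.foldl_cons, List.foldl_nil]
    rw [initialState_eq, load_zero_embed, gateH_embed]
    -- Without steps the two Hadamard gates act in succession. This case arises for `t = 0`, where
    -- the step lemma, which asks for `Δ ≠ 0`, does not apply.
    by_cases h : Q = 0
    · subst h
      simp only [List.replicate_zero, List.flatten_nil, List.foldl_nil, gateH_embed]
      rfl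
    · rw [foldl_replicate_step (hQ h).1 (hQ h).2, gateH_embed]
      rfl
  obtain ⟨i1, i2, i3, i4⟩ := iterate_coreIter hρ.trace_eq_one hc hσ hcσ (s := corePrep ρ)
    block_corePrep Q
  have hherm : ρᴴ = ρ := hρ.posSemidef.isHermitian
  set X := c • (1 : QubitMatrix n) + σ • ρ with hX
  have hXH : star c • (1 : QubitMatrix n) + star σ • ρ = Xᴴ := by
    rw [hX, Matrix.conjTranspose_add, Matrix.conjTranspose_smul, Matrix.conjTranspose_smul,
      Matrix.conjTranspose_one, hherm]
  have h10 : (X ^ Q * ρ).trace = (ρ * X ^ Q).trace := Matrix.trace_mul_comm _ _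
  have h01 : (ρ * (star c • 1 + star σ • ρ) ^ Q).trace = star (ρ * X ^ Q).trace := by
    rw [hXH, ← h10, ← Matrix.trace_conjTranspose, Matrix.conjTranspose_mul, hherm,
      Matrix.conjTranspose_pow]
  rw [hfinal]
  rw [sum_embed_diag, trace_block_coreH, i1, i2, i3, i4, Matrix.trace_smul, Matrix.trace_smul,
    h10, h01]
  set T := (ρ * X ^ Q).trace
  have : (1 / 2 + 1 / 2 + (outcomeSign b : ℂ) * ((1 / 2 : ℂ) • T + (1 / 2 : ℂ) • star T)) / 2 =
      (((1 + outcomeSign b * T.re) / 2 : ℝ) : ℂ) := by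
    have hT : T + star T = ((2 * T.re : ℝ) : ℂ) := Complex.add_conj T
    push_cast at hT ⊢
    simp only [smul_eq_mul]
    linear_combination (outcomeSign b : ℂ) / 4 * hT
  rw [this, Complex.ofReal_re]

end Evolution

/-! ### Expectations for discrete laws and a tail bound for independent samples. -/

section Probability

variable {α β : Type}

/-- The expectation of a function with values in `[0, ∞]`. -/
def lexp (p : PMF α) (g : α → ℝ≥0∞) : ℝ≥0∞ := ∑' a, p a * g a

theorem lexp_pure (a : α) (g : α → ℝ≥0∞) : lexp (PMF.pure a) g = g a := by
  unfold lexp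
  rw [tsum_eq_single a]
  · simp
  · intro b hb
    simp [hb]

theorem lexp_bind (p : PMF α) (f : α → PMF β) (g : β → ℝ≥0∞) :
    lexp (p.bind f) g = lexp p fun a => lexp (f a) g := by
  unfold lexp
  simp only [PMF.bind_apply, ← ENNReal.tsum_mul_right, ← ENNReal.tsum_mul_left]
  rw [ENNReal.tsum_comm]
  simp only [mul_assoc]

theorem lexp_map (p : PMF α) (f : α → β) (g : β → ℝ≥0∞) :
    lexp (p.map f) g = lexp p fun a => g (f a) := by
  rw [PMF.map, lexp_bind]
  simp only [Function.comp_apply, lexp_pure]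

theorem lexp_add (p : PMF α) (g h : α → ℝ≥0∞) :
    lexp p (fun a => g a + h a) = lexp p g + lexp p h := by
  unfold lexp
  simp only [mul_add]
  exact ENNReal.tsum_add

theorem lexp_const_mul (p : PMF α) (c : ℝ≥0∞) (g : α → ℝ≥0∞) :
    lexp p (fun a => c * g a) = c * lexp p g := by
  unfold lexp
  rw [← ENNReal.tsum_mul_left]
  exact tsum_congr fun a => by ring

theorem lexp_const (p : PMF α) (c : ℝ≥0∞) : lexp p (fun _ => c) = c := by
  unfold lexp
  rw [ENNReal.tsum_mul_right, p.tsum_coe, one_mul]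

theorem lexp_mono (p : PMF α) {g h : α → ℝ≥0∞} (hgh : ∀ a ∈ p.support, g a ≤ h a) :
    lexp p g ≤ lexp p h := by
  refine ENNReal.tsum_le_tsum fun a => ?_
  by_cases ha : p a = 0
  · simp [ha]
  · exact mul_le_mul_right (hgh a ((p.mem_support_iff a).mpr ha)) _

theorem lexp_congr (p : PMF α) {g h : α → ℝ≥0∞} (hgh : ∀ a ∈ p.support, g a = h a) :
    lexp p g = lexp p h :=
  le_antisymm (lexp_mono p fun a ha => (hgh a ha).le) (lexp_mono p fun a ha => (hgh a ha).ge)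

/-- Markov's inequality, with the lower bound on `g` required only at points of positive mass. -/
theorem toOuterMeasure_le_lexp (p : PMF α) (S : Set α) (g : α → ℝ≥0∞)
    (hg : ∀ a ∈ p.support, a ∈ S → 1 ≤ g a) : p.toOuterMeasure S ≤ lexp p g := by
  rw [PMF.toOuterMeasure_apply]
  refine ENNReal.tsum_le_tsum fun a => ?_
  by_cases ha : a ∈ S
  · rw [Set.indicator_of_mem ha]
    by_cases h0 : p a = 0
    · simp [h0]
    · exact le_mul_of_one_le_right' (hg a ((p.mem_support_iff a).mpr h0) ha)
  · rw [Set.indicator_of_notMem ha]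
    exact zero_le

theorem toOuterMeasure_add_compl (p : PMF α) (S : Set α) :
    p.toOuterMeasure S + p.toOuterMeasure Sᶜ = 1 := by
  rw [PMF.toOuterMeasure_apply, PMF.toOuterMeasure_apply, ← ENNReal.tsum_add, ← p.tsum_coe]
  refine tsum_congr fun a => ?_
  by_cases ha : a ∈ S <;> simp [ha]

theorem mem_support_iid {p : PMF α} {k : ℕ} {l : List α} (hl : l ∈ (iid p k).support) :
    l.length = k ∧ ∀ a ∈ l, a ∈ p.support := by
  induction k generalizing l with
  | zero =>
    rw [iid, PMF.support_pure, Set.mem_singleton_iff] at hl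
    subst hl
    simp
  | succ k ih =>
    rw [iid, PMF.mem_support_bind_iff] at hl
    obtain ⟨a, ha, hl⟩ := hl
    rw [PMF.support_map] at hl
    obtain ⟨l', hl', rfl⟩ := hl
    obtain ⟨h1, h2⟩ := ih hl'
    refine ⟨by simp [h1], ?_⟩
    intro b hb
    rcases List.mem_cons.mp hb with rfl | hb
    · exact ha
    · exact h2 b hb

theorem lexp_iid_prod (p : PMF α) (g : α → ℝ≥0∞) (k : ℕ) :
    lexp (iid p k) (fun l => (l.map g).prod) = lexp p g ^ k := by
  induction k with
  | zero => simp [iid, lexp_pure]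
  | succ k ih =>
    rw [iid, lexp_bind]
    simp only [lexp_map, List.map_cons, List.prod_cons, lexp_const_mul, ih]
    rw [pow_succ]
    simp only [mul_comm _ (lexp p g ^ k), lexp_const_mul]

theorem lexp_iid_sum (p : PMF α) (g : α → ℝ≥0∞) (k : ℕ) :
    lexp (iid p k) (fun l => (l.map g).sum) = k * lexp p g := by
  induction k with
  | zero => simp [iid, lexp_pure]
  | succ k ih =>
    rw [iid, lexp_bind]
    simp only [lexp_map, List.map_cons, List.sum_cons, lexp_add, lexp_const, ih]
    push_cast
    ring

/-- A positive total weight excludes the default branch of the sampler. -/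
theorem sampleProportional_apply [DecidableEq α] [Inhabited α] {I : Finset α} {w : α → ℝ}
    (hw : ∀ a ∈ I, 0 ≤ w a) (hS : 0 < ∑ a ∈ I, w a) (a : α) :
    sampleProportional I w a = if a ∈ I then ENNReal.ofReal (w a / ∑ b ∈ I, w b) else 0 := by
  have hsum : (∑' a, if a ∈ I then ENNReal.ofReal (w a) else 0) =
      ENNReal.ofReal (∑ a ∈ I, w a) := by
    rw [tsum_eq_sum (s := I) (fun b hb => if_neg hb), ENNReal.ofReal_sum_of_nonneg hw]
    exact Finset.sum_congr rfl fun b hb => if_pos hb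
  have h : (∑' a, if a ∈ I then ENNReal.ofReal (w a) else 0) ≠ 0 ∧
      (∑' a, if a ∈ I then ENNReal.ofReal (w a) else 0) ≠ ⊤ := by
    rw [hsum]
    exact ⟨(ENNReal.ofReal_pos.mpr hS).ne', ENNReal.ofReal_ne_top⟩
  unfold sampleProportional
  simp only
  rw [dif_pos h, PMF.normalize_apply, hsum]
  split_ifs with ha
  · rw [ENNReal.ofReal_div_of_pos hS, div_eq_mul_inv]
  · simp

theorem lexp_sampleProportional [DecidableEq α] [Inhabited α] {I : Finset α} {w : α → ℝ}
    (hw : ∀ a ∈ I, 0 ≤ w a) (hS : 0 < ∑ a ∈ I, w a) (g : α → ℝ≥0∞) :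
    lexp (sampleProportional I w) g =
      ∑ a ∈ I, ENNReal.ofReal (w a / ∑ b ∈ I, w b) * g a := by
  unfold lexp
  simp only [sampleProportional_apply hw hS]
  rw [tsum_eq_sum (s := I) (fun b hb => by rw [if_neg hb, zero_mul])]
  exact Finset.sum_congr rfl fun b hb => by rw [if_pos hb]

theorem mem_of_mem_support_sampleProportional [DecidableEq α] [Inhabited α] {I : Finset α}
    {w : α → ℝ} (hw : ∀ a ∈ I, 0 ≤ w a) (hS : 0 < ∑ a ∈ I, w a) {a : α}
    (ha : a ∈ (sampleProportional I w).support) : a ∈ I := by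
  rw [PMF.mem_support_iff, sampleProportional_apply hw hS] at ha
  by_contra h
  exact ha (if_neg h)

/-- From `exp u ≤ 1 + u + u²` for `|u| ≤ 1`, with `y²` replaced by `1`. The result is affine in `1 +
y`, the quantity whose expectation is available for `lexp`, which only takes nonnegative functions.
-/
theorem exp_le_linear {x ν y : ℝ} (hx0 : 0 ≤ x) (hx : x ≤ 1 / 2) (hν : |ν| ≤ 1) (hy : |y| ≤ 1) :
    Real.exp (x * (y - ν)) ≤
      (1 - x * (1 + ν) + x ^ 2 * (1 + ν) ^ 2) + (x - 2 * x ^ 2 * ν) * (1 + y) := by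
  rw [abs_le] at hν hy
  have h1 : |x * (y - ν)| ≤ 1 := by
    rw [abs_mul, abs_of_nonneg hx0]
    have : |y - ν| ≤ 2 := abs_le.mpr ⟨by linarith, by linarith⟩
    nlinarith [abs_nonneg (y - ν)]
  have h2 := (abs_le.mp (Real.abs_exp_sub_one_sub_id_le h1)).2
  have h3 : y ^ 2 ≤ 1 := by nlinarith
  nlinarith [mul_le_mul_of_nonneg_left h3 (sq_nonneg x)]

theorem lexp_exp_le (p : PMF α) {Y : α → ℝ} (hY : ∀ a ∈ p.support, |Y a| ≤ 1) {ν : ℝ}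
    (hν : |ν| ≤ 1) (hE : lexp p (fun a => ENNReal.ofReal (1 + Y a)) = ENNReal.ofReal (1 + ν))
    {x : ℝ} (hx0 : 0 ≤ x) (hx : x ≤ 1 / 2) :
    lexp p (fun a => ENNReal.ofReal (Real.exp (x * (Y a - ν)))) ≤
      ENNReal.ofReal (Real.exp (x ^ 2)) := by
  have hν' := abs_le.mp hν
  -- Both coefficients must be nonnegative for `ENNReal.ofReal` to respect the sum. This one equals
  -- `(x(1 + ν) - 1/2)² + 3/4`.
  have hA : 0 ≤ 1 - x * (1 + ν) + x ^ 2 * (1 + ν) ^ 2 := by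
    nlinarith [sq_nonneg (x * (1 + ν) - 1 / 2)]
  have hb : 0 ≤ x - 2 * x ^ 2 * ν := by
    have : x * ν ≤ 1 / 2 := by nlinarith
    nlinarith
  calc lexp p (fun a => ENNReal.ofReal (Real.exp (x * (Y a - ν))))
      ≤ lexp p (fun a => ENNReal.ofReal (1 - x * (1 + ν) + x ^ 2 * (1 + ν) ^ 2) +
          ENNReal.ofReal (x - 2 * x ^ 2 * ν) * ENNReal.ofReal (1 + Y a)) := by
        refine lexp_mono p fun a ha => ?_
        have h1 : 0 ≤ 1 + Y a := by linarith [(abs_le.mp (hY a ha)).1]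
        rw [← ENNReal.ofReal_mul hb, ← ENNReal.ofReal_add hA (mul_nonneg hb h1)]
        exact ENNReal.ofReal_le_ofReal (exp_le_linear hx0 hx hν (hY a ha))
    _ = ENNReal.ofReal (1 + x ^ 2 * (1 - ν ^ 2)) := by
        rw [lexp_add, lexp_const, lexp_const_mul, hE, ← ENNReal.ofReal_mul hb,
          ← ENNReal.ofReal_add hA (mul_nonneg hb (by linarith))]
        congr 1
        ring
    _ ≤ _ := by
        apply ENNReal.ofReal_le_ofReal
        have h1 := Real.add_one_le_exp (x ^ 2)
        have : x ^ 2 * (1 - ν ^ 2) ≤ x ^ 2 * 1 :=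
          mul_le_mul_of_nonneg_left (by linarith [sq_nonneg ν]) (sq_nonneg x)
        linarith

theorem prod_map_exp (l : List α) (Y : α → ℝ) (x ν : ℝ) :
    (l.map fun a => ENNReal.ofReal (Real.exp (x * (Y a - ν)))).prod =
      ENNReal.ofReal (Real.exp (x * ((l.map Y).sum - l.length * ν))) := by
  induction l with
  | nil => simp
  | cons a l ih =>
    rw [List.map_cons, List.prod_cons, ih, ← ENNReal.ofReal_mul (Real.exp_pos _).le,
      ← Real.exp_add, List.map_cons, List.sum_cons, List.length_cons]
    push_cast
    congr 2
    ring

/-- One-sided tail bound of Hoeffding type. -/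
theorem iid_upper_tail (p : PMF α) {Y : α → ℝ} (hY : ∀ a ∈ p.support, |Y a| ≤ 1) {ν : ℝ}
    (hν : |ν| ≤ 1) (hE : lexp p (fun a => ENNReal.ofReal (1 + Y a)) = ENNReal.ofReal (1 + ν))
    {ε : ℝ} (hε0 : 0 ≤ ε) (hε : ε ≤ 1) (B : ℕ) :
    (iid p B).toOuterMeasure {l | B * ε ≤ (l.map Y).sum - B * ν} ≤
      ENNReal.ofReal (Real.exp (-(B * ε ^ 2 / 4))) := by
  calc (iid p B).toOuterMeasure {l | B * ε ≤ (l.map Y).sum - B * ν}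
      -- Exponential Markov inequality with parameter `ε/2`, which minimizes `B x² - x B ε` and
      -- gives the exponent `-Bε²/4`.
      ≤ lexp (iid p B) (fun l => ENNReal.ofReal (Real.exp (-(ε / 2 * (B * ε)))) *
          (l.map fun a => ENNReal.ofReal (Real.exp (ε / 2 * (Y a - ν)))).prod) := by
        apply toOuterMeasure_le_lexp
        intro l hl hS
        rw [prod_map_exp, (mem_support_iid hl).1, ← ENNReal.ofReal_mul (Real.exp_pos _).le,
          ← Real.exp_add, ENNReal.one_le_ofReal, Real.one_le_exp_iff]
        have hS' : B * ε ≤ (l.map Y).sum - B * ν := hS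
        nlinarith
    _ = ENNReal.ofReal (Real.exp (-(ε / 2 * (B * ε)))) *
          lexp p (fun a => ENNReal.ofReal (Real.exp (ε / 2 * (Y a - ν)))) ^ B := by
        rw [lexp_const_mul, lexp_iid_prod]
    _ ≤ ENNReal.ofReal (Real.exp (-(ε / 2 * (B * ε)))) *
          ENNReal.ofReal (Real.exp ((ε / 2) ^ 2)) ^ B := by
        gcongr
        exact lexp_exp_le p hY hν hE (by linarith) (by linarith)
    _ = _ := by
        rw [← ENNReal.ofReal_pow (Real.exp_pos _).le, ← Real.exp_nat_mul,
          ← ENNReal.ofReal_mul (Real.exp_pos _).le, ← Real.exp_add]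
        congr 2
        ring

theorem sum_map_neg (l : List α) (X : α → ℝ) : (l.map fun a => -X a).sum = -(l.map X).sum := by
  induction l with
  | nil => simp
  | cons a l ih => simp [ih]; ring

/-- Two-sided tail bound of Hoeffding type for the empirical mean. -/
theorem iid_mean_tail (p : PMF α) {X : α → ℝ} (hX : ∀ a ∈ p.support, |X a| ≤ 1) {ν : ℝ}
    (hν : |ν| ≤ 1) (hE : lexp p (fun a => ENNReal.ofReal (1 + X a)) = ENNReal.ofReal (1 + ν))
    (hE' : lexp p (fun a => ENNReal.ofReal (1 - X a)) = ENNReal.ofReal (1 - ν))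
    {ε δ : ℝ} (hε0 : 0 < ε) (hε : ε ≤ 1) (hδ0 : 0 < δ) (hδ1 : δ < 1) {B : ℕ}
    (hB : 4 * Real.log (2 / δ) / ε ^ 2 ≤ B) :
    (iid p B).toOuterMeasure {l | ε < |(l.map X).sum / B - ν|} ≤ ENNReal.ofReal δ := by
  have hlog : 0 < Real.log (2 / δ) := Real.log_pos (by rw [lt_div_iff₀ hδ0]; linarith)
  have hBpos : (0 : ℝ) < B := lt_of_lt_of_le (by positivity) hB
  have hexp : Real.exp (-(B * ε ^ 2 / 4)) ≤ δ / 2 := by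
    have h1 : Real.log (2 / δ) ≤ B * ε ^ 2 / 4 := by
      rw [div_le_iff₀ (by positivity)] at hB
      linarith
    calc Real.exp (-(B * ε ^ 2 / 4)) ≤ Real.exp (-Real.log (2 / δ)) :=
          Real.exp_le_exp.mpr (by linarith)
      _ = δ / 2 := by rw [Real.exp_neg, Real.exp_log (by positivity), inv_div]
  have hsub : {l : List α | ε < |(l.map X).sum / B - ν|} ⊆
      {l | B * ε ≤ (l.map X).sum - B * ν} ∪
        {l | B * ε ≤ (l.map fun a => -X a).sum - B * (-ν)} := by
    intro l hl
    have hl' : ε < |(l.map X).sum / B - ν| := hl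
    have e : (l.map X).sum / B - ν = ((l.map X).sum - B * ν) / B := by field_simp
    rw [e] at hl'
    rcases lt_abs.mp hl' with h | h
    · left
      rw [lt_div_iff₀ hBpos] at h
      change B * ε ≤ (l.map X).sum - B * ν
      linarith
    · right
      rw [← neg_div, lt_div_iff₀ hBpos] at h
      change B * ε ≤ (l.map fun a => -X a).sum - B * (-ν)
      rw [sum_map_neg]
      linarith
  calc (iid p B).toOuterMeasure {l | ε < |(l.map X).sum / B - ν|}
      ≤ (iid p B).toOuterMeasure {l | B * ε ≤ (l.map X).sum - B * ν} +
          (iid p B).toOuterMeasure {l | B * ε ≤ (l.map fun a => -X a).sum - B * (-ν)} :=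
        (MeasureTheory.measure_mono hsub).trans (MeasureTheory.measure_union_le _ _)
    _ ≤ ENNReal.ofReal (δ / 2) + ENNReal.ofReal (δ / 2) := by
        refine add_le_add ?_ ?_
        · exact (iid_upper_tail p hX hν hE hε0.le hε B).trans (ENNReal.ofReal_le_ofReal hexp)
        · refine (iid_upper_tail p (Y := fun a => -X a) (ν := -ν) ?_ ?_ ?_ hε0.le hε B).trans
            (ENNReal.ofReal_le_ofReal hexp)
          · intro a ha; rw [abs_neg]; exact hX a ha
          · rwa [abs_neg]
          · simpa only [← sub_eq_add_neg] using hE'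
    _ = ENNReal.ofReal δ := by
        rw [← ENNReal.ofReal_add (by positivity) (by positivity)]
        congr 1
        ring

end Probability

/-! ### Law of the estimate returned by one pass of the loop. -/

section Estimates

variable {n : ℕ} {ρ : QubitMatrix n}

theorem lexp_measure {c : Circuit n} {E : ℝ} (hE : |E| ≤ 1)
    (hw : ∀ b, (∑ x : Wire n → Fin 2, if x measWire = b then c.finalState ρ x x else 0).re =
      (1 + outcomeSign b * E) / 2) (g : Fin 2 → ℝ≥0∞) :
    lexp (measure c ρ) g =
      ENNReal.ofReal ((1 + E) / 2) * g 0 + ENNReal.ofReal ((1 - E) / 2) * g 1 := by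
  rw [abs_le] at hE
  have h0 : outcomeSign 0 = 1 := rfl
  have h1 : outcomeSign 1 = -1 := rfl
  have hsum : ∑ b : Fin 2, (1 + outcomeSign b * E) / 2 = 1 := by
    rw [Fin.sum_univ_two, h0, h1]; ring
  have hnn : ∀ b ∈ (Finset.univ : Finset (Fin 2)), 0 ≤ (1 + outcomeSign b * E) / 2 := by
    intro b _
    obtain rfl | rfl : b = 0 ∨ b = 1 := by omega
    · rw [h0]; linarith
    · rw [h1]; linarith
  unfold measure
  simp only [hw]
  rw [lexp_sampleProportional hnn (by rw [hsum]; norm_num), hsum, Fin.sum_univ_two, h0, h1]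
  congr 3
  · ring_nf
  · ring_nf

/-- Spreading the constant `1` over the `R` outcomes makes every summand nonnegative, so that
`lexp_iid_sum` applies. The cases `τ = 1` and `τ = -1` serve the two tails. -/
theorem ofReal_one_add_mean (l : List (Fin 2)) {R : ℕ} (hR : R ≠ 0) (hl : l.length = R) (τ : ℝ)
    (hτ : |τ| ≤ 1) :
    ENNReal.ofReal (1 + τ * ((l.map outcomeSign).sum / R)) =
      (l.map fun b => ENNReal.ofReal ((1 + τ * outcomeSign b) / R)).sum := by
  have hR' : (0 : ℝ) < R := by positivity
  rw [abs_le] at hτ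
  have hpos : ∀ b, 0 ≤ (1 + τ * outcomeSign b) / R := by
    intro b
    apply div_nonneg _ hR'.le
    unfold outcomeSign
    split_ifs <;> linarith
  have key : ∀ l : List (Fin 2), (l.map fun b => ENNReal.ofReal ((1 + τ * outcomeSign b) / R)).sum =
      ENNReal.ofReal (l.length / R + τ * ((l.map outcomeSign).sum / R)) ∧
      0 ≤ l.length / R + τ * ((l.map outcomeSign).sum / R) := by
    intro l
    induction l with
    | nil => simp
    | cons b l ih =>
      have e : ((b :: l).length : ℝ) / R + τ * (((b :: l).map outcomeSign).sum / R) =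
          (1 + τ * outcomeSign b) / R +
            ((l.length : ℝ) / R + τ * ((l.map outcomeSign).sum / R)) := by
        rw [List.map_cons, List.sum_cons, List.length_cons]
        push_cast
        ring
      rw [e]
      refine ⟨?_, add_nonneg (hpos b) ih.2⟩
      rw [List.map_cons, List.sum_cons, ih.1, ENNReal.ofReal_add (hpos b) ih.2]
  rw [(key l).1, hl, div_self hR'.ne']

theorem abs_sum_outcomeSign_le (l : List (Fin 2)) : |(l.map outcomeSign).sum| ≤ l.length := by
  induction l with
  | nil => simp
  | cons b l ih =>
    rw [List.map_cons, List.sum_cons, List.length_cons]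
    push_cast
    have : |outcomeSign b| = 1 := by unfold outcomeSign; split_ifs <;> simp
    calc _ ≤ |outcomeSign b| + |(l.map outcomeSign).sum| := abs_add_le _ _
      _ ≤ _ := by linarith

theorem abs_estimate_le_one {η δ Λ : ℝ} {r : Outcome} (hr : r ∈ (iteration η δ Λ ρ).support) :
    |r.estimate| ≤ 1 := by
  rw [iteration, PMF.mem_support_bind_iff] at hr
  obtain ⟨p, -, hr⟩ := hr
  rw [PMF.support_map] at hr
  obtain ⟨bs, hbs, rfl⟩ := hr
  have h := abs_sum_outcomeSign_le bs
  rw [(mem_support_iid hbs).1] at h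
  simp only
  rw [abs_div, Nat.abs_cast]
  exact div_le_one_of_le₀ h (Nat.cast_nonneg _)

/-- For a fixed pair the average over the executions is unbiased for `E p`, whatever their number;
averaging over the sampled pair produces the normalized weighted sum. -/
theorem lexp_iteration {η δ Λ : ℝ} (hw : ∀ p ∈ indexSet η Λ, 0 ≤ weight η Λ p)
    (hS : 0 < ∑ p ∈ indexSet η Λ, weight η Λ p) (hR : numMeasurements η δ Λ ≠ 0)
    {E : (Σ _ : ℕ, ℕ) → ℝ} (hE : ∀ p ∈ indexSet η Λ, |E p| ≤ 1)
    (hc : ∀ p ∈ indexSet η Λ, ∀ b, (∑ x : Wire n → Fin 2,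
      if x measWire = b then (termCircuit n η Λ p).finalState ρ x x else 0).re =
      (1 + outcomeSign b * E p) / 2) (τ : ℝ) (hτ : |τ| ≤ 1) :
    lexp (iteration η δ Λ ρ) (fun r => ENNReal.ofReal (1 + τ * r.estimate)) =
      ENNReal.ofReal (1 + τ * ((∑ p ∈ indexSet η Λ, weight η Λ p * E p) /
        ∑ p ∈ indexSet η Λ, weight η Λ p)) := by
  set S := ∑ p ∈ indexSet η Λ, weight η Λ p with hSdef
  set R := numMeasurements η δ Λ with hRdef
  have hR' : (0 : ℝ) < R := by positivity
  have hτ' := abs_le.mp hτ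
  have hpos : ∀ p ∈ indexSet η Λ, 0 ≤ 1 + τ * E p := by
    intro p hp
    have h1 : |τ * E p| ≤ 1 := by
      rw [abs_mul]; exact mul_le_one₀ hτ (abs_nonneg _) (hE p hp)
    linarith [(abs_le.mp h1).1]
  have inner : ∀ p ∈ indexSet η Λ,
      lexp ((iid (measure (termCircuit n η Λ p) ρ) R).map fun bs =>
        ({ estimate := (bs.map outcomeSign).sum / R
           copies := R * (termCircuit n η Λ p).copyCount
           gates := (termCircuit n η Λ p).gateCount } : Outcome))
        (fun r => ENNReal.ofReal (1 + τ * r.estimate)) = ENNReal.ofReal (1 + τ * E p) := by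
    intro p hp
    have hEp := abs_le.mp (hE p hp)
    rw [lexp_map, lexp_congr _ (h := fun l =>
      (l.map fun b => ENNReal.ofReal ((1 + τ * outcomeSign b) / R)).sum)
      (fun l hl => ofReal_one_add_mean l hR (mem_support_iid hl).1 τ hτ), lexp_iid_sum,
      lexp_measure (hE p hp) (hc p hp)]
    have h0 : outcomeSign 0 = 1 := rfl
    have h1 : outcomeSign 1 = -1 := rfl
    rw [h0, h1, ← ENNReal.ofReal_mul (by linarith), ← ENNReal.ofReal_mul (by linarith),
      ← ENNReal.ofReal_add
        (mul_nonneg (by linarith) (div_nonneg (by linarith) hR'.le))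
        (mul_nonneg (by linarith) (div_nonneg (by linarith) hR'.le)),
      ← ENNReal.ofReal_natCast, ← ENNReal.ofReal_mul hR'.le]
    congr 1
    field_simp
    ring
  rw [iteration, lexp_bind, lexp_sampleProportional hw hS]
  have h2 : ∑ p ∈ indexSet η Λ, weight η Λ p / S * (1 + τ * E p) =
      1 + τ * ((∑ p ∈ indexSet η Λ, weight η Λ p * E p) / S) := by
    have : ∀ p, weight η Λ p / S * (1 + τ * E p) =
        weight η Λ p / S + τ * (weight η Λ p * E p / S) := fun p => by ring
    simp only [this, Finset.sum_add_distrib, ← Finset.mul_sum, ← Finset.sum_div]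
    rw [← hSdef, div_self hS.ne']
  rw [← h2, ENNReal.ofReal_sum_of_nonneg]
  · refine Finset.sum_congr rfl fun p hp => ?_
    rw [← hRdef, inner p hp, ← ENNReal.ofReal_mul (div_nonneg (hw p hp) hS.le)]
  · intro p hp
    exact mul_nonneg (div_nonneg (hw p hp) hS.le) (hpos p hp)

end Estimates

/-! ### Power series of the powers of `arcsin y / (π/2)`. -/

section ArcsinSeries

theorem hasSum_congr_fun {f g : ℕ → ℝ} {a : ℝ} (h : HasSum f a) (e : ∀ n, g n = f n) :
    HasSum g a := by
  rwa [funext e]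

/-- The coefficients of `(1 - x)^(-1/2)`: the rising factorial of `1/2` satisfies the same recursion
as `n! * centralBinom n / 4^n`. -/
theorem ring_choose_half (n : ℕ) :
    Ring.choose ((1 / 2 : ℝ) + n - 1) n = (n.centralBinom : ℝ) / 4 ^ n := by
  have h1 : Ring.choose ((1 / 2 : ℝ) + n - 1) n = Ring.multichoose (1 / 2 : ℝ) n := by
    unfold Ring.choose
    congr 1
    ring
  have h2 := Ring.factorial_nsmul_multichoose_eq_ascPochhammer (1 / 2 : ℝ) n
  rw [Polynomial.ascPochhammer_smeval_eq_eval, nsmul_eq_mul] at h2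
  have h3 : ∀ n : ℕ, Polynomial.eval (1 / 2 : ℝ) (ascPochhammer ℝ n) =
      n.factorial * ((n.centralBinom : ℝ) / 4 ^ n) := by
    intro n
    induction n with
    | zero => simp
    | succ n ih =>
      have hs : ((n : ℝ) + 1) * ((n + 1).centralBinom : ℝ) =
          2 * (2 * n + 1) * (n.centralBinom : ℝ) := by
        exact_mod_cast Nat.succ_mul_centralBinom_succ n
      rw [ascPochhammer_succ_eval, ih, Nat.factorial_succ, pow_succ]
      push_cast
      field_simp
      linear_combination -2 * hs
  have h4 : (n.factorial : ℝ) ≠ 0 := by exact_mod_cast n.factorial_ne_zero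
  rw [h1]
  exact mul_left_cancel₀ h4 (h2.trans (h3 n))

theorem hasSum_inv_sqrt_one_sub {x : ℝ} (hx : |x| < 1) :
    HasSum (fun n : ℕ => (n.centralBinom : ℝ) / 4 ^ n * x ^ n) (1 / √(1 - x)) := by
  have h := (Real.one_div_one_sub_rpow_hasFPowerSeriesOnBall_zero (1 / 2)).hasSum (y := x)
    (by rw [Metric.mem_eball, edist_dist, dist_zero_right, Real.norm_eq_abs, ← ENNReal.ofReal_one]
        exact (ENNReal.ofReal_lt_ofReal_iff one_pos).mpr hx)
  rw [zero_add, ← Real.sqrt_eq_rpow] at h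
  have e : (fun n : ℕ => (n.centralBinom : ℝ) / 4 ^ n * x ^ n) = fun n =>
      (FormalMultilinearSeries.ofScalars ℝ
        (fun n : ℕ => Ring.choose ((1 / 2 : ℝ) + n - 1) n) n) fun _ => x := by
    funext n
    rw [FormalMultilinearSeries.ofScalars_apply_eq, ring_choose_half, smul_eq_mul]
  rw [e]
  exact h

theorem centralBinom_div_le_one (n : ℕ) : (n.centralBinom : ℝ) / 4 ^ n ≤ 1 := by
  rw [div_le_one (by positivity)]
  exact_mod_cast Nat.centralBinom_le_four_pow n

/-- Both sides vanish at zero and have derivative `1/√(1 - z²)`. Termwise differentiation is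
justified on `|z| < r` for some `|y| < r < 1`, where the derivatives are dominated by the geometric
series in `r²`. -/
theorem hasSum_arcsin {y : ℝ} (hy : |y| < 1) :
    HasSum (fun m : ℕ => (m.centralBinom : ℝ) / 4 ^ m * (y ^ (2 * m + 1) / (2 * m + 1)))
      (Real.arcsin y) := by
  obtain ⟨r, hyr, hr1⟩ := exists_between hy
  have hr0 : 0 < r := lt_of_le_of_lt (abs_nonneg y) hyr
  set g : ℕ → ℝ → ℝ := fun m z => (m.centralBinom : ℝ) / 4 ^ m * (z ^ (2 * m + 1) / (2 * m + 1))
    with hg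
  set g' : ℕ → ℝ → ℝ := fun m z => (m.centralBinom : ℝ) / 4 ^ m * (z ^ 2) ^ m with hg'
  set t : Set ℝ := Set.Ioo (-r) r
  have hu : Summable fun m : ℕ => (r ^ 2) ^ m :=
    summable_geometric_of_lt_one (by positivity) (by nlinarith)
  have hder : ∀ m z, z ∈ t → HasDerivAt (g m) (g' m z) z := by
    intro m z _
    have h := ((hasDerivAt_pow (2 * m + 1) z).div_const (2 * m + 1 : ℝ)).const_mul
      ((m.centralBinom : ℝ) / 4 ^ m)
    convert! h using 1
    simp only [hg', Nat.add_sub_cancel]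
    push_cast
    field_simp
    ring
  have hcb : ∀ m : ℕ, 0 ≤ (m.centralBinom : ℝ) / 4 ^ m := fun m => by positivity
  have hbound : ∀ m z, z ∈ t → ‖g' m z‖ ≤ (r ^ 2) ^ m := by
    intro m z hz
    have hz2 : z ^ 2 ≤ r ^ 2 := by
      rw [sq_le_sq, abs_of_pos hr0]
      exact (abs_lt.mpr hz).le
    rw [Real.norm_eq_abs, abs_of_nonneg (by simp only [hg']; positivity)]
    calc g' m z ≤ 1 * (z ^ 2) ^ m :=
          mul_le_mul_of_nonneg_right (centralBinom_div_le_one m) (by positivity)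
      _ ≤ _ := by rw [one_mul]; exact pow_le_pow_left₀ (sq_nonneg z) hz2 m
  have h0t : (0 : ℝ) ∈ t := ⟨by linarith, hr0⟩
  have hg0 : ∀ m, g m 0 = 0 := fun m => by simp [hg]
  have hs0 : Summable fun m => g m 0 := by simp only [hg0]; exact summable_zero
  have hyt : y ∈ t := abs_lt.mp hyr
  have hF : ∀ z ∈ t, HasDerivAt (fun z => ∑' m, g m z) (1 / √(1 - z ^ 2)) z := by
    intro z hz
    have h := hasDerivAt_tsum_of_isPreconnected hu isOpen_Ioo isPreconnected_Ioo hder hbound h0t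
      hs0 hz
    have hz1 : |z ^ 2| < 1 := by
      rw [abs_pow, sq_lt_one_iff_abs_lt_one, abs_abs]
      exact lt_trans (abs_lt.mpr hz) hr1
    rwa [(hasSum_inv_sqrt_one_sub hz1).tsum_eq] at h
  have hA : ∀ z ∈ t, HasDerivAt Real.arcsin (1 / √(1 - z ^ 2)) z := by
    intro z hz
    exact Real.hasDerivAt_arcsin (by linarith [hz.1]) (by linarith [hz.2])
  have hdiff : ∀ z ∈ t, HasDerivAt (fun z => (∑' m, g m z) - Real.arcsin z) 0 z := by
    intro z hz
    have := (hF z hz).sub (hA z hz)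
    rwa [sub_self] at this
  have hconst := isOpen_Ioo.is_const_of_deriv_eq_zero isPreconnected_Ioo
    (fun z hz => (hdiff z hz).differentiableAt.differentiableWithinAt)
    (fun z hz => (hdiff z hz).deriv) hyt h0t
  simp only [hg0, tsum_zero, Real.arcsin_zero, sub_zero] at hconst
  have hsum : Summable fun m => g m y := summable_of_summable_hasDerivAt_of_isPreconnected hu
    isOpen_Ioo isPreconnected_Ioo hder hbound h0t hs0 hyt
  have := hsum.hasSum
  rwa [sub_eq_zero.mp hconst] at this

theorem hasSum_coeffB₁ {y : ℝ} (hy : |y| < 1) :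
    HasSum (fun l => coeffB₁ l * y ^ l) (Real.arcsin y / (Real.pi / 2)) := by
  have he : HasSum (fun m : ℕ => coeffB₁ (2 * m) * y ^ (2 * m)) 0 := by
    simp only [coeffB₁, even_two_mul, if_true, zero_mul]
    exact hasSum_zero
  have ho : HasSum (fun m : ℕ => coeffB₁ (2 * m + 1) * y ^ (2 * m + 1))
      (Real.arcsin y / (Real.pi / 2)) := by
    have h0 := (hasSum_arcsin hy).div_const (Real.pi / 2)
    refine hasSum_congr_fun h0 fun m => ?_
    have h1 : ¬ Even (2 * m + 1) := by simp
    have h2 : 2 * m / 2 = m := by omega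
    have h3 : (2 : ℝ) ^ (2 * m) = 4 ^ m := by rw [pow_mul]; norm_num
    rw [coeffB₁, if_neg h1, Nat.add_sub_cancel, h2, ← Nat.centralBinom_eq_two_mul_choose, h3]
    push_cast
    have := Real.pi_ne_zero
    field_simp
  have h := HasSum.even_add_odd (f := fun l => coeffB₁ l * y ^ l) he ho
  rwa [zero_add] at h

theorem coeffB₁_nonneg (l : ℕ) : 0 ≤ coeffB₁ l := by
  unfold coeffB₁
  have := Real.pi_pos
  split_ifs <;> positivity

theorem coeffB_nonneg (k l : ℕ) : 0 ≤ coeffB k l := by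
  induction k using Nat.strong_induction_on generalizing l with
  | _ k ih =>
    match k with
    | 0 => exact le_rfl
    | 1 => exact coeffB₁_nonneg l
    | k + 2 =>
      rw [coeffB]
      exact Finset.sum_nonneg fun l' _ => mul_nonneg (ih (k + 1) (by omega) l') (coeffB₁_nonneg _)

/-- Cauchy product. For `0 ≤ y` all terms are nonnegative, so absolute summability is plain
summability. -/
theorem hasSum_coeffB {y : ℝ} (hy0 : 0 ≤ y) (hy : y < 1) (k : ℕ) :
    HasSum (fun l => coeffB (k + 1) l * y ^ l) ((Real.arcsin y / (Real.pi / 2)) ^ (k + 1)) := by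
  have hy' : |y| < 1 := by rwa [abs_of_nonneg hy0]
  induction k with
  | zero => simpa [coeffB] using hasSum_coeffB₁ hy'
  | succ k ih =>
    have h1 := hasSum_coeffB₁ hy'
    have n1 : Summable fun l => ‖coeffB (k + 1) l * y ^ l‖ := by
      simpa only [Real.norm_of_nonneg (mul_nonneg (coeffB_nonneg (k + 1) _) (pow_nonneg hy0 _))]
        using ih.summable
    have n2 : Summable fun l => ‖coeffB₁ l * y ^ l‖ := by
      simpa only [Real.norm_of_nonneg (mul_nonneg (coeffB₁_nonneg _) (pow_nonneg hy0 _))]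
        using h1.summable
    have h := hasSum_sum_range_mul_of_summable_norm n1 n2
    rw [ih.tsum_eq, h1.tsum_eq, ← pow_succ] at h
    refine hasSum_congr_fun h fun l => ?_
    have e : coeffB (k + 1 + 1) l =
        ∑ l' ∈ Finset.range (l + 1), coeffB (k + 1) l' * coeffB₁ (l - l') := by rw [coeffB]
    rw [e, Finset.sum_mul]
    refine Finset.sum_congr rfl fun l' hl' => ?_
    have : y ^ l = y ^ l' * y ^ (l - l') := by
      rw [← pow_add, Nat.add_sub_cancel' (Nat.lt_succ_iff.mp (Finset.mem_range.mp hl'))]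
    rw [this]
    ring

/-- For `y < 1` a partial sum is at most the value of the function, hence at most `1` because
`arcsin y ≤ π/2`. Let `y` tend to `1` from the left. -/
theorem sum_coeffB_le_one (k : ℕ) (s : Finset ℕ) : ∑ l ∈ s, coeffB (k + 1) l ≤ 1 := by
  have hcont : Filter.Tendsto (fun y : ℝ => ∑ l ∈ s, coeffB (k + 1) l * y ^ l)
      (nhdsWithin 1 (Set.Iio 1)) (nhds (∑ l ∈ s, coeffB (k + 1) l * 1 ^ l)) := by
    apply Filter.Tendsto.mono_left _ nhdsWithin_le_nhds
    exact (by fun_prop : Continuous fun y : ℝ => ∑ l ∈ s, coeffB (k + 1) l * y ^ l).tendsto 1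
  simp only [one_pow, mul_one] at hcont
  refine le_of_tendsto hcont ?_
  have h01 : Set.Ioo (0 : ℝ) 1 ∈ nhdsWithin (1 : ℝ) (Set.Iio 1) := Ioo_mem_nhdsLT one_pos
  filter_upwards [h01] with y hy
  have h := hasSum_coeffB hy.1.le hy.2 k
  refine (sum_le_hasSum s (fun l _ => mul_nonneg (coeffB_nonneg _ _) (pow_nonneg hy.1.le _))
    h).trans ?_
  apply pow_le_one₀
  · exact div_nonneg (Real.arcsin_nonneg.mpr hy.1.le) (by positivity)
  · rw [div_le_one (by positivity)]
    exact Real.arcsin_le_pi_div_two y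

/-- The tail has nonnegative coefficients of total mass at most one, and each power in it is at most
`y^n`. -/
theorem coeffB_tail {y : ℝ} (hy0 : 0 ≤ y) (hy : y < 1) (k n : ℕ) :
    |(Real.arcsin y / (Real.pi / 2)) ^ (k + 1) - ∑ l ∈ Finset.range n, coeffB (k + 1) l * y ^ l| ≤
      y ^ n := by
  have h := hasSum_coeffB hy0 hy k
  have hnn : ∀ l, 0 ≤ coeffB (k + 1) l * y ^ l := fun l =>
    mul_nonneg (coeffB_nonneg _ _) (pow_nonneg hy0 _)
  rw [abs_of_nonneg (sub_nonneg.mpr (sum_le_hasSum _ (fun l _ => hnn l) h)), sub_le_iff_le_add]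
  refine le_of_tendsto h.tendsto_sum_nat ?_
  filter_upwards [Filter.eventually_ge_atTop n] with m hm
  rw [← Finset.sum_range_add_sum_Ico _ hm, add_comm]
  gcongr
  calc ∑ l ∈ Finset.Ico n m, coeffB (k + 1) l * y ^ l
      ≤ ∑ l ∈ Finset.Ico n m, coeffB (k + 1) l * y ^ n := by
        refine Finset.sum_le_sum fun l hl => mul_le_mul_of_nonneg_left ?_ (coeffB_nonneg _ _)
        exact pow_le_pow_of_le_one hy0 hy.le (Finset.mem_Ico.mp hl).1
    _ = (∑ l ∈ Finset.Ico n m, coeffB (k + 1) l) * y ^ n := by rw [Finset.sum_mul]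
    _ ≤ 1 * y ^ n := mul_le_mul_of_nonneg_right (sum_coeffB_le_one k _) (pow_nonneg hy0 _)
    _ = y ^ n := one_mul _

end ArcsinSeries

/-! ### Powers of the cosine as binomial averages, and a Chernoff bound. -/

section BinomialTail

theorem cos_pow_eq_sum (θ : ℝ) (l : ℕ) :
    Real.cos θ ^ l = ∑ s ∈ Finset.range (l + 1),
      ((l.choose s : ℝ) / 2 ^ l) * Real.cos ((2 * s - l) * θ) := by
  have h : Complex.cos θ ^ l = ∑ s ∈ Finset.range (l + 1),
      ((l.choose s : ℂ) / 2 ^ l) * Complex.exp (((2 * s - l) * θ : ℝ) * Complex.I) := by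
    rw [Complex.cos, div_pow, add_pow, Finset.sum_div]
    refine Finset.sum_congr rfl fun s hs => ?_
    have hs' : s ≤ l := Nat.lt_succ_iff.mp (Finset.mem_range.mp hs)
    rw [← Complex.exp_nat_mul, ← Complex.exp_nat_mul, ← Complex.exp_add, mul_comm, mul_div_assoc,
      mul_comm, div_mul_eq_mul_div]
    rw [div_mul_eq_mul_div, mul_comm (l.choose s : ℂ)]
    congr 3
    push_cast [Nat.cast_sub hs']
    ring
  have h2 := congrArg Complex.re h
  rw [← Complex.ofReal_cos, ← Complex.ofReal_pow, Complex.ofReal_re, Complex.re_sum] at h2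
  rw [h2]
  refine Finset.sum_congr rfl fun s _ => ?_
  have : ((l.choose s : ℂ) / 2 ^ l) = (((l.choose s : ℝ) / 2 ^ l : ℝ) : ℂ) := by push_cast; rfl
  rw [this, Complex.re_ofReal_mul, Complex.exp_ofReal_mul_I_re]

theorem sum_choose_exp (x : ℝ) (l : ℕ) :
    ∑ s ∈ Finset.range (l + 1), ((l.choose s : ℝ) / 2 ^ l) * Real.exp ((2 * s - l) * x) =
      Real.cosh x ^ l := by
  rw [Real.cosh_eq, div_pow, add_pow, Finset.sum_div]
  refine Finset.sum_congr rfl fun s hs => ?_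
  have hs' : s ≤ l := Nat.lt_succ_iff.mp (Finset.mem_range.mp hs)
  have h2 : Real.exp ((2 * s - l) * x) = Real.exp x ^ s * Real.exp (-x) ^ (l - s) := by
    rw [← Real.exp_nat_mul, ← Real.exp_nat_mul, ← Real.exp_add, Nat.cast_sub hs']
    congr 1
    ring
  rw [h2]
  ring

theorem sum_choose_div (l : ℕ) :
    ∑ s ∈ Finset.range (l + 1), ((l.choose s : ℝ) / 2 ^ l) = 1 := by
  simpa using sum_choose_exp 0 l

theorem binomial_tail {l : ℕ} (hl : l ≠ 0) {a : ℝ} (ha : 0 ≤ a) (s : Finset ℕ)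
    (hs : s ⊆ Finset.range (l + 1))
    (hfar : ∀ i ∈ s, 2 * √(a * (l / 2)) ≤ |2 * (i : ℝ) - l|) :
    ∑ i ∈ s, ((l.choose i : ℝ) / 2 ^ l) ≤ 2 * Real.exp (-a) := by
  have hl' : (0 : ℝ) < l := by positivity
  set u := √(a * (l / 2)) with hu
  have hu0 : 0 ≤ u := Real.sqrt_nonneg _
  have hu2 : u * u = a * (l / 2) := Real.mul_self_sqrt (by positivity)
  -- The optimal Chernoff parameter: it balances `2ux = 2a` against `l x²/2 = a`, and `cosh x ≤
  -- exp(x²/2)` leaves `exp(-a)` for each of the two tails.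
  set x := 2 * u / l with hx
  have hx0 : 0 ≤ x := by positivity
  have hxu : 2 * u * x = 2 * a := by
    rw [hx]; field_simp; nlinarith
  have hxx : l * (x ^ 2 / 2) = a := by
    rw [hx]; field_simp; nlinarith
  have hcosh : Real.cosh x ^ l ≤ Real.exp a := by
    calc Real.cosh x ^ l ≤ Real.exp (x ^ 2 / 2) ^ l :=
          pow_le_pow_left₀ (Real.cosh_pos x).le (Real.cosh_le_exp_half_sq x) l
      _ = Real.exp a := by rw [← Real.exp_nat_mul, hxx]
  have hone : ∀ i ∈ s, 1 ≤ Real.exp (-(2 * a)) *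
      (Real.exp ((2 * i - l) * x) + Real.exp ((2 * i - l) * (-x))) := by
    intro i hi
    rw [mul_add, ← Real.exp_add, ← Real.exp_add]
    rcases le_abs.mp (hfar i hi) with h | h
    · have : 0 ≤ -(2 * a) + (2 * i - l) * x := by
        have := mul_le_mul_of_nonneg_right h hx0
        linarith
      linarith [Real.one_le_exp this, Real.exp_pos (-(2 * a) + (2 * i - l) * -x)]
    · have : 0 ≤ -(2 * a) + (2 * i - l) * (-x) := by
        have := mul_le_mul_of_nonneg_right h hx0
        linarith
      linarith [Real.one_le_exp this, Real.exp_pos (-(2 * a) + (2 * i - l) * x)]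
  calc ∑ i ∈ s, ((l.choose i : ℝ) / 2 ^ l)
      ≤ ∑ i ∈ s, ((l.choose i : ℝ) / 2 ^ l) * (Real.exp (-(2 * a)) *
          (Real.exp ((2 * i - l) * x) + Real.exp ((2 * i - l) * (-x)))) :=
        Finset.sum_le_sum fun i hi => le_mul_of_one_le_right (by positivity) (hone i hi)
    _ ≤ ∑ i ∈ Finset.range (l + 1), ((l.choose i : ℝ) / 2 ^ l) * (Real.exp (-(2 * a)) *
          (Real.exp ((2 * i - l) * x) + Real.exp ((2 * i - l) * (-x)))) :=
        Finset.sum_le_sum_of_subset_of_nonneg hs fun i _ _ => by positivity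
    _ = Real.exp (-(2 * a)) * (Real.cosh x ^ l + Real.cosh (-x) ^ l) := by
        rw [← sum_choose_exp, ← sum_choose_exp, ← Finset.sum_add_distrib, Finset.mul_sum]
        exact Finset.sum_congr rfl fun i _ => by ring
    _ ≤ Real.exp (-(2 * a)) * (Real.exp a + Real.exp a) := by
        rw [Real.cosh_neg]; gcongr
    _ = 2 * Real.exp (-a) := by
        rw [← two_mul, mul_left_comm, ← Real.exp_add]
        congr 2
        ring

end BinomialTail

/-! ### The truncated Fourier series of `-ln` on `[Λ, 1]`. -/

section Parameters

theorem sum_Icc_one (f : ℕ → ℝ) (K : ℕ) :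
    ∑ k ∈ Finset.Icc 1 K, f k = ∑ i ∈ Finset.range K, f (i + 1) := by
  induction K with
  | zero => simp
  | succ K ih => rw [Finset.sum_Icc_succ_top (by omega), ih, Finset.sum_range_succ]

variable {η Λ : ℝ}

/-- The harmonic number of the truncation order. -/
def harmonicK (η Λ : ℝ) : ℝ := ∑ k ∈ Finset.Icc 1 (orderK η Λ), 1 / (k : ℝ)

theorem log_inv_one_sub_pos (hΛ : Λ ∈ Set.Ioo (0 : ℝ) 1) : 0 < Real.log (1 / (1 - Λ)) := by
  apply Real.log_pos
  rw [lt_div_iff₀ (by linarith [hΛ.2])]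
  linarith [hΛ.1]

theorem log_four_div_pos (hη : η ∈ Set.Ioo (0 : ℝ) (1 / 3)) (hΛ : Λ ∈ Set.Ioo (0 : ℝ) 1) :
    0 < Real.log (4 / (η * Λ)) := by
  have h0 : 0 < η * Λ := mul_pos hη.1 hΛ.1
  apply Real.log_pos
  rw [lt_div_iff₀ h0]
  have : η * Λ ≤ 1 / 3 * 1 :=
    mul_le_mul hη.2.le hΛ.2.le hΛ.1.le (by norm_num)
  linarith

theorem one_le_orderK (hη : η ∈ Set.Ioo (0 : ℝ) (1 / 3)) (hΛ : Λ ∈ Set.Ioo (0 : ℝ) 1) :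
    1 ≤ orderK η Λ :=
  Nat.one_le_iff_ne_zero.mpr
    (Nat.ceil_pos.mpr (div_pos (log_four_div_pos hη hΛ) (log_inv_one_sub_pos hΛ))).ne'

theorem one_sub_pow_orderK_le (hη : η ∈ Set.Ioo (0 : ℝ) (1 / 3)) (hΛ : Λ ∈ Set.Ioo (0 : ℝ) 1) :
    (1 - Λ) ^ orderK η Λ ≤ η * Λ / 4 := by
  have h0 : 0 < η * Λ := mul_pos hη.1 hΛ.1
  have h1 : 0 < 1 - Λ := by linarith [hΛ.2]
  have h := Nat.le_ceil (Real.log (4 / (η * Λ)) / Real.log (1 / (1 - Λ)))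
  rw [div_le_iff₀ (log_inv_one_sub_pos hΛ)] at h
  change _ ≤ (orderK η Λ : ℝ) * _ at h
  rw [one_div, Real.log_inv] at h
  have e : (1 - Λ) ^ orderK η Λ = Real.exp (orderK η Λ * Real.log (1 - Λ)) := by
    rw [Real.exp_nat_mul, Real.exp_log h1]
  rw [e, ← Real.exp_log (show 0 < η * Λ / 4 by positivity), Real.exp_le_exp]
  have : Real.log (η * Λ / 4) = -Real.log (4 / (η * Λ)) := by rw [← Real.log_inv, inv_div]
  rw [this]
  linarith

theorem one_le_harmonicK (hη : η ∈ Set.Ioo (0 : ℝ) (1 / 3)) (hΛ : Λ ∈ Set.Ioo (0 : ℝ) 1) :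
    1 ≤ harmonicK η Λ := by
  have h := Finset.single_le_sum (f := fun k : ℕ => 1 / (k : ℝ)) (s := Finset.Icc 1 (orderK η Λ))
    (fun k _ => by positivity) (Finset.mem_Icc.mpr ⟨le_rfl, one_le_orderK hη hΛ⟩)
  simpa [harmonicK] using h

theorem exp_neg_logTerm (hη : η ∈ Set.Ioo (0 : ℝ) (1 / 3)) (hΛ : Λ ∈ Set.Ioo (0 : ℝ) 1) :
    Real.exp (-logTerm η Λ) = η / (4 * harmonicK η Λ) := by
  have h1 := one_le_harmonicK hη hΛ
  have h2 := hη.1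
  rw [Real.exp_neg]
  change (Real.exp (Real.log (4 * harmonicK η Λ / η)))⁻¹ = _
  rw [Real.exp_log (by positivity), inv_div]

theorem one_le_logTerm (hη : η ∈ Set.Ioo (0 : ℝ) (1 / 3)) (hΛ : Λ ∈ Set.Ioo (0 : ℝ) 1) :
    1 ≤ logTerm η Λ := by
  have h1 := one_le_harmonicK hη hΛ
  have h2 := hη.1
  change 1 ≤ Real.log (4 * harmonicK η Λ / η)
  rw [Real.le_log_iff_exp_le (by positivity), le_div_iff₀ h2]
  have := Real.exp_one_lt_d9
  nlinarith [hη.2]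

/-- The Taylor coefficients of the truncated logarithm. -/
def seriesCoeff (η Λ : ℝ) (l : ℕ) : ℝ := ∑ k ∈ Finset.Icc 1 (orderK η Λ), coeffB k l / k

theorem seriesCoeff_nonneg (l : ℕ) : 0 ≤ seriesCoeff η Λ l :=
  Finset.sum_nonneg fun k _ => div_nonneg (coeffB_nonneg k l) (Nat.cast_nonneg k)

theorem sum_seriesCoeff_le (s : Finset ℕ) : ∑ l ∈ s, seriesCoeff η Λ l ≤ harmonicK η Λ := by
  unfold seriesCoeff harmonicK
  rw [Finset.sum_comm]
  refine Finset.sum_le_sum fun k hk => ?_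
  obtain ⟨k, rfl⟩ : ∃ j, k = j + 1 := ⟨k - 1, by have := (Finset.mem_Icc.mp hk).1; omega⟩
  rw [← Finset.sum_div]
  exact div_le_div_of_nonneg_right (sum_coeffB_le_one k s) (Nat.cast_nonneg _)

theorem weight_nonneg (p : Σ _ : ℕ, ℕ) : 0 ≤ weight η Λ p :=
  mul_nonneg (seriesCoeff_nonneg p.1) (by positivity)

theorem weightNorm_eq : weightNorm η Λ = ∑ p ∈ indexSet η Λ, weight η Λ p :=
  Finset.sum_congr rfl fun p _ => abs_of_nonneg (weight_nonneg p)

/-- The range of the second index. -/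
def innerSet (η Λ : ℝ) (l : ℕ) : Finset ℕ :=
  Finset.Icc (l / 2 - paramM η Λ l) (min l ((l + 1) / 2 + paramM η Λ l))

theorem innerSet_subset (l : ℕ) : innerSet η Λ l ⊆ Finset.range (l + 1) := by
  intro s hs
  have := (Finset.mem_Icc.mp hs).2
  exact Finset.mem_range.mpr (Nat.lt_succ_of_le (this.trans (min_le_left _ _)))

theorem sum_indexSet (F : (Σ _ : ℕ, ℕ) → ℝ) :
    ∑ p ∈ indexSet η Λ, weight η Λ p * F p =
      ∑ l ∈ Finset.range (⌊paramL η Λ⌋₊ + 1), seriesCoeff η Λ l *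
        ∑ s ∈ innerSet η Λ l, ((l.choose s : ℝ) / 2 ^ l) * F ⟨l, s⟩ := by
  rw [indexSet, Finset.sum_sigma]
  refine Finset.sum_congr rfl fun l _ => ?_
  rw [Finset.mul_sum]
  refine Finset.sum_congr rfl fun s _ => ?_
  rw [← mul_assoc]
  rfl

theorem weightNorm_le : weightNorm η Λ ≤ harmonicK η Λ := by
  have h := sum_indexSet (η := η) (Λ := Λ) (fun _ => 1)
  simp only [mul_one] at h
  rw [weightNorm_eq, h]
  refine le_trans (Finset.sum_le_sum fun l _ => ?_) (sum_seriesCoeff_le _)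
  refine mul_le_of_le_one_right (seriesCoeff_nonneg l) ?_
  rw [← sum_choose_div l]
  exact Finset.sum_le_sum_of_subset_of_nonneg (innerSet_subset l) fun _ _ _ => by positivity

theorem one_le_paramL (hη : η ∈ Set.Ioo (0 : ℝ) (1 / 3)) (hΛ : Λ ∈ Set.Ioo (0 : ℝ) 1) :
    1 ≤ paramL η Λ := by
  have h1 : 1 ≤ 1 / Λ ^ 2 := by
    rw [le_div_iff₀ (pow_pos hΛ.1 2), one_mul]
    exact pow_le_one₀ hΛ.1.le hΛ.2.le
  exact one_le_mul_of_one_le_of_one_le (one_le_logTerm hη hΛ) h1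

/-- The terms with `l = 1` alone contribute at least `b_1^{(1)} = 2/π ≥ 1/2`. This makes the
sampling law well defined and keeps the accuracy `ε` below one. -/
theorem half_le_weightNorm (hη : η ∈ Set.Ioo (0 : ℝ) (1 / 3)) (hΛ : Λ ∈ Set.Ioo (0 : ℝ) 1) :
    1 / 2 ≤ weightNorm η Λ := by
  have h := sum_indexSet (η := η) (Λ := Λ) (fun _ => 1)
  simp only [mul_one] at h
  rw [weightNorm_eq, h]
  have hmem : 1 ∈ Finset.range (⌊paramL η Λ⌋₊ + 1) := by
    rw [Finset.mem_range]
    have : 1 ≤ ⌊paramL η Λ⌋₊ := Nat.le_floor (by simpa using one_le_paramL hη hΛ)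
    omega
  refine le_trans ?_ (Finset.single_le_sum (fun l _ => mul_nonneg (seriesCoeff_nonneg l)
    (Finset.sum_nonneg fun s _ => by positivity)) hmem)
  -- For `l = 1` floor and ceiling of `l/2` are `0` and `1`, so both values of `s` are admitted
  -- whatever `M_1` is.
  have hinner : innerSet η Λ 1 = Finset.range 2 := by
    ext s
    simp only [innerSet, Finset.mem_Icc, Finset.mem_range]
    omega
  have hsum : ∑ s ∈ innerSet η Λ 1, ((Nat.choose 1 s : ℝ) / 2 ^ 1) = 1 := by
    rw [hinner]; exact sum_choose_div 1
  rw [hsum, mul_one]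
  have h1 : coeffB 1 1 / (1 : ℕ) ≤ seriesCoeff η Λ 1 :=
    Finset.single_le_sum (f := fun k : ℕ => coeffB k 1 / (k : ℝ))
      (fun k _ => div_nonneg (coeffB_nonneg k 1) (Nat.cast_nonneg k))
      (Finset.mem_Icc.mpr ⟨le_rfl, one_le_orderK hη hΛ⟩)
  have h2 : coeffB 1 1 = 2 / Real.pi := by
    simp [coeffB, coeffB₁]
  rw [h2] at h1
  refine le_trans ?_ h1
  rw [Nat.cast_one, div_one, div_le_div_iff₀ (by norm_num) Real.pi_pos]
  linarith [Real.pi_le_four]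

/-- The omitted `s` satisfy `|2s - l| ≥ 2 M_l`, so their binomial mass is controlled by
`binomial_tail` with `a = ln r`. For `l = 0` nothing is omitted. -/
theorem inner_sum_approx (hη : η ∈ Set.Ioo (0 : ℝ) (1 / 3)) (hΛ : Λ ∈ Set.Ioo (0 : ℝ) 1)
    (θ : ℝ) (l : ℕ) :
    |∑ s ∈ innerSet η Λ l, ((l.choose s : ℝ) / 2 ^ l) * Real.cos ((2 * s - l) * θ) -
      Real.cos θ ^ l| ≤ 2 * Real.exp (-logTerm η Λ) := by
  rw [cos_pow_eq_sum, ← Finset.sum_sdiff (innerSet_subset (η := η) (Λ := Λ) l), sub_add_cancel_right,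
    abs_neg]
  refine (Finset.abs_sum_le_sum_abs _ _).trans ?_
  have h1 : ∑ s ∈ Finset.range (l + 1) \ innerSet η Λ l,
      |((l.choose s : ℝ) / 2 ^ l) * Real.cos ((2 * s - l) * θ)| ≤
      ∑ s ∈ Finset.range (l + 1) \ innerSet η Λ l, ((l.choose s : ℝ) / 2 ^ l) := by
    refine Finset.sum_le_sum fun s _ => ?_
    rw [abs_mul, abs_of_nonneg (by positivity : (0 : ℝ) ≤ (l.choose s : ℝ) / 2 ^ l)]
    exact mul_le_of_le_one_right (by positivity) (Real.abs_cos_le_one _)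
  refine h1.trans ?_
  by_cases hl : l = 0
  · subst hl
    have : Finset.range (0 + 1) \ innerSet η Λ 0 = ∅ := by
      ext s
      simp only [innerSet, Finset.mem_sdiff, Finset.mem_range, Finset.mem_Icc,
        Finset.notMem_empty, iff_false]
      omega
    rw [this, Finset.sum_empty]
    positivity
  · refine binomial_tail hl (by linarith [one_le_logTerm hη hΛ]) _ Finset.sdiff_subset ?_
    intro s hs
    rw [Finset.mem_sdiff, Finset.mem_range, innerSet, Finset.mem_Icc] at hs
    have hM : √(logTerm η Λ * (l / 2)) ≤ (paramM η Λ l : ℝ) := Nat.le_ceil _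
    have hs' : 2 * s + 2 * paramM η Λ l ≤ l ∨ l + 2 * paramM η Λ l ≤ 2 * s := by omega
    rw [le_abs]
    rcases hs' with h | h
    · right
      have : (2 * s + 2 * paramM η Λ l : ℝ) ≤ l := by exact_mod_cast h
      linarith
    · left
      have : (l + 2 * paramM η Λ l : ℝ) ≤ 2 * s := by exact_mod_cast h
      linarith

/-- Concavity of the sine on `[0, π/4]` gives `sin(xπ/4) ≥ x/√2`. Hence `cos(xπ/2) = 1 - 2
sin²(xπ/4) ≤ 1 - x² ≤ exp(-x²)`. -/
theorem cos_le_exp_neg_sq {x : ℝ} (hx0 : 0 ≤ x) (hx1 : x ≤ 1) :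
    Real.cos (x * (Real.pi / 2)) ≤ Real.exp (-x ^ 2) := by
  have hpi := Real.pi_pos
  have hconc := strictConcaveOn_sin_Icc.concaveOn.2
    (show (0 : ℝ) ∈ Set.Icc 0 Real.pi from ⟨le_rfl, hpi.le⟩)
    (show Real.pi / 4 ∈ Set.Icc 0 Real.pi from ⟨by positivity, by linarith⟩)
    (show (0 : ℝ) ≤ 1 - x by linarith) hx0 (by ring)
  simp only [smul_eq_mul, Real.sin_zero, mul_zero, zero_add, Real.sin_pi_div_four] at hconc
  have h2 : x ^ 2 / 2 ≤ Real.sin (x * (Real.pi / 4)) ^ 2 := by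
    have := pow_le_pow_left₀ (by positivity) hconc 2
    have e : (x * (√2 / 2)) ^ 2 = x ^ 2 / 2 := by
      rw [mul_pow, div_pow, Real.sq_sqrt (by norm_num)]; ring
    rwa [e] at this
  have h3 : Real.cos (x * (Real.pi / 2)) = 1 - 2 * Real.sin (x * (Real.pi / 4)) ^ 2 := by
    have e : x * (Real.pi / 2) = 2 * (x * (Real.pi / 4)) := by ring
    rw [e, Real.cos_two_mul, Real.cos_sq']
    ring
  rw [h3]
  linarith [Real.add_one_le_exp (-x ^ 2)]

theorem sum_seriesCoeff_pow (y : ℝ) (s : Finset ℕ) :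
    ∑ l ∈ s, seriesCoeff η Λ l * y ^ l =
      ∑ k ∈ Finset.Icc 1 (orderK η Λ), 1 / (k : ℝ) * ∑ l ∈ s, coeffB k l * y ^ l := by
  simp only [seriesCoeff, Finset.sum_mul, Finset.mul_sum]
  rw [Finset.sum_comm]
  exact Finset.sum_congr rfl fun k _ => Finset.sum_congr rfl fun l _ => by ring

/-- The remainder is at most `(1 - x)^(K+1) / x`. The factor `Λ` inside the logarithm defining `K`
pays for the division by `x ≥ Λ`. -/
theorem log_taylor_approx (hη : η ∈ Set.Ioo (0 : ℝ) (1 / 3)) (hΛ : Λ ∈ Set.Ioo (0 : ℝ) 1)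
    {x : ℝ} (hx : x ∈ Set.Icc Λ 1) :
    |∑ k ∈ Finset.Icc 1 (orderK η Λ), 1 / (k : ℝ) * (1 - x) ^ k - -Real.log x| ≤ η / 4 := by
  have hx0 : 0 < x := lt_of_lt_of_le hΛ.1 hx.1
  have hz0 : 0 ≤ 1 - x := by linarith [hx.2]
  have habs : |1 - x| = 1 - x := abs_of_nonneg hz0
  have h := Real.abs_log_sub_add_sum_range_le (x := 1 - x) (by rw [habs]; linarith) (orderK η Λ)
  rw [habs, sub_sub_cancel] at h
  have e : ∑ k ∈ Finset.Icc 1 (orderK η Λ), 1 / (k : ℝ) * (1 - x) ^ k =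
      ∑ i ∈ Finset.range (orderK η Λ), (1 - x) ^ (i + 1) / ((i : ℝ) + 1) := by
    rw [sum_Icc_one]
    refine Finset.sum_congr rfl fun i _ => ?_
    push_cast
    ring
  rw [e, sub_neg_eq_add]
  refine h.trans ?_
  have h1 : (1 - x) ^ (orderK η Λ + 1) ≤ (1 - Λ) ^ orderK η Λ := by
    rw [pow_succ]
    calc (1 - x) ^ orderK η Λ * (1 - x) ≤ (1 - x) ^ orderK η Λ * 1 :=
          mul_le_mul_of_nonneg_left (by linarith) (by positivity)
      _ = (1 - x) ^ orderK η Λ := mul_one _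
      _ ≤ _ := pow_le_pow_left₀ hz0 (by linarith [hx.1]) _
  rw [div_le_iff₀ hx0]
  refine (h1.trans (one_sub_pow_orderK_le hη hΛ)).trans ?_
  nlinarith [hη.1, hx.1]

/-- The truncated Fourier series approximates `-ln` on `[Λ, 1]` with accuracy `η`. -/
theorem fourier_approx (hη : η ∈ Set.Ioo (0 : ℝ) (1 / 3)) (hΛ : Λ ∈ Set.Ioo (0 : ℝ) 1)
    {x : ℝ} (hx : x ∈ Set.Icc Λ 1) :
    |∑ p ∈ indexSet η Λ, weight η Λ p * Real.cos (x * time p) - -Real.log x| ≤ η := by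
  have hpi := Real.pi_pos
  have hx0 : 0 < x := lt_of_lt_of_le hΛ.1 hx.1
  have hH := one_le_harmonicK hη hΛ
  have hexp := exp_neg_logTerm hη hΛ
  set y := Real.cos (x * (Real.pi / 2)) with hy
  set n := ⌊paramL η Λ⌋₊ + 1 with hn
  have hy0 : 0 ≤ y := Real.cos_nonneg_of_neg_pi_div_two_le_of_le
    (by nlinarith) (by nlinarith [hx.2])
  have hyΛ : y ≤ Real.exp (-Λ ^ 2) :=
    (Real.cos_le_cos_of_nonneg_of_le_pi (mul_nonneg hΛ.1.le (by positivity))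
      (by nlinarith [hx.2]) (mul_le_mul_of_nonneg_right hx.1 (by positivity))).trans
      (cos_le_exp_neg_sq hΛ.1.le hΛ.2.le)
  have hy1 : y < 1 := lt_of_le_of_lt hyΛ (by
    rw [Real.exp_lt_one_iff]; nlinarith [pow_pos hΛ.1 2])
  -- The substitution that turns powers of `1 - x` into power series in a cosine: `y = sin(π/2 -
  -- xπ/2)`.
  have harc : Real.arcsin y / (Real.pi / 2) = 1 - x := by
    rw [hy, ← Real.sin_pi_div_two_sub, Real.arcsin_sin (by nlinarith [hx.2]) (by nlinarith)]
    field_simp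
  -- `n = ⌊L⌋ + 1` exceeds `L` and `L Λ² = ln r`, so `y^n ≤ exp(-nΛ²) ≤ 1/r`.
  have hyn : y ^ n ≤ η / (4 * harmonicK η Λ) := by
    rw [← hexp]
    calc y ^ n ≤ Real.exp (-Λ ^ 2) ^ n := pow_le_pow_left₀ hy0 hyΛ n
      _ = Real.exp (n * (-Λ ^ 2)) := by rw [Real.exp_nat_mul]
      _ ≤ _ := by
        rw [Real.exp_le_exp]
        have h1 : paramL η Λ ≤ n := by
          have := Nat.lt_floor_add_one (paramL η Λ)
          rw [hn]; push_cast; exact this.le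
        have h2 : logTerm η Λ = paramL η Λ * Λ ^ 2 := by
          have := hΛ.1.ne'
          rw [paramL]; field_simp
        rw [h2]
        nlinarith [pow_pos hΛ.1 2]
  -- The error budget is `η/2` for dropping the binomial tails, `η/4` for the powers of `y` beyond
  -- `L` (`d2`), and `η/4` for the logarithmic series (`d3`).
  have d1 : |∑ p ∈ indexSet η Λ, weight η Λ p * Real.cos (x * time p) -
      ∑ l ∈ Finset.range n, seriesCoeff η Λ l * y ^ l| ≤ η / 2 := by
    rw [sum_indexSet (fun p => Real.cos (x * time p)), ← Finset.sum_sub_distrib]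
    refine (Finset.abs_sum_le_sum_abs _ _).trans ?_
    have : ∀ l ∈ Finset.range n, |seriesCoeff η Λ l * (∑ s ∈ innerSet η Λ l,
        ((l.choose s : ℝ) / 2 ^ l) * Real.cos (x * time ⟨l, s⟩)) - seriesCoeff η Λ l * y ^ l| ≤
        seriesCoeff η Λ l * (2 * Real.exp (-logTerm η Λ)) := by
      intro l _
      rw [← mul_sub, abs_mul, abs_of_nonneg (seriesCoeff_nonneg l)]
      refine mul_le_mul_of_nonneg_left ?_ (seriesCoeff_nonneg l)
      have h := inner_sum_approx hη hΛ (x * (Real.pi / 2)) l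
      have e : ∀ s : ℕ, x * time ⟨l, s⟩ = (2 * (s : ℝ) - l) * (x * (Real.pi / 2)) := by
        intro s; simp only [time]; ring
      simpa only [e] using h
    refine (Finset.sum_le_sum this).trans ?_
    rw [← Finset.sum_mul, hexp]
    calc _ ≤ harmonicK η Λ * (2 * (η / (4 * harmonicK η Λ))) :=
          mul_le_mul_of_nonneg_right (sum_seriesCoeff_le _)
            (mul_nonneg zero_le_two (div_nonneg hη.1.le (by linarith)))
      _ = η / 2 := by field_simp; ring
  have d2 : |∑ l ∈ Finset.range n, seriesCoeff η Λ l * y ^ l -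
      ∑ k ∈ Finset.Icc 1 (orderK η Λ), 1 / (k : ℝ) * (1 - x) ^ k| ≤ η / 4 := by
    rw [sum_seriesCoeff_pow, ← Finset.sum_sub_distrib]
    refine (Finset.abs_sum_le_sum_abs _ _).trans ?_
    have : ∀ k ∈ Finset.Icc 1 (orderK η Λ), |1 / (k : ℝ) * ∑ l ∈ Finset.range n, coeffB k l * y ^ l -
        1 / (k : ℝ) * (1 - x) ^ k| ≤ 1 / (k : ℝ) * (η / (4 * harmonicK η Λ)) := by
      intro k hk
      obtain ⟨k, rfl⟩ : ∃ j, k = j + 1 := ⟨k - 1, by have := (Finset.mem_Icc.mp hk).1; omega⟩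
      rw [← mul_sub, abs_mul, abs_of_nonneg (by positivity)]
      refine mul_le_mul_of_nonneg_left ?_ (by positivity)
      rw [abs_sub_comm, ← harc]
      exact (coeffB_tail hy0 hy1 k n).trans hyn
    refine (Finset.sum_le_sum this).trans ?_
    rw [← Finset.sum_mul]
    change harmonicK η Λ * _ ≤ _
    apply le_of_eq
    field_simp
  have d3 := log_taylor_approx hη hΛ hx
  have t1 := abs_sub_le (∑ p ∈ indexSet η Λ, weight η Λ p * Real.cos (x * time p))
    (∑ l ∈ Finset.range n, seriesCoeff η Λ l * y ^ l) (-Real.log x)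
  have t2 := abs_sub_le (∑ l ∈ Finset.range n, seriesCoeff η Λ l * y ^ l)
    (∑ k ∈ Finset.Icc 1 (orderK η Λ), 1 / (k : ℝ) * (1 - x) ^ k) (-Real.log x)
  linarith

end Parameters

/-! ### Reduction to eigenvalues, and the scalar error of the circuit. -/

section Spectral

open Matrix

variable {n : ℕ} {ρ : QubitMatrix n}

theorem trace_eigenvalue_polynomial (hρ : ρ.IsHermitian) (c σ : ℂ) (Q : ℕ) :
    (ρ * (c • (1 : QubitMatrix n) + σ • ρ) ^ Q).trace =
      ∑ i, (hρ.eigenvalues i : ℂ) * (c + σ * hρ.eigenvalues i) ^ Q := by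
  set D : QubitMatrix n := diagonal (RCLike.ofReal ∘ hρ.eigenvalues) with hD
  set φ := Unitary.conjStarAlgAut ℂ (QubitMatrix n) hρ.eigenvectorUnitary with hφ
  have h : ρ = φ D := hρ.spectral_theorem
  have e : ρ * (c • (1 : QubitMatrix n) + σ • ρ) ^ Q = φ (D * (c • 1 + σ • D) ^ Q) := by
    rw [map_mul, map_pow, map_add, map_smul, map_smul, map_one, ← h]
  have d1 : c • (1 : QubitMatrix n) + σ • D =
      diagonal fun i => c + σ * (hρ.eigenvalues i : ℂ) := by
    rw [hD, ← diagonal_one, ← diagonal_smul, ← diagonal_smul, diagonal_add]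
    congr 1
    funext i
    simp
  rw [e, hφ, Unitary.conjStarAlgAut_apply, trace_mul_cycle, Unitary.coe_star_mul_self, one_mul,
    d1, diagonal_pow, hD, diagonal_mul_diagonal, trace_diagonal]
  rfl

theorem vonNeumannEntropy_eq (hρ : ρ.IsHermitian) :
    vonNeumannEntropy ρ = ∑ i, hρ.eigenvalues i * -Real.log (hρ.eigenvalues i) := by
  set D : QubitMatrix n := diagonal (RCLike.ofReal ∘ hρ.eigenvalues) with hD
  set φ := Unitary.conjStarAlgAut ℂ (QubitMatrix n) hρ.eigenvectorUnitary with hφ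
  have h : ρ = φ D := hρ.spectral_theorem
  have e : ρ * cfc Real.log ρ =
      φ (D * diagonal (RCLike.ofReal ∘ Real.log ∘ hρ.eigenvalues)) := by
    rw [hρ.cfc_eq, map_mul, ← h]
    rfl
  rw [vonNeumannEntropy, e, hφ, Unitary.conjStarAlgAut_apply, trace_mul_cycle,
    Unitary.coe_star_mul_self, one_mul, hD, diagonal_mul_diagonal, trace_diagonal]
  have : ∀ i, (RCLike.ofReal ∘ hρ.eigenvalues) i * (RCLike.ofReal ∘ Real.log ∘ hρ.eigenvalues) i =
      ((hρ.eigenvalues i * Real.log (hρ.eigenvalues i) : ℝ) : ℂ) := by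
    intro i
    simp
  simp only [this]
  rw [← Complex.ofReal_sum, Complex.ofReal_re, ← Finset.sum_neg_distrib]
  exact Finset.sum_congr rfl fun i _ => by ring

theorem eigenvalues_nonneg (hρ : IsDensityMatrix ρ) (i : Fin n → Fin 2) :
    0 ≤ hρ.posSemidef.isHermitian.eigenvalues i := hρ.posSemidef.eigenvalues_nonneg i

theorem sum_eigenvalues (hρ : IsDensityMatrix ρ) :
    ∑ i, hρ.posSemidef.isHermitian.eigenvalues i = 1 := by
  have h := hρ.posSemidef.isHermitian.trace_eq_sum_eigenvalues
  rw [hρ.trace_eq_one] at h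
  have h' : ((∑ i, hρ.posSemidef.isHermitian.eigenvalues i : ℝ) : ℂ) = 1 := by
    rw [h, Complex.ofReal_sum]
    rfl
  exact Complex.ofReal_eq_one.mp h'

theorem eigenvalues_le_one (hρ : IsDensityMatrix ρ) (i : Fin n → Fin 2) :
    hρ.posSemidef.isHermitian.eigenvalues i ≤ 1 := by
  rw [← sum_eigenvalues hρ]
  exact Finset.single_le_sum (fun j _ => eigenvalues_nonneg hρ j) (Finset.mem_univ i)

theorem abs_sin_sub_le {x : ℝ} : |Real.sin x - x| ≤ |x| ^ 3 / 6 := by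
  have key : ∀ z : ℝ, 0 < z → |Real.sin z - z| ≤ |z| ^ 3 / 6 := by
    intro z hz
    rw [abs_of_pos hz, abs_le]
    constructor
    · linarith [Real.sin_gt_sub_cube hz]
    · have := Real.sin_le hz.le
      have : 0 < z ^ 3 := by positivity
      linarith
  rcases lt_trichotomy x 0 with h | h | h
  · have := key (-x) (by linarith)
    rwa [Real.sin_neg, abs_neg, ← neg_sub', abs_neg] at this
  · simp [h]
  · exact key x h

theorem norm_pow_sub_pow_le_mul {a b : ℂ} (ha : ‖a‖ ≤ 1) (hb : ‖b‖ ≤ 1) (Q : ℕ) :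
    ‖a ^ Q - b ^ Q‖ ≤ Q * ‖a - b‖ := by
  induction Q with
  | zero => simp
  | succ Q ih =>
    have e : a ^ (Q + 1) - b ^ (Q + 1) = a * (a ^ Q - b ^ Q) + (a - b) * b ^ Q := by ring
    rw [e]
    refine (norm_add_le _ _).trans ?_
    rw [norm_mul, norm_mul, norm_pow]
    have h1 : ‖a‖ * ‖a ^ Q - b ^ Q‖ ≤ 1 * (Q * ‖a - b‖) :=
      mul_le_mul ha ih (norm_nonneg _) zero_le_one
    have h2 : ‖a - b‖ * ‖b‖ ^ Q ≤ ‖a - b‖ * 1 :=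
      mul_le_mul_of_nonneg_left (pow_le_one₀ (norm_nonneg _) hb) (norm_nonneg _)
    push_cast
    linarith

theorem norm_step_le_one (Δ : ℝ) {x : ℝ} (hx0 : 0 ≤ x) (hx1 : x ≤ 1) :
    ‖(Real.cos Δ : ℂ) + -Complex.I * Real.sin Δ * x‖ ≤ 1 := by
  have e : (Real.cos Δ : ℂ) + -Complex.I * Real.sin Δ * x =
      (Real.cos Δ : ℂ) + ((-(Real.sin Δ * x) : ℝ) : ℂ) * Complex.I := by push_cast; ring
  rw [e, Complex.norm_add_mul_I]
  apply Real.sqrt_le_one.mpr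
  have h1 : x ^ 2 ≤ 1 := pow_le_one₀ hx0 hx1
  nlinarith [Real.cos_sq_add_sin_sq Δ, mul_le_mul_of_nonneg_left h1 (sq_nonneg (Real.sin Δ))]

/-- The two expressions agree to first order in `Δ`. The cosines differ by at most `Δ²/2` and the
sine parts by at most `|Δ|³/3 ≤ Δ²/3`. -/
theorem step_error {Δ : ℝ} (hΔ : |Δ| ≤ 1) {x : ℝ} (hx0 : 0 ≤ x) (hx1 : x ≤ 1) :
    ‖((Real.cos Δ : ℂ) + -Complex.I * Real.sin Δ * x) -
      Complex.exp ((-(x * Δ) : ℝ) * Complex.I)‖ ≤ Δ ^ 2 := by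
  have e : ((Real.cos Δ : ℂ) + -Complex.I * Real.sin Δ * x) -
      Complex.exp ((-(x * Δ) : ℝ) * Complex.I) =
      ((Real.cos Δ - Real.cos (x * Δ) : ℝ) : ℂ) +
        ((Real.sin (x * Δ) - x * Real.sin Δ : ℝ) : ℂ) * Complex.I := by
    rw [Complex.exp_mul_I, ← Complex.ofReal_cos, ← Complex.ofReal_sin, Real.cos_neg, Real.sin_neg]
    push_cast
    ring
  rw [e]
  refine (norm_add_le _ _).trans ?_
  rw [norm_mul, Complex.norm_I, mul_one, Complex.norm_real, Complex.norm_real, Real.norm_eq_abs,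
    Real.norm_eq_abs]
  have hxΔ : (x * Δ) ^ 2 ≤ Δ ^ 2 := by
    rw [mul_pow]; exact mul_le_of_le_one_left (sq_nonneg _) (pow_le_one₀ hx0 hx1)
  have h1 : |Real.cos Δ - Real.cos (x * Δ)| ≤ Δ ^ 2 / 2 := by
    have a1 := Real.one_sub_sq_div_two_le_cos (x := Δ)
    have a2 := Real.one_sub_sq_div_two_le_cos (x := x * Δ)
    have a3 := Real.cos_le_one Δ
    have a4 := Real.cos_le_one (x * Δ)
    rw [abs_le]
    constructor <;> linarith
  have hcube : |Δ| ^ 3 ≤ Δ ^ 2 := by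
    rw [pow_succ, sq_abs]
    exact mul_le_of_le_one_right (sq_nonneg _) hΔ
  have h2 : |Real.sin (x * Δ) - x * Real.sin Δ| ≤ Δ ^ 2 / 3 := by
    have b1 := abs_sin_sub_le (x := x * Δ)
    have b2 := abs_sin_sub_le (x := Δ)
    have b3 : |x * Δ| ^ 3 ≤ |Δ| ^ 3 := by
      rw [abs_mul, abs_of_nonneg hx0]
      exact pow_le_pow_left₀ (by positivity) (mul_le_of_le_one_left (abs_nonneg _) hx1) 3
    have b4 : |x * (Real.sin Δ - Δ)| ≤ |Δ| ^ 3 / 6 := by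
      rw [abs_mul, abs_of_nonneg hx0]
      exact (mul_le_of_le_one_left (abs_nonneg _) hx1).trans b2
    have e2 : Real.sin (x * Δ) - x * Real.sin Δ =
        (Real.sin (x * Δ) - x * Δ) - x * (Real.sin Δ - Δ) := by ring
    rw [e2]
    refine (abs_sub _ _).trans ?_
    linarith
  nlinarith [sq_nonneg Δ]

/-- Both bases have modulus at most one, so the errors of the `Q` steps add up to at most `Q
(t/Q)²`. -/
theorem circuit_error {t : ℝ} {Q : ℕ} (hQ : Q ≠ 0) (hΔ : |t / Q| ≤ 1) {x : ℝ} (hx0 : 0 ≤ x)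
    (hx1 : x ≤ 1) :
    |(((Real.cos (t / Q) : ℂ) + -Complex.I * Real.sin (t / Q) * x) ^ Q).re - Real.cos (x * t)| ≤
      t ^ 2 / Q := by
  have hQ' : (Q : ℝ) ≠ 0 := by exact_mod_cast hQ
  have e1 : Complex.exp ((-(x * (t / Q)) : ℝ) * Complex.I) ^ Q =
      Complex.exp ((-(x * t) : ℝ) * Complex.I) := by
    rw [← Complex.exp_nat_mul, ← mul_assoc]
    congr 2
    rw [← Complex.ofReal_natCast, ← Complex.ofReal_mul]
    congr 1
    field_simp
  have h := norm_pow_sub_pow_le_mul (norm_step_le_one (t / Q) hx0 hx1)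
    (Complex.norm_exp_ofReal_mul_I (-(x * (t / Q)))).le Q
  rw [e1] at h
  have h2 := (Complex.abs_re_le_norm _).trans h
  rw [Complex.sub_re, Complex.exp_ofReal_mul_I_re, Real.cos_neg] at h2
  refine h2.trans ?_
  calc (Q : ℝ) * _ ≤ Q * (t / Q) ^ 2 :=
        mul_le_mul_of_nonneg_left (step_error hΔ hx0 hx1) (Nat.cast_nonneg Q)
    _ = t ^ 2 / Q := by field_simp

end Spectral

/-! ### Bias of one pass and accuracy of the output. -/

section Accuracy

variable {η Λ δ : ℝ} {n : ℕ} {ρ : QubitMatrix n}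

theorem termAccuracy_pos (hη : η ∈ Set.Ioo (0 : ℝ) (1 / 3)) (hΛ : Λ ∈ Set.Ioo (0 : ℝ) 1) :
    0 < termAccuracy η Λ :=
  div_pos hη.1 (by linarith [half_le_weightNorm hη hΛ])

theorem termAccuracy_le_one (hη : η ∈ Set.Ioo (0 : ℝ) (1 / 3)) (hΛ : Λ ∈ Set.Ioo (0 : ℝ) 1) :
    termAccuracy η Λ ≤ 1 := by
  have := half_le_weightNorm hη hΛ
  rw [termAccuracy, div_le_one (by linarith)]
  linarith [hη.2]

theorem numSteps_eq (p : Σ _ : ℕ, ℕ) : numSteps η Λ p = ⌈time p ^ 2 / termAccuracy η Λ⌉₊ := by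
  rw [numSteps, time]
  congr 1
  rw [mul_comm (4 : ℝ), ← div_div]
  ring

theorem one_le_abs_time {p : Σ _ : ℕ, ℕ} (hp : time p ≠ 0) : 1 ≤ |time p| := by
  have h0 : (2 * (p.2 : ℤ) - p.1) ≠ 0 := by
    intro h
    apply hp
    have : (2 * (p.2 : ℝ) - p.1) = 0 := by exact_mod_cast h
    simp [time, this]
  have h1 : (1 : ℝ) ≤ |2 * (p.2 : ℝ) - p.1| := by exact_mod_cast Int.one_le_abs h0
  have e : time p = (2 * (p.2 : ℝ) - p.1) * (Real.pi / 2) := by rw [time]; ring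
  rw [e, abs_mul]
  refine one_le_mul_of_one_le_of_one_le h1 ?_
  rw [abs_of_pos (by positivity)]
  linarith [Real.pi_gt_three]

/-- A nonzero time is a nonzero integer multiple of `π/2`, hence `|t| ≥ 1` and `Q ≥ t²/ε ≥ t² ≥
|t|`. So `|Δ| ≤ 1`, the range in which `cos Δ > 0` and `sin Δ` has the sign of `Δ`. -/
theorem step_of_numSteps_ne_zero (hη : η ∈ Set.Ioo (0 : ℝ) (1 / 3)) (hΛ : Λ ∈ Set.Ioo (0 : ℝ) 1)
    {p : Σ _ : ℕ, ℕ} (hQ : numSteps η Λ p ≠ 0) :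
    time p / numSteps η Λ p ≠ 0 ∧ |time p / numSteps η Λ p| ≤ 1 ∧
      time p ^ 2 / numSteps η Λ p ≤ termAccuracy η Λ := by
  have hε := termAccuracy_pos hη hΛ
  have ht : time p ≠ 0 := by
    intro h
    apply hQ
    rw [numSteps_eq, h]
    simp
  have hQ0 : (0 : ℝ) < numSteps η Λ p := by exact_mod_cast Nat.pos_of_ne_zero hQ
  have h1 := one_le_abs_time ht
  have h2 : time p ^ 2 / termAccuracy η Λ ≤ numSteps η Λ p := by
    rw [numSteps_eq]
    exact Nat.le_ceil _
  have h3 : time p ^ 2 ≤ numSteps η Λ p * termAccuracy η Λ := (div_le_iff₀ hε).mp h2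
  refine ⟨div_ne_zero ht hQ0.ne', ?_, ?_⟩
  · rw [abs_div, abs_of_pos hQ0, div_le_one hQ0]
    have h4 : |time p| ≤ time p ^ 2 := by
      rw [← sq_abs]
      nlinarith
    nlinarith [termAccuracy_le_one hη hΛ]
  · rw [div_le_iff₀ hQ0]
    linarith

theorem time_eq_zero_of_numSteps (hη : η ∈ Set.Ioo (0 : ℝ) (1 / 3)) (hΛ : Λ ∈ Set.Ioo (0 : ℝ) 1)
    {p : Σ _ : ℕ, ℕ} (hQ : numSteps η Λ p = 0) : time p = 0 := by
  have hε := termAccuracy_pos hη hΛ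
  rw [numSteps_eq, Nat.ceil_eq_zero] at hQ
  by_contra h
  have : 0 < time p ^ 2 / termAccuracy η Λ := by positivity
  linarith

/-- The expected value of the `Z`-measurement at the end of the circuit of a pair. -/
def termExpectation (η Λ : ℝ) (ρ : QubitMatrix n) (p : Σ _ : ℕ, ℕ) : ℝ :=
  (ρ * ((Real.cos (time p / numSteps η Λ p) : ℂ) • (1 : QubitMatrix n) +
    (-Complex.I * Real.sin (time p / numSteps η Λ p)) • ρ) ^ numSteps η Λ p).trace.re

theorem termExpectation_eq (hρ : IsDensityMatrix ρ) (p : Σ _ : ℕ, ℕ) :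
    termExpectation η Λ ρ p = ∑ i, hρ.posSemidef.isHermitian.eigenvalues i *
      (((Real.cos (time p / numSteps η Λ p) : ℂ) +
        -Complex.I * Real.sin (time p / numSteps η Λ p) *
          hρ.posSemidef.isHermitian.eigenvalues i) ^ numSteps η Λ p).re := by
  rw [termExpectation, trace_eigenvalue_polynomial hρ.posSemidef.isHermitian, Complex.re_sum]
  exact Finset.sum_congr rfl fun i _ => Complex.re_ofReal_mul _ _

theorem abs_termExpectation_le_one (hρ : IsDensityMatrix ρ) (p : Σ _ : ℕ, ℕ) :
    |termExpectation η Λ ρ p| ≤ 1 := by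
  rw [termExpectation_eq hρ, ← sum_eigenvalues hρ]
  refine (Finset.abs_sum_le_sum_abs _ _).trans (Finset.sum_le_sum fun i _ => ?_)
  rw [abs_mul, abs_of_nonneg (eigenvalues_nonneg hρ i)]
  refine mul_le_of_le_one_right (eigenvalues_nonneg hρ i) ((Complex.abs_re_le_norm _).trans ?_)
  rw [norm_pow]
  exact pow_le_one₀ (norm_nonneg _)
    (norm_step_le_one _ (eigenvalues_nonneg hρ i) (eigenvalues_le_one hρ i))

theorem termExpectation_error (hη : η ∈ Set.Ioo (0 : ℝ) (1 / 3)) (hΛ : Λ ∈ Set.Ioo (0 : ℝ) 1)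
    (hρ : IsDensityMatrix ρ) (p : Σ _ : ℕ, ℕ) :
    |termExpectation η Λ ρ p - ∑ i, hρ.posSemidef.isHermitian.eigenvalues i *
      Real.cos (hρ.posSemidef.isHermitian.eigenvalues i * time p)| ≤ termAccuracy η Λ := by
  have hε := termAccuracy_pos hη hΛ
  rw [termExpectation_eq hρ, ← Finset.sum_sub_distrib]
  by_cases hQ : numSteps η Λ p = 0
  · have ht := time_eq_zero_of_numSteps hη hΛ hQ
    simp [hQ, ht, hε.le]
  · obtain ⟨-, hΔ, herr⟩ := step_of_numSteps_ne_zero hη hΛ hQ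
    calc _ ≤ ∑ i, hρ.posSemidef.isHermitian.eigenvalues i * termAccuracy η Λ := by
          refine (Finset.abs_sum_le_sum_abs _ _).trans (Finset.sum_le_sum fun i _ => ?_)
          rw [← mul_sub, abs_mul, abs_of_nonneg (eigenvalues_nonneg hρ i)]
          exact mul_le_mul_of_nonneg_left
            ((circuit_error hQ hΔ (eigenvalues_nonneg hρ i) (eigenvalues_le_one hρ i)).trans herr)
            (eigenvalues_nonneg hρ i)
      _ = termAccuracy η Λ := by rw [← Finset.sum_mul, sum_eigenvalues hρ, one_mul]

/-- Zero eigenvalues drop out of both sides because of the factor `λ_i`. The others lie in `[Λ, 1]`,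
and the errors are averaged with weights `λ_i` of sum one. -/
theorem fourier_trace_approx (hη : η ∈ Set.Ioo (0 : ℝ) (1 / 3)) (hΛ : Λ ∈ Set.Ioo (0 : ℝ) 1)
    (hρ : IsDensityMatrix ρ) (hspec : ∀ lam ∈ spectrum ℝ ρ, lam ≠ 0 → Λ ≤ lam) :
    |∑ p ∈ indexSet η Λ, weight η Λ p * ∑ i, hρ.posSemidef.isHermitian.eigenvalues i *
      Real.cos (hρ.posSemidef.isHermitian.eigenvalues i * time p) - vonNeumannEntropy ρ| ≤ η := by
  set ev := hρ.posSemidef.isHermitian.eigenvalues with hev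
  have e : ∑ p ∈ indexSet η Λ, weight η Λ p * ∑ i, ev i * Real.cos (ev i * time p) -
      vonNeumannEntropy ρ = ∑ i, ev i *
        (∑ p ∈ indexSet η Λ, weight η Λ p * Real.cos (ev i * time p) - -Real.log (ev i)) := by
    rw [vonNeumannEntropy_eq hρ.posSemidef.isHermitian]
    simp only [mul_sub, Finset.sum_sub_distrib, Finset.mul_sum]
    rw [Finset.sum_comm]
    congr 1
    exact Finset.sum_congr rfl fun i _ => Finset.sum_congr rfl fun p _ => by ring
  rw [e]
  calc _ ≤ ∑ i, ev i * η := by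
        refine (Finset.abs_sum_le_sum_abs _ _).trans (Finset.sum_le_sum fun i _ => ?_)
        by_cases h0 : ev i = 0
        · simp [h0]
        · rw [abs_mul, abs_of_nonneg (eigenvalues_nonneg hρ i)]
          exact mul_le_mul_of_nonneg_left (fourier_approx hη hΛ
            ⟨hspec _ (hρ.posSemidef.isHermitian.eigenvalues_mem_spectrum_real i) h0,
              eigenvalues_le_one hρ i⟩) (eigenvalues_nonneg hρ i)
    _ = η := by rw [← Finset.sum_mul, sum_eigenvalues hρ, one_mul]

/-- The expected value of the estimate of one iteration. -/
def meanEstimate (η Λ : ℝ) (ρ : QubitMatrix n) : ℝ :=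
  (∑ p ∈ indexSet η Λ, weight η Λ p * termExpectation η Λ ρ p) /
    ∑ p ∈ indexSet η Λ, weight η Λ p

theorem abs_meanEstimate_le_one (hη : η ∈ Set.Ioo (0 : ℝ) (1 / 3)) (hΛ : Λ ∈ Set.Ioo (0 : ℝ) 1)
    (hρ : IsDensityMatrix ρ) : |meanEstimate η Λ ρ| ≤ 1 := by
  have hS := half_le_weightNorm hη hΛ
  rw [weightNorm_eq] at hS
  rw [meanEstimate, abs_div, abs_of_pos (by linarith : 0 < ∑ p ∈ indexSet η Λ, weight η Λ p),
    div_le_one (by linarith)]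
  refine (Finset.abs_sum_le_sum_abs _ _).trans (Finset.sum_le_sum fun p _ => ?_)
  rw [abs_mul, abs_of_nonneg (weight_nonneg p)]
  exact mul_le_of_le_one_right (weight_nonneg p) (abs_termExpectation_le_one hρ p)

theorem weightNorm_mul_termAccuracy (hη : η ∈ Set.Ioo (0 : ℝ) (1 / 3))
    (hΛ : Λ ∈ Set.Ioo (0 : ℝ) 1) : weightNorm η Λ * termAccuracy η Λ = η := by
  have hS := half_le_weightNorm hη hΛ
  rw [termAccuracy]
  field_simp

/-- One `η` comes from the Fourier series and one from the circuits, as the norm of the weights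
times `ε` is `η`. -/
theorem meanEstimate_error (hη : η ∈ Set.Ioo (0 : ℝ) (1 / 3)) (hΛ : Λ ∈ Set.Ioo (0 : ℝ) 1)
    (hρ : IsDensityMatrix ρ) (hspec : ∀ lam ∈ spectrum ℝ ρ, lam ≠ 0 → Λ ≤ lam) :
    |weightNorm η Λ * meanEstimate η Λ ρ - vonNeumannEntropy ρ| ≤ 2 * η := by
  have hS := half_le_weightNorm hη hΛ
  have h1 := fourier_trace_approx hη hΛ hρ hspec
  have h2 : weightNorm η Λ * meanEstimate η Λ ρ =
      ∑ p ∈ indexSet η Λ, weight η Λ p * termExpectation η Λ ρ p := by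
    rw [meanEstimate, ← weightNorm_eq]
    field_simp
  have h3 : |∑ p ∈ indexSet η Λ, weight η Λ p * termExpectation η Λ ρ p -
      ∑ p ∈ indexSet η Λ, weight η Λ p * ∑ i, hρ.posSemidef.isHermitian.eigenvalues i *
      Real.cos (hρ.posSemidef.isHermitian.eigenvalues i * time p)| ≤ η := by
    rw [← Finset.sum_sub_distrib]
    calc _ ≤ ∑ p ∈ indexSet η Λ, weight η Λ p * termAccuracy η Λ := by
          refine (Finset.abs_sum_le_sum_abs _ _).trans (Finset.sum_le_sum fun p _ => ?_)
          rw [← mul_sub, abs_mul, abs_of_nonneg (weight_nonneg p)]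
          exact mul_le_mul_of_nonneg_left (termExpectation_error hη hΛ hρ p) (weight_nonneg p)
      _ = η := by
          rw [← Finset.sum_mul, ← weightNorm_eq, weightNorm_mul_termAccuracy hη hΛ]
  rw [h2]
  rw [abs_le] at h1 h3 ⊢
  constructor <;> linarith [h1.1, h1.2, h3.1, h3.2]

theorem one_le_numTerms : 1 ≤ numTerms η Λ := by
  have h := Finset.single_le_sum (f := fun l => 2 * paramM η Λ l + 1)
    (s := Finset.range (⌊paramL η Λ⌋₊ + 1)) (fun l _ => Nat.zero_le _)
    (Finset.mem_range.mpr (Nat.succ_pos _) : 0 ∈ _)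
  exact le_trans (Nat.le_add_left 1 _) h

theorem log_numTerms_pos (hδ : δ ∈ Set.Ioo (0 : ℝ) 1) :
    0 < Real.log (2 * numTerms η Λ / δ) := by
  have h : (1 : ℝ) ≤ numTerms η Λ := by exact_mod_cast one_le_numTerms
  apply Real.log_pos
  rw [lt_div_iff₀ hδ.1]
  linarith [hδ.2]

theorem numMeasurements_ne_zero (hη : η ∈ Set.Ioo (0 : ℝ) (1 / 3)) (hΛ : Λ ∈ Set.Ioo (0 : ℝ) 1)
    (hδ : δ ∈ Set.Ioo (0 : ℝ) 1) : numMeasurements η δ Λ ≠ 0 := by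
  have h1 := log_numTerms_pos (η := η) (Λ := Λ) hδ
  have h2 := termAccuracy_pos hη hΛ
  exact (Nat.ceil_pos.mpr (by positivity)).ne'

theorem lexp_iteration_eq (hη : η ∈ Set.Ioo (0 : ℝ) (1 / 3)) (hΛ : Λ ∈ Set.Ioo (0 : ℝ) 1)
    (hδ : δ ∈ Set.Ioo (0 : ℝ) 1) (hρ : IsDensityMatrix ρ) (τ : ℝ) (hτ : |τ| ≤ 1) :
    lexp (iteration η δ Λ ρ) (fun r => ENNReal.ofReal (1 + τ * r.estimate)) =
      ENNReal.ofReal (1 + τ * meanEstimate η Λ ρ) := by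
  have hS := half_le_weightNorm hη hΛ
  rw [weightNorm_eq] at hS
  exact lexp_iteration (fun p _ => weight_nonneg p) (by linarith)
    (numMeasurements_ne_zero hη hΛ hδ) (fun p _ => abs_termExpectation_le_one hρ p)
    (fun p _ b => estimationCircuit_weight hρ (time p) (numSteps η Λ p)
      (fun hQ => ⟨(step_of_numSteps_ne_zero hη hΛ hQ).1, (step_of_numSteps_ne_zero hη hΛ hQ).2.1⟩)
      b) τ hτ

/-- The estimate is `3 * η`-accurate with probability at least `1 - δ`. -/
theorem algorithm_accuracy (hη : η ∈ Set.Ioo (0 : ℝ) (1 / 3)) (hΛ : Λ ∈ Set.Ioo (0 : ℝ) 1)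
    (hδ : δ ∈ Set.Ioo (0 : ℝ) 1) (hρ : IsDensityMatrix ρ)
    (hspec : ∀ lam ∈ spectrum ℝ ρ, lam ≠ 0 → Λ ≤ lam) :
    ENNReal.ofReal (1 - δ) ≤ (algorithm η δ Λ ρ).toOuterMeasure
      {r | |r.estimate - vonNeumannEntropy ρ| ≤ 3 * η} := by
  have hS := half_le_weightNorm hη hΛ
  have hε := termAccuracy_pos hη hΛ
  -- The statistical error supplies the third `η`. The passes as a whole are the independent
  -- samples, so the random choice of the pair is covered as well.
  have htail := iid_mean_tail (iteration η δ Λ ρ) (X := Outcome.estimate)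
    (fun r hr => abs_estimate_le_one hr) (abs_meanEstimate_le_one hη hΛ hρ)
    (by simpa using lexp_iteration_eq hη hΛ hδ hρ 1 (by simp))
    (by simpa [sub_eq_add_neg] using lexp_iteration_eq hη hΛ hδ hρ (-1) (by simp))
    hε (termAccuracy_le_one hη hΛ) hδ.1 hδ.2 (B := numSamples η δ Λ) (Nat.le_ceil _)
  rw [algorithm, PMF.toOuterMeasure_map_apply]
  set tail := {l : List Outcome | termAccuracy η Λ <
    |(l.map Outcome.estimate).sum / numSamples η δ Λ - meanEstimate η Λ ρ|} with htl
  set p := iid (iteration η δ Λ ρ) (numSamples η δ Λ)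
  have hsum := toOuterMeasure_add_compl p tail
  have hcompl : ENNReal.ofReal (1 - δ) ≤ p.toOuterMeasure tailᶜ := by
    rw [ENNReal.ofReal_sub _ hδ.1.le, ENNReal.ofReal_one, tsub_le_iff_left, ← hsum]
    exact add_le_add htail le_rfl
  refine hcompl.trans (p.toOuterMeasure.mono fun l hl => ?_)
  have hl' : |(l.map Outcome.estimate).sum / numSamples η δ Λ - meanEstimate η Λ ρ| ≤
      termAccuracy η Λ := not_lt.mp hl
  have h1 : |weightNorm η Λ * ((l.map Outcome.estimate).sum / numSamples η δ Λ) -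
      weightNorm η Λ * meanEstimate η Λ ρ| ≤ η := by
    rw [← mul_sub, abs_mul, abs_of_pos (by linarith : 0 < weightNorm η Λ)]
    exact (mul_le_mul_of_nonneg_left hl' (by linarith : 0 ≤ weightNorm η Λ)).trans_eq
      (weightNorm_mul_termAccuracy hη hΛ)
  have h2 := meanEstimate_error hη hΛ hρ hspec
  change |weightNorm η Λ * ((l.map Outcome.estimate).sum / numSamples η δ Λ) -
    vonNeumannEntropy ρ| ≤ 3 * η
  rw [abs_le] at h1 h2 ⊢
  constructor <;> linarith [h1.1, h1.2, h2.1, h2.2]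

end Accuracy

/-! ### Copies and gates of one circuit. -/

section GateCounts

variable {n : ℕ}

/-- Seven gates per controlled qubit swap, five for each of the two Toffolis, and at most two phase
gates. -/
theorem length_cSelect_le (Δ : ℝ) : (cSelect (n := n) Δ).length ≤ 7 * n + 12 := by
  have h : ((List.finRange n).flatMap cSwapQubit).length = 7 * n := by
    simp [List.length_flatMap, cSwapQubit, toffoli, gatesCC, mul_comm]
  simp only [cSelect, List.length_append, h]
  split_ifs <;> simp [toffoli, gatesCC] <;> omega

theorem length_cW_le (Δ : ℝ) : (cW (n := n) Δ).length ≤ 7 * n + 15 := by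
  have h := length_cSelect_le (n := n) Δ
  simp only [cW, List.length_append, List.length_cons, List.length_nil]
  omega

theorem length_cA_le (Δ : ℝ) : (cA (n := n) Δ).length ≤ 21 * n + 61 := by
  have h := length_cW_le (n := n) Δ
  simp only [cA, List.length_append, daggerList, List.length_reverse, List.length_map, cReflect,
    cNegReflect, ccZ, gatesCC, List.length_cons, List.length_nil]
  omega

theorem copyCount_estimationCircuit (t : ℝ) (Q : ℕ) :
    (estimationCircuit n t Q).copyCount = Q + 1 := by
  have h : ∀ c : List (Gate (Wire n)), ((c.map Instr.gate).map Instr.copyCost).sum = 0 := by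
    intro c
    induction c with
    | nil => rfl
    | cons g c ih => simpa [Instr.copyCost] using ih
  have h2 : (((List.replicate Q (Instr.load 1 :: (cA (n := n) (t / Q)).map Instr.gate)).flatten).map
      Instr.copyCost).sum = Q := by
    rw [List.map_flatten, List.sum_flatten, List.map_replicate, List.map_replicate,
      List.sum_replicate, List.map_cons, List.sum_cons, h]
    simp [Instr.copyCost]
  rw [Circuit.copyCount, estimationCircuit, List.map_append, List.map_append, List.sum_append,
    List.sum_append, h2]
  simp [Instr.copyCost, add_comm]

theorem gateCount_estimationCircuit_le (hn : 1 ≤ n) (t : ℝ) (Q : ℕ) :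
    (estimationCircuit n t Q).gateCount ≤ 84 * n * (Q + 1) := by
  have h : ∀ c : List (Gate (Wire n)),
      ((c.map Instr.gate).map Instr.gateCost).sum = c.length := by
    intro c
    induction c with
    | nil => rfl
    | cons g c ih =>
      rw [List.map_cons, List.map_cons, List.sum_cons, ih, List.length_cons, add_comm]
      rfl
  have h2 : (((List.replicate Q (Instr.load 1 :: (cA (n := n) (t / Q)).map Instr.gate)).flatten).map
      Instr.gateCost).sum = Q * (cA (n := n) (t / Q)).length := by
    rw [List.map_flatten, List.sum_flatten, List.map_replicate, List.map_replicate,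
      List.sum_replicate, List.map_cons, List.sum_cons, h]
    simp [Instr.gateCost]
  have h3 := length_cA_le (n := n) (t / Q)
  rw [Circuit.gateCount, estimationCircuit, List.map_append, List.map_append, List.sum_append,
    List.sum_append, h2]
  simp only [List.map_cons, List.map_nil, List.sum_cons, List.sum_nil, Instr.gateCost]
  -- `21n + 61 ≤ 82n` because `1 ≤ n`; the two Hadamard gates are absorbed in the final `84n(Q +
  -- 1)`.
  have h4 : Q * (cA (n := n) (t / Q)).length ≤ Q * (82 * n) := Nat.mul_le_mul_left _ (by omega)
  nlinarith

end GateCounts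

/-! ### Bounds for all parameters in terms of one logarithm `ℓ`, `1/Λ` and `1/ϵ`. -/

section Parameters

variable {Λ ϵ δ : ℝ}

/-- The logarithmic factor of the resource bounds. -/
def logFactor (ϵ δ Λ : ℝ) : ℝ := Real.log (3 / (ϵ * δ * Λ))

theorem third_mem (hϵ : ϵ ∈ Set.Ioo (0 : ℝ) 1) : ϵ / 3 ∈ Set.Ioo (0 : ℝ) (1 / 3) :=
  ⟨by linarith [hϵ.1], by linarith [hϵ.2]⟩

theorem one_le_inv_of_mem {x : ℝ} (hx : x ∈ Set.Ioo (0 : ℝ) 1) : 1 ≤ 1 / x := by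
  rw [le_div_iff₀ hx.1, one_mul]
  exact hx.2.le

theorem three_mul_inv_eq (ϵ δ Λ : ℝ) :
    3 / (ϵ * δ * Λ) = 3 * ((1 / ϵ) * (1 / δ) * (1 / Λ)) := by
  rw [one_div_mul_one_div, one_div_mul_one_div, mul_one_div]

theorem logFactor_eq (hΛ : Λ ∈ Set.Ioo (0 : ℝ) 1)
    (hϵ : ϵ ∈ Set.Ioo (0 : ℝ) 1) (hδ : δ ∈ Set.Ioo (0 : ℝ) 1) :
    logFactor ϵ δ Λ =
      Real.log 3 + (Real.log (1 / ϵ) + Real.log (1 / δ) + Real.log (1 / Λ)) := by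
  have h1 := hϵ.1
  have h2 := hδ.1
  have h3 := hΛ.1
  rw [logFactor, three_mul_inv_eq, Real.log_mul (by positivity) (by positivity),
    Real.log_mul (by positivity) (by positivity), Real.log_mul (by positivity) (by positivity)]

theorem log_inv_nonneg_of_mem {x : ℝ} (hx : x ∈ Set.Ioo (0 : ℝ) 1) : 0 ≤ Real.log (1 / x) :=
  Real.log_nonneg (one_le_inv_of_mem hx)

theorem one_le_log_three : 1 ≤ Real.log 3 := by
  rw [Real.le_log_iff_exp_le (by norm_num)]
  linarith [Real.exp_one_lt_d9]

/-- The `3` in the logarithm is there for this: `ln 3 ≥ 1`, so numerical constants and the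
increments from rounding up can be absorbed into powers of the logarithm. -/
theorem one_le_logFactor (hΛ : Λ ∈ Set.Ioo (0 : ℝ) 1)
    (hϵ : ϵ ∈ Set.Ioo (0 : ℝ) 1) (hδ : δ ∈ Set.Ioo (0 : ℝ) 1) :
    1 ≤ logFactor ϵ δ Λ := by
  rw [logFactor_eq hΛ hϵ hδ]
  linarith [one_le_log_three, log_inv_nonneg_of_mem hΛ, log_inv_nonneg_of_mem hϵ,
    log_inv_nonneg_of_mem hδ]

theorem log_le_nat_mul_log_three {c : ℝ} (hc : 0 < c) {m : ℕ} (h : c ≤ 3 ^ m) :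
    Real.log c ≤ m * Real.log 3 := by
  rw [← Real.log_pow]
  exact Real.log_le_log hc h

/-- `ln(1/(1 - Λ)) ≥ Λ`, and the numerator `ln(12/(ϵΛ))` is at most `3ℓ` as `12 ≤ 3^3`; rounding up
costs one more `ℓ/Λ`. -/
theorem orderK_le (hΛ : Λ ∈ Set.Ioo (0 : ℝ) 1)
    (hϵ : ϵ ∈ Set.Ioo (0 : ℝ) 1) (hδ : δ ∈ Set.Ioo (0 : ℝ) 1) :
    (orderK (ϵ / 3) Λ : ℝ) ≤ 4 * logFactor ϵ δ Λ * (1 / Λ) := by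
  have hl := logFactor_eq hΛ hϵ hδ
  have h1 := hϵ.1
  have h3 := hΛ.1
  have hlog : Real.log (4 / (ϵ / 3 * Λ)) ≤ 3 * logFactor ϵ δ Λ := by
    have e : 4 / (ϵ / 3 * Λ) = 12 * ((1 / ϵ) * (1 / Λ)) := by
      field_simp
      norm_num
    rw [e, Real.log_mul (by positivity) (by positivity),
      Real.log_mul (by positivity) (by positivity)]
    have := log_le_nat_mul_log_three (c := 12) (m := 3) (by norm_num) (by norm_num)
    push_cast at this
    linarith [log_inv_nonneg_of_mem hΛ, log_inv_nonneg_of_mem hϵ, log_inv_nonneg_of_mem hδ]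
  have hden : Λ ≤ Real.log (1 / (1 - Λ)) := by
    have hp : 0 < 1 - Λ := by linarith [hΛ.2]
    rw [one_div, Real.log_inv]
    linarith [Real.log_le_sub_one_of_pos hp]
  have h5 : Real.log (4 / (ϵ / 3 * Λ)) / Real.log (1 / (1 - Λ)) ≤
      3 * logFactor ϵ δ Λ * (1 / Λ) := by
    rw [mul_one_div]
    exact div_le_div₀ (by linarith [one_le_logFactor hΛ hϵ hδ]) hlog hΛ.1 hden
  have h6 := (Nat.ceil_lt_add_one
    (div_nonneg (log_four_div_pos (third_mem hϵ) hΛ).le (log_inv_one_sub_pos hΛ).le)).le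
  have h7 : 1 ≤ logFactor ϵ δ Λ * (1 / Λ) :=
    one_le_mul_of_one_le_of_one_le (one_le_logFactor hΛ hϵ hδ) (one_le_inv_of_mem hΛ)
  rw [orderK]
  linarith

theorem harmonicK_le_one_add_log (η Λ : ℝ) : harmonicK η Λ ≤ 1 + Real.log (orderK η Λ) := by
  have h := harmonic_le_one_add_log (orderK η Λ)
  rw [harmonic_eq_sum_Icc] at h
  push_cast at h
  simpa [harmonicK] using h

theorem harmonicK_le (hΛ : Λ ∈ Set.Ioo (0 : ℝ) 1)
    (hϵ : ϵ ∈ Set.Ioo (0 : ℝ) 1) (hδ : δ ∈ Set.Ioo (0 : ℝ) 1) :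
    harmonicK (ϵ / 3) Λ ≤ 5 * logFactor ϵ δ Λ := by
  have hl := logFactor_eq hΛ hϵ hδ
  have h1 := one_le_logFactor hΛ hϵ hδ
  have h3 := hΛ.1
  have hK : (0 : ℝ) < orderK (ϵ / 3) Λ := by
    exact_mod_cast one_le_orderK (third_mem hϵ) hΛ
  have h := (harmonicK_le_one_add_log (ϵ / 3) Λ).trans
    (add_le_add le_rfl (Real.log_le_log hK (orderK_le hΛ hϵ hδ)))
  rw [Real.log_mul (by positivity) (by positivity),
    Real.log_mul (by positivity) (by positivity)] at h
  have h4 := log_le_nat_mul_log_three (c := 4) (m := 2) (by norm_num) (by norm_num)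
  push_cast at h4
  have h5 := Real.log_le_sub_one_of_pos (show 0 < logFactor ϵ δ Λ by linarith)
  linarith [log_inv_nonneg_of_mem hΛ, log_inv_nonneg_of_mem hϵ, log_inv_nonneg_of_mem hδ]

theorem logTerm_le (hΛ : Λ ∈ Set.Ioo (0 : ℝ) 1)
    (hϵ : ϵ ∈ Set.Ioo (0 : ℝ) 1) (hδ : δ ∈ Set.Ioo (0 : ℝ) 1) :
    logTerm (ϵ / 3) Λ ≤ 9 * logFactor ϵ δ Λ := by
  have hl := logFactor_eq hΛ hϵ hδ
  have h1 := hϵ.1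
  have hH := one_le_harmonicK (third_mem hϵ) hΛ
  have hH' := harmonicK_le hΛ hϵ hδ
  have e : logTerm (ϵ / 3) Λ = Real.log (12 * (harmonicK (ϵ / 3) Λ * (1 / ϵ))) := by
    change Real.log (4 * harmonicK (ϵ / 3) Λ / (ϵ / 3)) = _
    congr 1
    field_simp
    norm_num
  rw [e, Real.log_mul (by positivity) (by positivity),
    Real.log_mul (by positivity) (by positivity)]
  have h12 := log_le_nat_mul_log_three (c := 12) (m := 3) (by norm_num) (by norm_num)
  push_cast at h12
  have h5 := Real.log_le_sub_one_of_pos (show 0 < harmonicK (ϵ / 3) Λ by linarith)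
  linarith [log_inv_nonneg_of_mem hΛ, log_inv_nonneg_of_mem hϵ, log_inv_nonneg_of_mem hδ]

/-- The square root in `M_l` halves the exponent of `Λ`: `l ≤ ln r / Λ²` gives `√(l ln r / 2) ≤ ln r
/ Λ`. -/
theorem paramM_le (hΛ : Λ ∈ Set.Ioo (0 : ℝ) 1)
    (hϵ : ϵ ∈ Set.Ioo (0 : ℝ) 1) (hδ : δ ∈ Set.Ioo (0 : ℝ) 1)
    {l : ℕ} (h : l ∈ Finset.range (⌊paramL (ϵ / 3) Λ⌋₊ + 1)) :
    (paramM (ϵ / 3) Λ l : ℝ) ≤ 10 * logFactor ϵ δ Λ * (1 / Λ) := by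
  have h1 := one_le_logTerm (third_mem hϵ) hΛ
  have hT := logTerm_le hΛ hϵ hδ
  have ha := one_le_inv_of_mem hΛ
  have hl : (l : ℝ) ≤ logTerm (ϵ / 3) Λ * (1 / Λ ^ 2) := by
    have := Nat.lt_succ_iff.mp (Finset.mem_range.mp h)
    exact (Nat.le_floor_iff (zero_le_one.trans (one_le_paramL (third_mem hϵ) hΛ))).mp this
  have hs : √(logTerm (ϵ / 3) Λ * (l / 2)) ≤ logTerm (ϵ / 3) Λ * (1 / Λ) := by
    rw [Real.sqrt_le_iff]
    refine ⟨by positivity, ?_⟩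
    rw [← one_div_pow] at hl
    have h2 := mul_le_mul_of_nonneg_left hl (by linarith : 0 ≤ logTerm (ϵ / 3) Λ)
    have h3 : 0 ≤ logTerm (ϵ / 3) Λ * l := by positivity
    nlinarith
  have hc := (Nat.ceil_lt_add_one (Real.sqrt_nonneg (logTerm (ϵ / 3) Λ * (l / 2)))).le
  have h2 : logTerm (ϵ / 3) Λ * (1 / Λ) ≤ 9 * logFactor ϵ δ Λ * (1 / Λ) :=
    mul_le_mul_of_nonneg_right hT (by linarith)
  have h7 : 1 ≤ logFactor ϵ δ Λ * (1 / Λ) :=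
    one_le_mul_of_one_le_of_one_le (one_le_logFactor hΛ hϵ hδ) ha
  rw [paramM]
  linarith

/-- The index `s` stays within `M_l` of the rounded half of `l`, so `|2s - l| ≤ 2 M_l + 1`. This is
smaller by a factor of order `Λ` than the bound `l` available without truncation. -/
theorem abs_frequency_le (hΛ : Λ ∈ Set.Ioo (0 : ℝ) 1)
    (hϵ : ϵ ∈ Set.Ioo (0 : ℝ) 1) (hδ : δ ∈ Set.Ioo (0 : ℝ) 1)
    {p : Σ _ : ℕ, ℕ} (h : p ∈ indexSet (ϵ / 3) Λ) :
    |2 * (p.2 : ℝ) - p.1| ≤ 21 * logFactor ϵ δ Λ * (1 / Λ) := by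
  obtain ⟨h1, h2⟩ := Finset.mem_sigma.mp h
  have hM := paramM_le hΛ hϵ hδ h1
  have h7 : 1 ≤ logFactor ϵ δ Λ * (1 / Λ) :=
    one_le_mul_of_one_le_of_one_le (one_le_logFactor hΛ hϵ hδ) (one_le_inv_of_mem hΛ)
  rw [Finset.mem_Icc, le_min_iff] at h2
  have h3 : (p.1 : ℝ) ≤ 2 * p.2 + 2 * paramM (ϵ / 3) Λ p.1 + 1 := by
    have : p.1 ≤ 2 * p.2 + 2 * paramM (ϵ / 3) Λ p.1 + 1 := by omega
    exact_mod_cast this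
  have h4 : 2 * (p.2 : ℝ) ≤ p.1 + 2 * paramM (ϵ / 3) Λ p.1 + 1 := by
    have : 2 * p.2 ≤ p.1 + 2 * paramM (ϵ / 3) Λ p.1 + 1 := by omega
    exact_mod_cast this
  rw [abs_le]
  constructor <;> linarith

theorem inv_termAccuracy_le (hΛ : Λ ∈ Set.Ioo (0 : ℝ) 1)
    (hϵ : ϵ ∈ Set.Ioo (0 : ℝ) 1) (hδ : δ ∈ Set.Ioo (0 : ℝ) 1) :
    1 / termAccuracy (ϵ / 3) Λ ≤ 15 * logFactor ϵ δ Λ * (1 / ϵ) := by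
  have h1 := (weightNorm_le (η := ϵ / 3) (Λ := Λ)).trans (harmonicK_le hΛ hϵ hδ)
  have h2 := one_le_inv_of_mem hϵ
  have e : 1 / termAccuracy (ϵ / 3) Λ = weightNorm (ϵ / 3) Λ * (3 * (1 / ϵ)) := by
    rw [termAccuracy, one_div_div, div_div_eq_mul_div]
    ring
  rw [e]
  calc _ ≤ 5 * logFactor ϵ δ Λ * (3 * (1 / ϵ)) :=
        mul_le_mul_of_nonneg_right h1 (by linarith)
    _ = _ := by ring

theorem numSteps_add_one_le (hΛ : Λ ∈ Set.Ioo (0 : ℝ) 1)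
    (hϵ : ϵ ∈ Set.Ioo (0 : ℝ) 1) (hδ : δ ∈ Set.Ioo (0 : ℝ) 1)
    {p : Σ _ : ℕ, ℕ} (h : p ∈ indexSet (ϵ / 3) Λ) :
    (numSteps (ϵ / 3) Λ p : ℝ) + 1 ≤
      26462 * logFactor ϵ δ Λ ^ 3 * (1 / Λ) ^ 2 * (1 / ϵ) := by
  have hl := one_le_logFactor hΛ hϵ hδ
  have ha := one_le_inv_of_mem hΛ
  have he := one_le_inv_of_mem hϵ
  have hε := termAccuracy_pos (third_mem hϵ) hΛ
  have hf := abs_frequency_le hΛ hϵ hδ h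
  have hinv := inv_termAccuracy_le hΛ hϵ hδ
  set ℓ := logFactor ϵ δ Λ
  set a := 1 / Λ
  set e := 1 / ϵ
  have ht : time p ^ 2 ≤ 4 * (21 * ℓ * a) ^ 2 := by
    have e1 : time p ^ 2 = (2 * (p.2 : ℝ) - p.1) ^ 2 * (Real.pi / 2) ^ 2 := by rw [time]; ring
    have h2 : (2 * (p.2 : ℝ) - p.1) ^ 2 ≤ (21 * ℓ * a) ^ 2 := by
      rw [← sq_abs]
      exact pow_le_pow_left₀ (abs_nonneg _) hf 2
    have h3 : (Real.pi / 2) ^ 2 ≤ 4 := by nlinarith [Real.pi_pos, Real.pi_le_four]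
    rw [e1, mul_comm (4 : ℝ)]
    exact mul_le_mul h2 h3 (by positivity) (by positivity)
  have hq : time p ^ 2 / termAccuracy (ϵ / 3) Λ ≤ 4 * (21 * ℓ * a) ^ 2 * (15 * ℓ * e) := by
    rw [div_eq_mul_one_div]
    exact mul_le_mul ht hinv (by positivity) (by positivity)
  have hc := (Nat.ceil_lt_add_one
    (show 0 ≤ time p ^ 2 / termAccuracy (ϵ / 3) Λ by positivity)).le
  have h1 : 1 ≤ ℓ ^ 3 * a ^ 2 * e :=
    one_le_mul_of_one_le_of_one_le (one_le_mul_of_one_le_of_one_le (one_le_pow₀ hl)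
      (one_le_pow₀ ha)) he
  rw [numSteps_eq]
  -- `26462 = 4 * 21² * 15 + 2`, where one unit comes from the ceiling and one from the copy loaded
  -- into the main register.
  calc _ ≤ 4 * (21 * ℓ * a) ^ 2 * (15 * ℓ * e) + 2 * (ℓ ^ 3 * a ^ 2 * e) := by linarith
    _ = _ := by ring

theorem inv_termAccuracy_sq_le (hΛ : Λ ∈ Set.Ioo (0 : ℝ) 1)
    (hϵ : ϵ ∈ Set.Ioo (0 : ℝ) 1) (hδ : δ ∈ Set.Ioo (0 : ℝ) 1) :
    1 / termAccuracy (ϵ / 3) Λ ^ 2 ≤ 225 * logFactor ϵ δ Λ ^ 2 * (1 / ϵ) ^ 2 := by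
  have hε := termAccuracy_pos (third_mem hϵ) hΛ
  have h := pow_le_pow_left₀ (by positivity) (inv_termAccuracy_le hΛ hϵ hδ) 2
  rw [one_div_pow] at h
  exact h.trans_eq (by ring)

theorem log_two_div_le (hΛ : Λ ∈ Set.Ioo (0 : ℝ) 1)
    (hϵ : ϵ ∈ Set.Ioo (0 : ℝ) 1) (hδ : δ ∈ Set.Ioo (0 : ℝ) 1) :
    Real.log (2 / δ) ≤ logFactor ϵ δ Λ := by
  have h2 := hδ.1
  rw [logFactor_eq hΛ hϵ hδ, ← mul_one_div, Real.log_mul (by positivity) (by positivity)]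
  have := Real.log_le_log (by norm_num) (by norm_num : (2 : ℝ) ≤ 3)
  linarith [log_inv_nonneg_of_mem hΛ, log_inv_nonneg_of_mem hϵ]

theorem numSamples_le (hΛ : Λ ∈ Set.Ioo (0 : ℝ) 1)
    (hϵ : ϵ ∈ Set.Ioo (0 : ℝ) 1) (hδ : δ ∈ Set.Ioo (0 : ℝ) 1) :
    (numSamples (ϵ / 3) δ Λ : ℝ) ≤ 901 * logFactor ϵ δ Λ ^ 3 * (1 / ϵ) ^ 2 := by
  have hl := one_le_logFactor hΛ hϵ hδ
  have he := one_le_inv_of_mem hϵ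
  have hε := termAccuracy_pos (third_mem hϵ) hΛ
  have hlog := log_two_div_le hΛ hϵ hδ
  have hlog0 : 0 ≤ Real.log (2 / δ) := by
    apply Real.log_nonneg
    rw [le_div_iff₀ hδ.1]
    linarith [hδ.2]
  have h1 : 1 ≤ logFactor ϵ δ Λ ^ 3 * (1 / ϵ) ^ 2 :=
    one_le_mul_of_one_le_of_one_le (one_le_pow₀ hl) (one_le_pow₀ he)
  -- `4 * 225 = 900`, and the ceiling contributes the last unit of `901`. The bound for `R` arises
  -- in the same way from `16 * 11 * 225 + 1`.
  have hq : 4 * Real.log (2 / δ) / termAccuracy (ϵ / 3) Λ ^ 2 ≤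
      4 * logFactor ϵ δ Λ * (225 * logFactor ϵ δ Λ ^ 2 * (1 / ϵ) ^ 2) := by
    rw [div_eq_mul_one_div]
    exact mul_le_mul (by linarith) (inv_termAccuracy_sq_le hΛ hϵ hδ) (by positivity)
      (by positivity)
  have hc := (Nat.ceil_lt_add_one
    (show 0 ≤ 4 * Real.log (2 / δ) / termAccuracy (ϵ / 3) Λ ^ 2 by positivity)).le
  rw [numSamples]
  linarith

theorem numTerms_le (hΛ : Λ ∈ Set.Ioo (0 : ℝ) 1)
    (hϵ : ϵ ∈ Set.Ioo (0 : ℝ) 1) (hδ : δ ∈ Set.Ioo (0 : ℝ) 1) :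
    (numTerms (ϵ / 3) Λ : ℝ) ≤ 210 * logFactor ϵ δ Λ ^ 2 * (1 / Λ) ^ 3 := by
  have hl := one_le_logFactor hΛ hϵ hδ
  have ha := one_le_inv_of_mem hΛ
  have h7 : 1 ≤ logFactor ϵ δ Λ * (1 / Λ) := one_le_mul_of_one_le_of_one_le hl ha
  have h8 : 1 ≤ logFactor ϵ δ Λ * (1 / Λ) ^ 2 :=
    one_le_mul_of_one_le_of_one_le hl (one_le_pow₀ ha)
  have hL : (⌊paramL (ϵ / 3) Λ⌋₊ : ℝ) + 1 ≤ 10 * logFactor ϵ δ Λ * (1 / Λ) ^ 2 := by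
    have h1 := Nat.floor_le (zero_le_one.trans (one_le_paramL (third_mem hϵ) hΛ))
    have h2 : paramL (ϵ / 3) Λ ≤ 9 * logFactor ϵ δ Λ * (1 / Λ) ^ 2 := by
      rw [paramL, ← one_div_pow]
      exact mul_le_mul_of_nonneg_right (logTerm_le hΛ hϵ hδ) (by positivity)
    linarith
  rw [numTerms]
  push_cast
  calc _ ≤ ∑ l ∈ Finset.range (⌊paramL (ϵ / 3) Λ⌋₊ + 1), 21 * logFactor ϵ δ Λ * (1 / Λ) :=
        Finset.sum_le_sum fun l h => by linarith [paramM_le hΛ hϵ hδ h]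
    _ = ((⌊paramL (ϵ / 3) Λ⌋₊ : ℝ) + 1) * (21 * logFactor ϵ δ Λ * (1 / Λ)) := by
        rw [Finset.sum_const, Finset.card_range, nsmul_eq_mul]
        push_cast
        rfl
    _ ≤ (10 * logFactor ϵ δ Λ * (1 / Λ) ^ 2) * (21 * logFactor ϵ δ Λ * (1 / Λ)) :=
        mul_le_mul_of_nonneg_right hL (by linarith)
    _ = _ := by ring

theorem log_numTerms_le (hΛ : Λ ∈ Set.Ioo (0 : ℝ) 1)
    (hϵ : ϵ ∈ Set.Ioo (0 : ℝ) 1) (hδ : δ ∈ Set.Ioo (0 : ℝ) 1) :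
    Real.log (2 * numTerms (ϵ / 3) Λ / δ) ≤ 11 * logFactor ϵ δ Λ := by
  have hl := logFactor_eq hΛ hϵ hδ
  have hl1 := one_le_logFactor hΛ hϵ hδ
  have h2 := hδ.1
  have h3 := hΛ.1
  have hN : (1 : ℝ) ≤ numTerms (ϵ / 3) Λ := by exact_mod_cast one_le_numTerms
  have hN' := Real.log_le_log (by linarith) (numTerms_le hΛ hϵ hδ)
  rw [Real.log_mul (by positivity) (by positivity),
    Real.log_mul (by positivity) (by positivity), Real.log_pow, Real.log_pow] at hN'
  have h210 := log_le_nat_mul_log_three (c := 210) (m := 5) (by norm_num) (by norm_num)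
  have h5 := Real.log_le_sub_one_of_pos (show 0 < logFactor ϵ δ Λ by linarith)
  push_cast at h210 hN'
  have e : 2 * (numTerms (ϵ / 3) Λ : ℝ) / δ = 2 / δ * numTerms (ϵ / 3) Λ := by ring
  rw [e, Real.log_mul (by positivity) (by positivity)]
  linarith [log_inv_nonneg_of_mem hΛ, log_inv_nonneg_of_mem hϵ, log_inv_nonneg_of_mem hδ,
    log_two_div_le hΛ hϵ hδ]

theorem numMeasurements_le (hΛ : Λ ∈ Set.Ioo (0 : ℝ) 1)
    (hϵ : ϵ ∈ Set.Ioo (0 : ℝ) 1) (hδ : δ ∈ Set.Ioo (0 : ℝ) 1) :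
    (numMeasurements (ϵ / 3) δ Λ : ℝ) ≤ 39601 * logFactor ϵ δ Λ ^ 3 * (1 / ϵ) ^ 2 := by
  have hl := one_le_logFactor hΛ hϵ hδ
  have he := one_le_inv_of_mem hϵ
  have hε := termAccuracy_pos (third_mem hϵ) hΛ
  have hlog := log_numTerms_le hΛ hϵ hδ
  have hlog0 := log_numTerms_pos (η := ϵ / 3) (Λ := Λ) hδ
  have h1 : 1 ≤ logFactor ϵ δ Λ ^ 3 * (1 / ϵ) ^ 2 :=
    one_le_mul_of_one_le_of_one_le (one_le_pow₀ hl) (one_le_pow₀ he)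
  have hq : 16 * Real.log (2 * numTerms (ϵ / 3) Λ / δ) / termAccuracy (ϵ / 3) Λ ^ 2 ≤
      176 * logFactor ϵ δ Λ * (225 * logFactor ϵ δ Λ ^ 2 * (1 / ϵ) ^ 2) := by
    rw [div_eq_mul_one_div]
    exact mul_le_mul (by linarith) (inv_termAccuracy_sq_le hΛ hϵ hδ) (by positivity)
      (by positivity)
  have hc := (Nat.ceil_lt_add_one (show 0 ≤ 16 * Real.log (2 * numTerms (ϵ / 3) Λ / δ) /
    termAccuracy (ϵ / 3) Λ ^ 2 by positivity)).le
  rw [numMeasurements]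
  linarith

end Parameters

/-! ### Worst-case totals over the support of the algorithm. -/

section Resources

variable {Λ ϵ δ : ℝ} {n : ℕ} {ρ : QubitMatrix n}

theorem cast_sum_map_le {α : Type} (l : List α) (f : α → ℕ) (c : ℝ)
    (h : ∀ a ∈ l, (f a : ℝ) ≤ c) : (((l.map f).sum : ℕ) : ℝ) ≤ l.length * c := by
  induction l with
  | nil => simp
  | cons a l ih =>
    have h1 := ih fun b hb => h b (List.mem_cons_of_mem _ hb)
    have h2 := h a List.mem_cons_self
    simp only [List.map_cons, List.sum_cons, List.length_cons]
    push_cast at h1 ⊢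
    linarith

/-- The cost of a pass is determined by the sampled pair alone, not by the measurement outcomes, so
a worst-case bound only needs a bound over the index set. -/
theorem exists_pair_of_mem_support_iteration (hΛ : Λ ∈ Set.Ioo (0 : ℝ) 1)
    (hϵ : ϵ ∈ Set.Ioo (0 : ℝ) 1) {r : Outcome} (hr : r ∈ (iteration (ϵ / 3) δ Λ ρ).support) :
    ∃ p ∈ indexSet (ϵ / 3) Λ,
      r.copies = numMeasurements (ϵ / 3) δ Λ * (numSteps (ϵ / 3) Λ p + 1) ∧
        r.gates = (termCircuit n (ϵ / 3) Λ p).gateCount := by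
  have hS := half_le_weightNorm (third_mem hϵ) hΛ
  rw [weightNorm_eq] at hS
  rw [iteration, PMF.mem_support_bind_iff] at hr
  obtain ⟨p, hp, hr⟩ := hr
  rw [PMF.mem_support_map_iff] at hr
  obtain ⟨bs, -, rfl⟩ := hr
  refine ⟨p, mem_of_mem_support_sampleProportional (fun p _ => weight_nonneg p) (by linarith) hp,
    ?_, rfl⟩
  change _ * (termCircuit n (ϵ / 3) Λ p).copyCount = _
  rw [termCircuit, copyCount_estimationCircuit]

theorem algorithm_resources (hn : 1 ≤ n) (hΛ : Λ ∈ Set.Ioo (0 : ℝ) 1)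
    (hϵ : ϵ ∈ Set.Ioo (0 : ℝ) 1) (hδ : δ ∈ Set.Ioo (0 : ℝ) 1)
    {r : Outcome} (hr : r ∈ (algorithm (ϵ / 3) δ Λ ρ).support) :
    (r.copies : ℝ) ≤ 901 * logFactor ϵ δ Λ ^ 3 * (1 / ϵ) ^ 2 *
        (39601 * logFactor ϵ δ Λ ^ 3 * (1 / ϵ) ^ 2 *
          (26462 * logFactor ϵ δ Λ ^ 3 * (1 / Λ) ^ 2 * (1 / ϵ))) ∧
      (r.gates : ℝ) ≤ 901 * logFactor ϵ δ Λ ^ 3 * (1 / ϵ) ^ 2 *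
        (84 * n * (26462 * logFactor ϵ δ Λ ^ 3 * (1 / Λ) ^ 2 * (1 / ϵ))) := by
  have hl := one_le_logFactor hΛ hϵ hδ
  have ha := one_le_inv_of_mem hΛ
  have he := one_le_inv_of_mem hϵ
  have hB := numSamples_le hΛ hϵ hδ
  have hR := numMeasurements_le hΛ hϵ hδ
  rw [algorithm, PMF.mem_support_map_iff] at hr
  obtain ⟨rs, hrs, rfl⟩ := hr
  obtain ⟨hlen, hmem⟩ := mem_support_iid hrs
  constructor
  · refine (cast_sum_map_le rs Outcome.copies
      (39601 * logFactor ϵ δ Λ ^ 3 * (1 / ϵ) ^ 2 *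
        (26462 * logFactor ϵ δ Λ ^ 3 * (1 / Λ) ^ 2 * (1 / ϵ))) fun r hr => ?_).trans ?_
    · obtain ⟨p, hp, h, -⟩ := exists_pair_of_mem_support_iteration hΛ hϵ (hmem r hr)
      rw [h]
      push_cast
      exact mul_le_mul hR (numSteps_add_one_le hΛ hϵ hδ hp) (by positivity) (by positivity)
    · rw [hlen]
      exact mul_le_mul_of_nonneg_right hB (by positivity)
  · refine (cast_sum_map_le rs Outcome.gates
      (84 * n * (26462 * logFactor ϵ δ Λ ^ 3 * (1 / Λ) ^ 2 * (1 / ϵ))) fun r hr => ?_).trans ?_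
    · obtain ⟨p, hp, -, h⟩ := exists_pair_of_mem_support_iteration hΛ hϵ (hmem r hr)
      have hg : (r.gates : ℝ) ≤ 84 * n * (numSteps (ϵ / 3) Λ p + 1) := by
        rw [h]
        exact_mod_cast gateCount_estimationCircuit_le hn _ _
      exact hg.trans (mul_le_mul_of_nonneg_left (numSteps_add_one_le hΛ hϵ hδ hp) (by positivity))
    · rw [hlen]
      exact mul_le_mul_of_nonneg_right hB (by positivity)

end Resources

end EntropyEstimation

end

/-- Run with accuracy parameter `ϵ / 3`, the algorithm outputs an `ϵ`-accurate estimate of the von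
Neumann entropy with probability at least `1 - δ`, and in every run the numbers of copies and of
single/two-qubit gates obey the bounds, with an absolute constant and an absolute power of a
logarithm. -/
theorem theorem1 :
    ∃ (C : ℝ) (k : ℕ), 0 < C ∧
      ∀ (n : ℕ) (_ : 1 ≤ n) (ρ : EntropyEstimation.QubitMatrix n)
        (_ : EntropyEstimation.IsDensityMatrix ρ)
        (Λ ϵ δ : ℝ) (_ : Λ ∈ Set.Ioo (0 : ℝ) 1) (_ : ϵ ∈ Set.Ioo (0 : ℝ) 1)
        (_ : δ ∈ Set.Ioo (0 : ℝ) 1)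
        (_ : ∀ lam ∈ spectrum ℝ ρ, lam ≠ 0 → Λ ≤ lam),
        ENNReal.ofReal (1 - δ) ≤
            (EntropyEstimation.algorithm (ϵ / 3) δ Λ ρ).toOuterMeasure
              {r | |r.estimate - EntropyEstimation.vonNeumannEntropy ρ| ≤ ϵ} ∧
          ∀ r ∈ (EntropyEstimation.algorithm (ϵ / 3) δ Λ ρ).support,
            (r.copies : ℝ) ≤ C * Real.log (3 / (ϵ * δ * Λ)) ^ k * (1 / (ϵ ^ 5 * Λ ^ 2)) ∧
            (r.gates : ℝ) ≤ C * Real.log (3 / (ϵ * δ * Λ)) ^ k * (n / (ϵ ^ 3 * Λ ^ 2)) := by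
  -- The constants of `B`, `R` and `Q + 1` are multiplied, and each carries a third power of the
  -- logarithm. The gate bound has `84` in place of `39601` and only the sixth power, so the same
  -- pair serves both.
  refine ⟨901 * 39601 * 26462, 9, by norm_num, fun n hn ρ hρ Λ ϵ δ hΛ hϵ hδ hspec =>
    ⟨?_, fun r hr => ?_⟩⟩
  · have h := EntropyEstimation.algorithm_accuracy (EntropyEstimation.third_mem hϵ) hΛ hδ hρ hspec
    rwa [mul_div_cancel₀ ϵ (by norm_num : (3 : ℝ) ≠ 0)] at h
  · obtain ⟨h1, h2⟩ := EntropyEstimation.algorithm_resources hn hΛ hϵ hδ hr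
    have hl := EntropyEstimation.one_le_logFactor hΛ hϵ hδ
    change _ ≤ 901 * 39601 * 26462 * EntropyEstimation.logFactor ϵ δ Λ ^ 9 * _ ∧
      _ ≤ 901 * 39601 * 26462 * EntropyEstimation.logFactor ϵ δ Λ ^ 9 * _
    have hϵ0 := hϵ.1
    have hΛ0 := hΛ.1
    refine ⟨h1.trans_eq (by field_simp), h2.trans ?_⟩
    have h3 : EntropyEstimation.logFactor ϵ δ Λ ^ 6 ≤ EntropyEstimation.logFactor ϵ δ Λ ^ 9 :=
      pow_le_pow_right₀ hl (by norm_num)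
    have h4 : 0 ≤ EntropyEstimation.logFactor ϵ δ Λ ^ 9 := by positivity
    calc _ = 901 * 84 * 26462 * EntropyEstimation.logFactor ϵ δ Λ ^ 6 * (n / (ϵ ^ 3 * Λ ^ 2)) := by
          field_simp
      _ ≤ _ := mul_le_mul_of_nonneg_right (by linarith) (by positivity)
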